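/- Let $M$ be a smooth connected manifold (Hausdorff, second countable) of dimension $n$, let $S^1=\mathbb R/2\pi\mathbb Z$, and consider the Kepler control systems on $S^1\times M$, indexed by $\varepsilon>0$, $$(\mathcal K_\varepsilon)\qquad \dot\theta=\omega(\theta,x)+g(\theta,x)\,v,\qquad \dot x=G(\theta,x)\,v,\qquad v\in\mathbb R^m,\ \|v\|\le\varepsilon ,$$ where $\omega$, $g=(g_1,\dots,g_m)$ and the vector fields $G_1(\theta,\cdot),\dots,G_m(\theta,\cdot)$ on $M$ forming the columns of $G$ are smooth in $(\theta,x)\in S^1\times M$, and $\omega\ge k$ on $S^1\times M$ for some constant $k>0$. Solutions are absolutely continuous and satisfy the equations almost everywhere, for some measurable control $v(\cdot)$ with $\|v(t)\|\le\varepsilon$. Assume the full rank condition: for every $(\theta,x)\in S^1\times M$ the vectors $\frac{\partial^jG_i}{\partial\theta^j}(\theta,x)$, $1\le i\le m$, $j\ge0$, span $T_xM$. The average system is the differential inclusion $\dot x\in\mathcal E(x)$ with $$\mathcal E(x)=\Bigl\{\ \overline\omega(x)\,\frac1{2\pi}\int_0^{2\pi}\frac{G(\theta,x)}{\omega(\theta,x)}\,U(\theta)\,d\theta\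 :\ U\in L^\infty([0,2\pi],\mathbb R^m),\ \|U\|_\infty\le1\Bigr\},\qquad \frac1{\overline\omega(x)}=\frac1{2\pi}\int_0^{2\pi}\frac{d\theta}{\omega(\theta,x)} ;$$ its solutions are the absolutely continuous curves $x(\cdot)$ with $\dot x(t)\in\mathcal E(x(t))$ for almost every $t$. Fix $x_0,x_1\in M$. Let $T_\varepsilon\in[0,+\infty]$ be the infimum of the times $T\ge 0$ such that, for some $\theta_0,\theta_1\in S^1$, a solution of $(\mathcal K_\varepsilon)$ on $[0,T]$ goes from $(\theta_0,x_0)$ to $(\theta_1,x_1)$, and let $T_0$ be the infimum of the times $T\ge0$ such that a solution of the average system on $[0,T]$ goes from $x_0$ to $x_1$. A solution that realizes $T_\varepsilon$ (respectively $T_0$) is called minimizing. 1. $T_0$ is finite, $\limsup_{\varepsilon\to0^+}\varepsilon T_\varepsilon\le T_0$, and $\varepsilon T_\varepsilon$ is bounded as $\varepsilon\to0^+$. 2. Suppose that for all sufficiently small $\varepsilon>0$ there is a minimizing solution $(\theta_\varepsilon,x_\varepsilon):[0,T_\varepsilon]\to S^1\times M$ of $(\mathcal K_\varepsilon)$, and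 that there is a compact set $S\subset M$ with $x_\varepsilon([0,T_\varepsilon])\subset S$ for all sufficiently small $\varepsilon>0$. Let $\hat x_\varepsilon(\tau)=x_\varepsilon(\tau/\varepsilon)$ for $0\le\tau\le\varepsilon T_\varepsilon$ and $\hat x_\varepsilon(\tau)=x_1$ for $\tau\ge\varepsilon T_\varepsilon$. Then, for $\varepsilon>0$ small, the restrictions of the curves $\hat x_\varepsilon$ to $[0,T_0]$ stay in a compact subset of $C^0([0,T_0],M)$ (with the topology of uniform convergence); all their accumulation points in $C^0([0,T_0],M)$ as $\varepsilon\to0^+$ are minimizing solutions of the average system; and $\lim_{\varepsilon\to0^+}\varepsilon T_\varepsilon=T_0$. -/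

import Mathlib

open Set Filter Topology MeasureTheory Manifold ContDiff
open scoped ENNReal

/-- The data of a Kepler control system with small control on `S¹ × M`,
`θ' = ω(θ, x) + g(θ, x) v`, `x' = G(θ, x) v`, `‖v‖ ≤ ε`, where `M` is an `n`-dimensional manifold
and `v` is `m`-dimensional; `pulse` is `ω`. Maps on `S¹ = ℝ / 2πℤ` are identified with `2π`-periodic
maps on `ℝ`. `G i θ` and `g i θ` are the `i`-th columns of `G` and `g`. -/
structure KeplerSystem (n m : ℕ) (M : Type*) [TopologicalSpace M]
    [ChartedSpace (EuclideanSpace ℝ (Fin n)) M] [IsManifold (𝓡 n) ∞ M] where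
  pulse : ℝ → M → ℝ
  g : Fin m → ℝ → M → ℝ
  G : Fin m → ℝ → (x : M) → TangentSpace (𝓡 n) x
  pulse_periodic : ∀ θ x, pulse (θ + 2 * Real.pi) x = pulse θ x
  g_periodic : ∀ i θ x, g i (θ + 2 * Real.pi) x = g i θ x
  G_periodic : ∀ i θ x, G i (θ + 2 * Real.pi) x = G i θ x
  pulse_smooth : ContMDiff (𝓘(ℝ, ℝ).prod (𝓡 n)) 𝓘(ℝ, ℝ) ∞ (fun q : ℝ × M => pulse q.1 q.2)
  g_smooth : ∀ i, ContMDiff (𝓘(ℝ, ℝ).prod (𝓡 n)) 𝓘(ℝ, ℝ) ∞ (fun q : ℝ × M => g i q.1 q.2)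
  G_smooth : ∀ i, ContMDiff (𝓘(ℝ, ℝ).prod (𝓡 n)) (𝓡 n).tangent ∞
    (fun q : ℝ × M => (⟨q.2, G i q.1 q.2⟩ : TangentBundle (𝓡 n) M))
  pulse_lower : ∃ k : ℝ, 0 < k ∧ ∀ θ x, k ≤ pulse θ x

section Curves

variable {n : ℕ} {M : Type*} [TopologicalSpace M] [ChartedSpace (EuclideanSpace ℝ (Fin n)) M]

/-- A continuous curve in the manifold `M` is absolutely continuous on `[0, T]`: every piece of it
that lies in the domain of a chart is absolutely continuous in this chart. -/
def ACCurveOn (x : C(ℝ, M)) (T : ℝ) : Prop :=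
  ∀ (p : M) (a b : ℝ), 0 ≤ a → a ≤ b → b ≤ T →
    (∀ t ∈ Icc a b, x t ∈ (extChartAt (𝓡 n) p).source) →
    AbsolutelyContinuousOnInterval (fun t => extChartAt (𝓡 n) p (x t)) a b

/-- The curve `x` has velocity `w` at time `t`. -/
def HasVelocityAt (x : C(ℝ, M)) (t : ℝ) (w : TangentSpace (𝓡 n) (x t)) : Prop :=
  HasMFDerivAt 𝓘(ℝ, ℝ) (𝓡 n) x t ((1 : ℝ →L[ℝ] ℝ).smulRight w)

/-- For a curve `x` given on `[0, T]`: the curve `τ ↦ x (τ / ε)` in slow time, prolonged by the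
constant `x T` for `τ ≥ ε T` and by `x 0` for `τ ≤ 0`. -/
noncomputable def slowCurve (ε T : ℝ) (x : C(ℝ, M)) : C(ℝ, M) :=
  x.comp ⟨fun τ => max 0 (min (τ / ε) T), by fun_prop⟩

end Curves

namespace KeplerSystem

variable {n m : ℕ} {M : Type*} [TopologicalSpace M]
    [ChartedSpace (EuclideanSpace ℝ (Fin n)) M] [IsManifold (𝓡 n) ∞ M]

/-- The scalar `g(θ, x) v`. -/
noncomputable def gApply (K : KeplerSystem n m M) (θ : ℝ) (x : M)
    (v : EuclideanSpace ℝ (Fin m)) : ℝ :=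
  ∑ i, v i * K.g i θ x

/-- The tangent vector `G(θ, x) v` at `x`. -/
noncomputable def GApply (K : KeplerSystem n m M) (θ : ℝ) (x : M)
    (v : EuclideanSpace ℝ (Fin m)) : TangentSpace (𝓡 n) x :=
  ∑ i, v i • K.G i θ x

/-- The vector `G_i(θ, x)`, seen in the normed space `ℝⁿ` underlying `T_x M`; derivatives with
respect to `θ` and integrals over `θ`, at fixed `x`, are taken there. -/
def colVec (K : KeplerSystem n m M) (i : Fin m) (x : M) (θ : ℝ) : EuclideanSpace ℝ (Fin n) :=
  K.G i θ x

/-- The vector `G(θ, x) v`, seen in the normed space `ℝⁿ` underlying `T_x M`. -/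
noncomputable def GVec (K : KeplerSystem n m M) (θ : ℝ) (x : M)
    (v : EuclideanSpace ℝ (Fin m)) : EuclideanSpace ℝ (Fin n) :=
  ∑ i, v i • K.colVec i x θ

/-- `r(θ, x)`, the rank of the vectors `∂ʲG_i/∂θʲ (θ, x)`, `1 ≤ i ≤ m`, `j ≥ 0`. -/
noncomputable def r (K : KeplerSystem n m M) (θ : ℝ) (x : M) : ℕ :=
  Module.finrank ℝ (Submodule.span ℝ
    (range fun q : ℕ × Fin m => iteratedDeriv q.1 (K.colVec q.2 x) θ))

/-- The full rank case. -/
def FullRank (K : KeplerSystem n m M) : Prop :=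
  ∀ θ x, K.r θ x = n

/-- `(θ, x)` is a solution on `[0, T]` of the Kepler control system with bound `ε` on the control,
for some admissible control. The angle is represented by a continuous real-valued lift. -/
def IsSolution (K : KeplerSystem n m M) (ε T : ℝ) (θ : ℝ → ℝ) (x : C(ℝ, M)) : Prop :=
  AbsolutelyContinuousOnInterval θ 0 T ∧ ACCurveOn (n := n) x T ∧
  ∃ v : ℝ → EuclideanSpace ℝ (Fin m), Measurable v ∧ (∀ t ∈ Icc 0 T, ‖v t‖ ≤ ε) ∧
    ∀ᵐ t ∂(volume.restrict (Icc 0 T)),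
      HasDerivAt θ (K.pulse (θ t) (x t) + K.gApply (θ t) (x t) (v t)) t ∧
      HasVelocityAt x t (K.GApply (θ t) (x t) (v t))

/-- `T_ε(x₀, x₁)`: the infimum of the times in which some `(θ₁, x₁)` can be reached from some
`(θ₀, x₀)` in the Kepler control system with bound `ε` on the control. -/
noncomputable def minTime (K : KeplerSystem n m M) (ε : ℝ) (x₀ x₁ : M) : ℝ≥0∞ :=
  sInf {s | ∃ T : ℝ, 0 ≤ T ∧ s = ENNReal.ofReal T ∧
    ∃ (θ : ℝ → ℝ) (x : C(ℝ, M)), K.IsSolution ε T θ x ∧ x 0 = x₀ ∧ x T = x₁}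

/-- `(θ, x)` is a minimizing solution on `[0, T]`, where `T = T_ε(x₀, x₁)`. -/
def IsMinimizing (K : KeplerSystem n m M) (ε : ℝ) (x₀ x₁ : M) (T : ℝ) (θ : ℝ → ℝ)
    (x : C(ℝ, M)) : Prop :=
  0 ≤ T ∧ ENNReal.ofReal T = K.minTime ε x₀ x₁ ∧ K.IsSolution ε T θ x ∧ x 0 = x₀ ∧ x T = x₁

/-- The averaged pulsation: `1 / ω̄(x) = (1 / 2π) ∫₀^{2π} dθ / ω(θ, x)`. -/
noncomputable def pulseBar (K : KeplerSystem n m M) (x : M) : ℝ :=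
  ((2 * Real.pi)⁻¹ * ∫ θ in (0 : ℝ)..(2 * Real.pi), (K.pulse θ x)⁻¹)⁻¹

/-- `Ḡ(x, U) = ω̄(x) (1 / 2π) ∫₀^{2π} G(θ, x) U(θ) / ω(θ, x) dθ`. -/
noncomputable def GBar (K : KeplerSystem n m M) (x : M)
    (U : ℝ → EuclideanSpace ℝ (Fin m)) : EuclideanSpace ℝ (Fin n) :=
  (K.pulseBar x * (2 * Real.pi)⁻¹) •
    ∫ θ in (0 : ℝ)..(2 * Real.pi), (K.pulse θ x)⁻¹ • K.GVec θ x (U θ)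

/-- The velocity set of the average system: all `Ḡ(x, U)` with `U ∈ L^∞([0, 2π], ℝᵐ)` and
`‖U‖_∞ ≤ 1`. -/
def velocitySet (K : KeplerSystem n m M) (x : M) : Set (TangentSpace (𝓡 n) x) :=
  {w | ∃ U : ℝ → EuclideanSpace ℝ (Fin m),
    AEStronglyMeasurable U (volume.restrict (Icc 0 (2 * Real.pi))) ∧
    (∀ᵐ θ ∂(volume.restrict (Icc 0 (2 * Real.pi))), ‖U θ‖ ≤ 1) ∧ w = K.GBar x U}

/-- `x` is a solution on `[0, T]` of the average control system `x' ∈ velocitySet x`. -/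
def IsAvgSolution (K : KeplerSystem n m M) (T : ℝ) (x : C(ℝ, M)) : Prop :=
  ACCurveOn (n := n) x T ∧
  ∀ᵐ t ∂(volume.restrict (Icc 0 T)), ∃ w ∈ K.velocitySet (x t), HasVelocityAt x t w

/-- `T₀(x₀, x₁)`: the infimum of the times in which `x₁` can be reached from `x₀` in the average
control system. -/
noncomputable def avgMinTime (K : KeplerSystem n m M) (x₀ x₁ : M) : ℝ≥0∞ :=
  sInf {s | ∃ T : ℝ, 0 ≤ T ∧ s = ENNReal.ofReal T ∧
    ∃ x : C(ℝ, M), K.IsAvgSolution T x ∧ x 0 = x₀ ∧ x T = x₁}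

/-- `x` is a minimizing solution of the average system on `[0, T]`, where `T = T₀(x₀, x₁)`. -/
def IsAvgMinimizing (K : KeplerSystem n m M) (x₀ x₁ : M) (T : ℝ) (x : C(ℝ, M)) : Prop :=
  0 ≤ T ∧ ENNReal.ofReal T = K.avgMinTime x₀ x₁ ∧ K.IsAvgSolution T x ∧ x 0 = x₀ ∧ x T = x₁

end KeplerSystem

/-! In the slow time `τ = ε t` the angle turns at rate of order `1 / ε` while `x` moves at speed of
order one, so `x` only feels averages over a turn. Velocities are measured by the support function
`K.supp x l`, the average over `θ` of `‖l ∘ G(θ, x)‖` with the weight `ω̄ / (2π ω)`. Under full rank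
no nonzero form kills `G(θ, x)` for all `θ`. Hence `K.supp x l` dominates a multiple of `‖l‖`, so
`0` is interior to the velocity set, and this set is exactly the set of `w` with `l w ≤ K.supp x l`
for all `l` (`apply_le_supp`, `FullRank.mem_velocitySet`).

The average system is at least as fast in the limit. For a smooth function `f`, the rate of `f`
along a Kepler solution is at most `ε ‖df ∘ G(θ, x)‖`, and the oscillation of this bound around its
average is removed by a bounded periodic corrector (`exists_averaging_bound`). A uniform limit of
slow curves therefore has increments bounded by the support function, and its velocities lie in the
average velocity sets (`FullRank.isAvgSolution_of_tendsto`).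

Conversely, an average solution can be followed by Kepler solutions at the cost of a time factor
arbitrarily close to `1` (`FullRank.eventually_kReach`). On a short piece, in a chart, a periodic
control realizes the displacement up to a small error; a fixed point argument on a small correction
of the control makes the endpoint exact (`exists_steering`). The pieces use whole numbers of turns,
so they can be concatenated. This gives `limsup ε T_ε ≤ T₀`; finiteness of `T₀` follows from local
controllability of the average system and connectedness.

For minimizing solutions in a compact set, the slow curves are equi-Lipschitz, so Arzelà-Ascoli
applies. Along an ultrafilter `ε T_ε` tends to some `L ≤ T₀`, and the limit curve is an average
solution that reaches `x₁` in time `L`, whence `T₀ ≤ L`. Thus `ε T_ε` tends to `T₀`, and every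
accumulation point is minimizing. -/

/-! ### Absolutely continuous functions on intervals -/

/-- A transitive relation between real numbers that holds locally on `[a, b]` holds between `a` and
`b`. -/
theorem rel_of_locally_Icc {P : ℝ → ℝ → Prop} {a b : ℝ} (hab : a ≤ b)
    (trans : ∀ r s t, a ≤ r → r ≤ s → s ≤ t → t ≤ b → P r s → P s t → P r t)
    (loc : ∀ t ∈ Icc a b, ∃ U ∈ 𝓝 t, ∀ r s, Icc r s ⊆ U → a ≤ r → r ≤ s → s ≤ b → P r s) :
    P a b := by
  choose! U hU hP using loc
  obtain ⟨t, h0, hmono, ⟨m, hm⟩, hsub⟩ := exists_monotone_Icc_subset_open_cover_Icc hab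
    (c := fun i : Icc a b => ((↑) : Icc a b → ℝ) ⁻¹' interior (U i))
    (fun i => isOpen_interior.preimage continuous_subtype_val)
    (fun i _ => mem_iUnion.2 ⟨i, mem_interior_iff_mem_nhds.2 (hU i i.2)⟩)
  have step : ∀ k, P (t k) (t (k + 1)) := fun k => by
    obtain ⟨i, hi⟩ := hsub k
    have hle := hmono (Nat.le_succ k)
    exact hP i i.2 _ _ (fun z hz => interior_subset
      (hi (show (⟨z, (t k).2.1.trans hz.1, hz.2.trans (t (k + 1)).2.2⟩ : Icc a b) ∈ _ from hz)))
      (t k).2.1 hle (t (k + 1)).2.2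
  have main : ∀ k, P a (t (k + 1)) := fun k => by
    induction k with
    | zero => have := step 0; rwa [h0] at this
    | succ k ih =>
      exact trans _ _ _ le_rfl (t (k + 1)).2.1 (hmono (Nat.le_succ _)) (t _).2.2 ih (step _)
  have := main m
  rwa [hm (m + 1) (by omega)] at this

section AC

variable {X Y : Type*} [PseudoMetricSpace X] [PseudoMetricSpace Y]

/-- Applied to the clamps `min · c` and `max · c`: they shrink half-open intervals, so they keep a
disjoint family disjoint. -/
theorem uIoc_map_subset {φ : ℝ → ℝ} (hφ : Monotone φ)
    (h : ∀ x y, x ≤ y → Ioc (φ x) (φ y) ⊆ Ioc x y) (x y : ℝ) :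
    uIoc (φ x) (φ y) ⊆ uIoc x y := by
  rcases le_total x y with hxy | hxy
  · rw [uIoc_of_le hxy, uIoc_of_le (hφ hxy)]; exact h x y hxy
  · rw [uIoc_of_ge hxy, uIoc_of_ge (hφ hxy)]; exact h y x hxy

/-- Every interval of a family is cut at `c`: clamping from above and from below gives two families,
one on each side, whose total lengths are not larger, and the triangle inequality at `c` adds the
two variations. -/
theorem AbsolutelyContinuousOnInterval.union {f : ℝ → X} {a b c : ℝ} (hac : a ≤ c) (hcb : c ≤ b)
    (h₁ : AbsolutelyContinuousOnInterval f a c) (h₂ : AbsolutelyContinuousOnInterval f c b) :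
    AbsolutelyContinuousOnInterval f a b := by
  rw [absolutelyContinuousOnInterval_iff] at h₁ h₂ ⊢
  intro ε hε
  obtain ⟨δ₁, hδ₁, H₁⟩ := h₁ (ε / 2) (by positivity)
  obtain ⟨δ₂, hδ₂, H₂⟩ := h₂ (ε / 2) (by positivity)
  refine ⟨min δ₁ δ₂, lt_min hδ₁ hδ₂, fun E hE hlt => ?_⟩
  have hab := hac.trans hcb
  have hmin := H₁ (E.1, fun i => (min (E.2 i).1 c, min (E.2 i).2 c)) ⟨fun i hi => by
      have := hE.1 i hi
      rw [uIcc_of_le hab] at this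
      rw [uIcc_of_le hac]
      simp only [mem_Icc] at this ⊢
      exact ⟨⟨le_min this.1.1 hac, min_le_right _ _⟩, ⟨le_min this.2.1 hac, min_le_right _ _⟩⟩,
    fun i hi j hj hij => (hE.2 hi hj hij).mono
      (uIoc_map_subset (φ := fun x => min x c) (fun x y h => min_le_min_right c h)
        (fun x y h z hz => by
          simp only [mem_Ioc, min_lt_iff, le_min_iff] at hz ⊢
          exact ⟨hz.1.resolve_right (not_lt.2 hz.2.2), hz.2.1⟩) _ _)
      (uIoc_map_subset (φ := fun x => min x c) (fun x y h => min_le_min_right c h)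
        (fun x y h z hz => by
          simp only [mem_Ioc, min_lt_iff, le_min_iff] at hz ⊢
          exact ⟨hz.1.resolve_right (not_lt.2 hz.2.2), hz.2.1⟩) _ _)⟩
    (lt_of_le_of_lt (Finset.sum_le_sum fun i _ => by
      simp only [Real.dist_eq]
      exact (abs_min_sub_min_le_max _ _ _ _).trans (by simp)) (hlt.trans_le (min_le_left _ _)))
  have hmax := H₂ (E.1, fun i => (max (E.2 i).1 c, max (E.2 i).2 c)) ⟨fun i hi => by
      have := hE.1 i hi
      rw [uIcc_of_le hab] at this
      rw [uIcc_of_le hcb]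
      simp only [mem_Icc] at this ⊢
      exact ⟨⟨le_max_right _ _, max_le this.1.2 hcb⟩, ⟨le_max_right _ _, max_le this.2.2 hcb⟩⟩,
    fun i hi j hj hij => (hE.2 hi hj hij).mono
      (uIoc_map_subset (φ := fun x => max x c) (fun x y h => max_le_max_right c h)
        (fun x y h z hz => by
          simp only [mem_Ioc, max_lt_iff, le_max_iff] at hz ⊢
          exact ⟨hz.1.1, hz.2.resolve_right (not_le.2 hz.1.2)⟩) _ _)
      (uIoc_map_subset (φ := fun x => max x c) (fun x y h => max_le_max_right c h)
        (fun x y h z hz => by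
          simp only [mem_Ioc, max_lt_iff, le_max_iff] at hz ⊢
          exact ⟨hz.1.1, hz.2.resolve_right (not_le.2 hz.1.2)⟩) _ _)⟩
    (lt_of_le_of_lt (Finset.sum_le_sum fun i _ => by
      simp only [Real.dist_eq]
      exact (abs_max_sub_max_le_max _ _ _ _).trans (by simp)) (hlt.trans_le (min_le_right _ _)))
  refine lt_of_le_of_lt ?_ ((add_lt_add hmin hmax).trans_eq (add_halves ε))
  rw [← Finset.sum_add_distrib]
  refine Finset.sum_le_sum fun i _ => ?_
  dsimp only
  rcases le_total (E.2 i).1 c with h1 | h1 <;> rcases le_total (E.2 i).2 c with h2 | h2 <;>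
    simp only [min_eq_left h1, min_eq_left h2, max_eq_right h1, max_eq_right h2, min_eq_right h1,
      min_eq_right h2, max_eq_left h1, max_eq_left h2, dist_self, add_zero, zero_add, le_refl,
      dist_triangle]
  rw [add_comm]
  exact dist_triangle _ _ _

theorem AbsolutelyContinuousOnInterval.congr {f g : ℝ → X} {a b : ℝ}
    (hf : AbsolutelyContinuousOnInterval f a b) (h : EqOn f g (uIcc a b)) :
    AbsolutelyContinuousOnInterval g a b := by
  rw [absolutelyContinuousOnInterval_iff] at hf ⊢
  intro ε hε
  obtain ⟨δ, hδ, H⟩ := hf ε hε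
  refine ⟨δ, hδ, fun E hE hlt => (Finset.sum_congr rfl fun i hi => ?_).trans_lt (H E hE hlt)⟩
  rw [h (hE.1 i hi).1, h (hE.1 i hi).2]

theorem AbsolutelyContinuousOnInterval.of_locally {f : ℝ → X} {a b : ℝ} (hab : a ≤ b)
    (loc : ∀ t ∈ Icc a b, ∃ U ∈ 𝓝 t, ∀ r s, Icc r s ⊆ U → a ≤ r → r ≤ s → s ≤ b →
      AbsolutelyContinuousOnInterval f r s) :
    AbsolutelyContinuousOnInterval f a b :=
  rel_of_locally_Icc hab (fun _ _ _ _ h₁ h₂ _ => AbsolutelyContinuousOnInterval.union h₁ h₂) loc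

theorem LipschitzOnWith.comp_absolutelyContinuousOnInterval {f : ℝ → X} {g : X → Y} {s : Set X}
    {K : NNReal} {a b : ℝ} (hg : LipschitzOnWith K g s) (hf : AbsolutelyContinuousOnInterval f a b)
    (hs : ∀ t ∈ uIcc a b, f t ∈ s) : AbsolutelyContinuousOnInterval (fun t => g (f t)) a b := by
  rw [absolutelyContinuousOnInterval_iff] at hf ⊢
  intro ε hε
  obtain ⟨δ, hδ, H⟩ := hf (ε / (K + 1)) (by positivity)
  refine ⟨δ, hδ, fun E hE hlt => ?_⟩
  calc ∑ i ∈ Finset.range E.1, dist (g (f (E.2 i).1)) (g (f (E.2 i).2))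
      ≤ ∑ i ∈ Finset.range E.1, (K + 1 : ℝ) * dist (f (E.2 i).1) (f (E.2 i).2) :=
        Finset.sum_le_sum fun i hi =>
          (hg.dist_le_mul _ (hs _ (hE.1 i hi).1) _ (hs _ (hE.1 i hi).2)).trans
            (mul_le_mul_of_nonneg_right (by simp) dist_nonneg)
    _ < (K + 1 : ℝ) * (ε / (K + 1)) := by
        rw [← Finset.mul_sum]; exact mul_lt_mul_of_pos_left (H E hE hlt) (by positivity)
    _ = ε := by field_simp

/-- The mean value inequality, by integrating the derivative. All differential estimates along
solutions go through it. -/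
theorem AbsolutelyContinuousOnInterval.sub_le_of_ae_deriv_le {F : ℝ → ℝ} {a b c : ℝ} (hab : a ≤ b)
    (hF : AbsolutelyContinuousOnInterval F a b)
    (h : ∀ᵐ t ∂(volume.restrict (Icc a b)), ∃ d, HasDerivAt F d t ∧ d ≤ c) :
    F b - F a ≤ c * (b - a) := by
  rw [← hF.integral_deriv_eq_sub, mul_comm, ← smul_eq_mul, ← intervalIntegral.integral_const]
  refine intervalIntegral.integral_mono_ae_restrict hab hF.intervalIntegrable_deriv
    intervalIntegrable_const ?_
  filter_upwards [h] with t ⟨d, hd, hdc⟩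
  rwa [hd.deriv]

/-- A real function which is locally `C`-Lipschitz on an interval is `C`-Lipschitz. -/
theorem abs_sub_le_of_ae_deriv_le {F : ℝ → ℝ} {a b c : ℝ} (hab : a ≤ b)
    (hF : AbsolutelyContinuousOnInterval F a b)
    (h : ∀ᵐ t ∂(volume.restrict (Icc a b)), ∃ d, HasDerivAt F d t ∧ |d| ≤ c) :
    |F b - F a| ≤ c * (b - a) := by
  rw [abs_le']
  refine ⟨hF.sub_le_of_ae_deriv_le hab ?_, ?_⟩
  · filter_upwards [h] with t ⟨d, hd, hdc⟩ using ⟨d, hd, (le_abs_self d).trans hdc⟩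
  · have := hF.fun_neg.sub_le_of_ae_deriv_le (c := c) hab ?_
    · linarith
    · filter_upwards [h] with t ⟨d, hd, hdc⟩ using ⟨-d, hd.fun_neg, (neg_le_abs d).trans hdc⟩

end AC

/-! ### Averages of linear maps over the unit ball of `L^∞` -/

/-- A substitute for weak compactness: the points of minimal norm of a bounded decreasing sequence
of closed convex sets form a Cauchy sequence. -/
theorem exists_mem_iInter_of_antitone_convex {H : Type*} [NormedAddCommGroup H]
    [InnerProductSpace ℝ H] [CompleteSpace H] (C : ℕ → Set H) (hne : ∀ k, (C k).Nonempty)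
    (hcl : ∀ k, IsClosed (C k)) (hcv : ∀ k, Convex ℝ (C k)) (hanti : Antitone C)
    {R : ℝ} (hR : ∀ u ∈ C 0, ‖u‖ ≤ R) : ∃ u, ∀ k, u ∈ C k := by
  have hmin : ∀ k, ∃ v ∈ C k, ∀ w ∈ C k, ‖v‖ ≤ ‖w‖ := fun k => by
    obtain ⟨v, hv, hv'⟩ := exists_norm_eq_iInf_of_complete_convex (hne k) (hcl k).isComplete
      (hcv k) 0
    refine ⟨v, hv, fun w hw => ?_⟩
    simp only [zero_sub, norm_neg] at hv'
    rw [hv']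
    exact ciInf_le (f := fun w : C k => ‖(w : H)‖)
      ⟨0, Set.forall_mem_range.2 fun _ => norm_nonneg _⟩ ⟨w, hw⟩
  choose v hv hvmin using hmin
  have hmono : Monotone fun k => ‖v k‖ ^ 2 := fun i j hij => by
    have := hvmin i _ (hanti hij (hv j))
    dsimp only
    gcongr
  have hbdd : BddAbove (range fun k => ‖v k‖ ^ 2) := ⟨R ^ 2, by
    rintro _ ⟨k, rfl⟩
    have := hR _ (hanti (Nat.zero_le k) (hv k))
    dsimp only
    gcongr⟩
  have hlim := tendsto_atTop_ciSup hmono hbdd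
  -- The midpoint of `v i` and `v j` lies in `C i`, so its norm is at least `‖v i‖`; the
  -- parallelogram law turns this into a bound of the distance by the gap between the squared norms,
  -- which converge.
  have key : ∀ i j, i ≤ j → ‖v i - v j‖ ^ 2 ≤ 2 * (‖v j‖ ^ 2 - ‖v i‖ ^ 2) := fun i j hij => by
    have hmid : (1 / 2 : ℝ) • v i + (1 / 2 : ℝ) • v j ∈ C i :=
      hcv i (hv i) (hanti hij (hv j)) (by norm_num) (by norm_num) (by norm_num)
    have h1 := hvmin i _ hmid
    rw [← smul_add, norm_smul] at h1
    have h2 : 2 * ‖v i‖ ≤ ‖v i + v j‖ := by norm_num at h1; linarith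
    have h3 := parallelogram_law_with_norm ℝ (v i) (v j)
    have h4 : (2 * ‖v i‖) ^ 2 ≤ ‖v i + v j‖ ^ 2 := by gcongr
    nlinarith
  have hcauchy : CauchySeq v := by
    rw [Metric.cauchySeq_iff']
    intro ε hε
    obtain ⟨N, hN⟩ := (Metric.cauchySeq_iff'.1 hlim.cauchySeq) (ε ^ 2 / 2) (by positivity)
    refine ⟨N, fun n hn => ?_⟩
    have h1 := key N n hn
    have h2 := hN n hn
    rw [Real.dist_eq] at h2
    have h3 := (le_abs_self _).trans_lt h2
    rw [dist_comm, dist_eq_norm]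
    exact lt_of_pow_lt_pow_left₀ 2 hε.le (by linarith)
  obtain ⟨u, hu⟩ := cauchySeq_tendsto_of_complete hcauchy
  exact ⟨u, fun k => (hcl k).mem_of_tendsto hu
    (eventually_atTop.2 ⟨k, fun j hj => hanti hj (hv j)⟩)⟩

section Averages

variable {E V : Type*} [NormedAddCommGroup E] [InnerProductSpace ℝ E] [FiniteDimensional ℝ E]
  [NormedAddCommGroup V] [InnerProductSpace ℝ V] [FiniteDimensional ℝ V]

/-- The average of `A θ (U θ)` over `[0, T]` with weight `ρ`. -/
noncomputable def avgMap (T : ℝ) (ρ : ℝ → ℝ) (A : ℝ → V →L[ℝ] E) (U : ℝ → V) : E :=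
  ∫ θ in (0 : ℝ)..T, ρ θ • A θ (U θ)

/-- The support function of the set of all averages `avgMap T ρ A U`, `‖U‖ ≤ 1`. -/
noncomputable def avgSupp (T : ℝ) (ρ : ℝ → ℝ) (A : ℝ → V →L[ℝ] E) (l : E →L[ℝ] ℝ) : ℝ :=
  ∫ θ in (0 : ℝ)..T, ρ θ * ‖l ∘L A θ‖

variable {T : ℝ} {ρ : ℝ → ℝ} {A : ℝ → V →L[ℝ] E}

theorem intervalIntegrable_avg (hρ : Continuous ρ) (hA : Continuous A) {U : ℝ → V}
    (hU : AEStronglyMeasurable U (volume.restrict (uIoc 0 T)))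
    {R : ℝ} (hU1 : ∀ᵐ θ ∂(volume.restrict (uIoc 0 T)), ‖U θ‖ ≤ R) :
    IntervalIntegrable (fun θ => ρ θ • A θ (U θ)) volume 0 T := by
  have hm : AEStronglyMeasurable (fun θ => ρ θ • A θ (U θ)) (volume.restrict (uIoc 0 T)) := by
    refine hρ.aestronglyMeasurable.smul ?_
    exact (isBoundedBilinearMap_apply (𝕜 := ℝ) (E := V) (F := E)).continuous.comp_aestronglyMeasurable
      (hA.aestronglyMeasurable.prodMk hU)
  have hc : IntervalIntegrable (fun θ => |ρ θ| * (‖A θ‖ * R)) volume 0 T :=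
    (by fun_prop : Continuous fun θ => |ρ θ| * (‖A θ‖ * R)).intervalIntegrable _ _
  refine hc.mono_fun hm ?_
  filter_upwards [hU1] with θ hθ
  have := (norm_nonneg _).trans hθ
  rw [norm_smul, Real.norm_of_nonneg (by positivity : 0 ≤ |ρ θ| * (‖A θ‖ * R)), Real.norm_eq_abs]
  exact mul_le_mul_of_nonneg_left ((A θ).le_opNorm_of_le hθ) (abs_nonneg _)

/-- The easy half of the duality: the bound holds pointwise under the integral. -/
theorem apply_avgMap_le_avgSupp (hT : 0 ≤ T) (hρ : Continuous ρ) (hρ0 : ∀ θ, 0 ≤ ρ θ)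
    (hA : Continuous A) {U : ℝ → V} (hU : AEStronglyMeasurable U (volume.restrict (uIoc 0 T)))
    {R : ℝ}
    (hU1 : ∀ᵐ θ ∂(volume.restrict (uIoc 0 T)), ‖U θ‖ ≤ R) (l : E →L[ℝ] ℝ) :
    l (avgMap T ρ A U) ≤ R * avgSupp T ρ A l := by
  have hint := intervalIntegrable_avg hρ hA hU hU1
  rw [avgMap, avgSupp, ← l.intervalIntegral_comp_comm hint, ← intervalIntegral.integral_const_mul]
  have h1 : IntervalIntegrable (fun θ => l (ρ θ • A θ (U θ))) volume 0 T :=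
    ⟨l.integrable_comp hint.1, l.integrable_comp hint.2⟩
  refine intervalIntegral.integral_mono_ae_restrict hT h1
    ((by fun_prop : Continuous fun θ => R * (ρ θ * ‖l ∘L A θ‖)).intervalIntegrable _ _) ?_
  rw [uIoc_of_le hT, ← Measure.restrict_congr_set Ioc_ae_eq_Icc.symm] at hU1
  filter_upwards [hU1] with θ hθ
  rw [map_smul, smul_eq_mul]
  have h3 : l (A θ (U θ)) ≤ ‖l ∘L A θ‖ * R :=
    (le_abs_self _).trans ((l ∘L A θ).le_opNorm_of_le hθ)
  calc ρ θ * l (A θ (U θ)) ≤ ρ θ * (‖l ∘L A θ‖ * R) := by gcongr; exact hρ0 θ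
    _ = R * (ρ θ * ‖l ∘L A θ‖) := by ring

/-- A continuous periodic right inverse of `avgMap`. -/
theorem exists_rightInverse_avgMap (hT : 0 < T) (hρ : Continuous ρ) (hρ0 : ∀ θ, 0 < ρ θ)
    (hA : Continuous A) (hAT : Function.Periodic A T)
    (hnd : ∀ l : E →L[ℝ] ℝ, (∀ θ, l ∘L A θ = 0) → l = 0) :
    ∃ W : ℝ → E →L[ℝ] V, Continuous W ∧ Function.Periodic W T ∧
      ∀ c, avgMap T ρ A (fun θ => W θ c) = c := by
  have hadj : Continuous fun θ => ContinuousLinearMap.adjoint (A θ) :=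
    (ContinuousLinearMap.adjoint (𝕜 := ℝ) (E := V) (F := E)).continuous.comp hA
  -- The Gramian of linear control theory, `Gr = ∫ ρ A A*`. If `Gr c = 0`, then `∫ ρ ‖A* c‖² = 0`,
  -- so the form `⟨c, ·⟩` kills every `A θ` and `c = 0`. The right inverse is `W = A* Gr⁻¹`.
  set Φ : ℝ → E →L[ℝ] E := fun θ => ρ θ • (A θ ∘L ContinuousLinearMap.adjoint (A θ)) with hΦ
  have hΦc : Continuous Φ := by fun_prop
  set Gr : E →L[ℝ] E := ∫ θ in (0 : ℝ)..T, Φ θ with hGr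
  have hGrapp : ∀ c, Gr c = avgMap T ρ A (fun θ => ContinuousLinearMap.adjoint (A θ) c) := fun c =>
    ContinuousLinearMap.intervalIntegral_apply (hΦc.intervalIntegrable _ _) c
  have hinj : Function.Injective Gr := by
    rw [injective_iff_map_eq_zero]
    intro c hc
    have h1 : ∫ θ in (0 : ℝ)..T, ρ θ * ‖ContinuousLinearMap.adjoint (A θ) c‖ ^ 2 = 0 := by
      have h2 : inner ℝ c (Gr c) = 0 := by rw [hc, inner_zero_right]
      rw [hGrapp, avgMap, ← innerSL_apply_apply ℝ,
        ← (innerSL ℝ c).intervalIntegral_comp_comm ((by fun_prop : Continuous fun θ =>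
            ρ θ • A θ (ContinuousLinearMap.adjoint (A θ) c)).intervalIntegrable _ _)] at h2
      refine Eq.trans ?_ h2
      refine intervalIntegral.integral_congr fun θ _ => ?_
      simp only [innerSL_apply_apply, inner_smul_right]
      rw [← ContinuousLinearMap.adjoint_inner_left, real_inner_self_eq_norm_sq]
    have hcont : Continuous fun θ => ρ θ * ‖ContinuousLinearMap.adjoint (A θ) c‖ ^ 2 := by fun_prop
    have h3 : ∀ θ ∈ Icc 0 T, ContinuousLinearMap.adjoint (A θ) c = 0 := by
      by_contra! hne
      obtain ⟨θ, hθ, hne⟩ := hne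
      have := intervalIntegral.integral_pos hT hcont.continuousOn
        (fun x _ => mul_nonneg (hρ0 x).le (sq_nonneg _))
        ⟨θ, hθ, mul_pos (hρ0 θ) (by positivity)⟩
      exact this.ne' h1
    have h4 : innerSL ℝ c = 0 := by
      refine hnd _ fun θ => ?_
      obtain ⟨θ', hθ', heq⟩ := hAT.exists_mem_Ico₀ hT θ
      ext v
      rw [heq]
      simp only [ContinuousLinearMap.comp_apply, innerSL_apply_apply,
        zero_apply]
      rw [← ContinuousLinearMap.adjoint_inner_left, h3 θ' (Ico_subset_Icc_self hθ'),
        inner_zero_left]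
    simpa using congrArg (fun l : E →L[ℝ] ℝ => l c) h4
  set e := (LinearEquiv.ofInjectiveEndo Gr.toLinearMap hinj).toContinuousLinearEquiv
  refine ⟨fun θ => ContinuousLinearMap.adjoint (A θ) ∘L (e.symm : E →L[ℝ] E), by fun_prop,
    fun θ => ?_, fun c => ?_⟩
  · dsimp only
    rw [hAT θ]
  · have := hGrapp (e.symm c)
    have h2 : Gr (e.symm c) = c := e.apply_symm_apply c
    rw [h2] at this
    exact this.symm

/-- Each `c` is the average of `W θ c`, whose norm is at most a constant times `‖c‖`; evaluating `l`
on this average bounds `l c`. -/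
theorem norm_le_mul_avgSupp (hT : 0 < T) (hρ : Continuous ρ) (hρ0 : ∀ θ, 0 < ρ θ)
    (hA : Continuous A) (hAT : Function.Periodic A T)
    (hnd : ∀ l : E →L[ℝ] ℝ, (∀ θ, l ∘L A θ = 0) → l = 0) :
    ∃ C > 0, ∀ l, ‖l‖ ≤ C * avgSupp T ρ A l := by
  obtain ⟨W, hWc, hWT, hW⟩ := exists_rightInverse_avgMap hT hρ hρ0 hA hAT hnd
  obtain ⟨C, hC⟩ := isCompact_Icc.exists_bound_of_continuousOn (s := Icc 0 T) hWc.continuousOn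
  have hsupp : ∀ l, 0 ≤ avgSupp T ρ A l := fun l =>
    intervalIntegral.integral_nonneg hT.le fun θ _ => mul_nonneg (hρ0 θ).le (norm_nonneg _)
  refine ⟨max C 1, by positivity, fun l => ?_⟩
  refine ContinuousLinearMap.opNorm_le_bound _ (mul_nonneg (by positivity) (hsupp l)) fun c => ?_
  have key : ∀ c, l c ≤ max C 1 * avgSupp T ρ A l * ‖c‖ := fun c => by
    conv_lhs => rw [← hW c]
    refine (apply_avgMap_le_avgSupp (R := max C 1 * ‖c‖) hT.le hρ (fun θ => (hρ0 θ).le) hA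
      ((by fun_prop : Continuous fun θ => W θ c).aestronglyMeasurable) ?_ l).trans_eq
      (by ring)
    filter_upwards [ae_restrict_mem measurableSet_uIoc] with θ hθ
    rw [uIoc_of_le hT.le] at hθ
    exact (W θ).le_of_opNorm_le ((hC θ (Ioc_subset_Icc_self hθ)).trans (le_max_left _ _)) c
  rw [Real.norm_eq_abs, abs_le']
  refine ⟨key c, ?_⟩
  have := key (-c)
  rwa [map_neg, norm_neg] at this

/-- A vector that satisfies the support inequalities is, up to an arbitrarily small contraction, an
average of a continuous periodic function with values in the unit ball. -/
theorem exists_continuous_avgMap_eq_smul (hT : 0 < T) (hρ : Continuous ρ) (hρ0 : ∀ θ, 0 < ρ θ)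
    (hρ1 : ∫ θ in (0 : ℝ)..T, ρ θ = 1)
    (hA : Continuous A) (hAT : Function.Periodic A T)
    (hnd : ∀ l : E →L[ℝ] ℝ, (∀ θ, l ∘L A θ = 0) → l = 0)
    {w : E} (hw : ∀ l, l w ≤ avgSupp T ρ A l) {s : ℝ} (hs0 : 0 ≤ s) (hs1 : s < 1) :
    ∃ U : ℝ → V, Continuous U ∧ Function.Periodic U T ∧ (∀ θ, ‖U θ‖ ≤ 1) ∧
      avgMap T ρ A U = s • w := by
  set S : Set (ℝ → V) := {U | Continuous U ∧ Function.Periodic U T ∧ ∀ θ, ‖U θ‖ ≤ 1} with hS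
  -- `C` is convex and has `0` in its interior, because of the right inverse. It remains to see that
  -- `w` is in its closure: the contraction `s • w`, with `s < 1`, is then interior to `C`.
  set C : Set E := avgMap T ρ A '' S with hCdef
  have hconv : Convex ℝ C := by
    rintro _ ⟨U, ⟨hU1, hU2, hU3⟩, rfl⟩ _ ⟨U', ⟨hU1', hU2', hU3'⟩, rfl⟩ a b ha hb hab
    refine ⟨fun θ => a • U θ + b • U' θ, ⟨by fun_prop, fun θ => ?_, fun θ => ?_⟩, ?_⟩
    · simp only [hU2 θ, hU2' θ]
    · have := convex_closedBall (0 : V) 1 (mem_closedBall_zero_iff.2 (hU3 θ))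
        (mem_closedBall_zero_iff.2 (hU3' θ)) ha hb hab
      exact mem_closedBall_zero_iff.1 this
    · rw [avgMap, avgMap, avgMap, ← intervalIntegral.integral_smul,
        ← intervalIntegral.integral_smul, ← intervalIntegral.integral_add
        ((by fun_prop : Continuous fun θ => a • ρ θ • A θ (U θ)).intervalIntegrable _ _)
        ((by fun_prop : Continuous fun θ => b • ρ θ • A θ (U' θ)).intervalIntegrable _ _)]
      refine intervalIntegral.integral_congr fun θ _ => ?_
      simp only [map_add, map_smul, smul_add]
      rw [smul_comm a, smul_comm b]
  have hint : (0 : E) ∈ interior C := by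
    obtain ⟨W, hWc, hWT, hW⟩ := exists_rightInverse_avgMap hT hρ hρ0 hA hAT hnd
    obtain ⟨K, hK⟩ := isCompact_Icc.exists_bound_of_continuousOn (s := Icc 0 T) hWc.continuousOn
    rw [mem_interior_iff_mem_nhds]
    refine mem_of_superset (Metric.closedBall_mem_nhds (0 : E) (ε := (max K 1)⁻¹) (by positivity))
      fun c hc => ⟨fun θ => W θ c, ⟨by fun_prop, fun θ => ?_, fun θ => ?_⟩, hW c⟩
    · simp only [hWT θ]
    · obtain ⟨θ', hθ', heq⟩ := hWT.exists_mem_Ico₀ hT θ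
      rw [mem_closedBall_zero_iff] at hc
      dsimp only
      rw [heq]
      calc ‖W θ' c‖ ≤ max K 1 * (max K 1)⁻¹ :=
            (W θ').le_of_opNorm_le_of_le
              ((hK θ' (Ico_subset_Icc_self hθ')).trans (le_max_left _ _)) hc
        _ = 1 := mul_inv_cancel₀ (by positivity)
  have hclos : w ∈ closure C := by
    by_contra hwC
    obtain ⟨l, u, hlu, huw⟩ := geometric_hahn_banach_closed_point hconv.closure isClosed_closure hwC
    set r : ℝ → V := fun θ => (InnerProductSpace.toDual ℝ V).symm (l ∘L A θ) with hr
    have hrc : Continuous r :=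
      (InnerProductSpace.toDual ℝ V).symm.continuous.comp (by fun_prop)
    have hrn : ∀ θ, ‖r θ‖ = ‖l ∘L A θ‖ := fun θ => LinearIsometryEquiv.norm_map _ _
    have hrl : ∀ θ v, l (A θ v) = inner ℝ (r θ) v := fun θ v => by
      rw [hr, InnerProductSpace.toDual_symm_apply]; rfl
    -- The pointwise maximizer `r / ‖r‖` of a separating form may be discontinuous where `r`
    -- vanishes. Its regularization `r / (δ + ‖r‖)` is continuous and loses at most `δ`, since the
    -- weight has integral `1`.
    have hmem : ∀ δ > 0, l (avgMap T ρ A fun θ => (δ + ‖r θ‖)⁻¹ • r θ) < u := fun δ hδ => by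
      refine hlu _ (subset_closure ⟨_, ⟨?_, fun θ => ?_, fun θ => ?_⟩, rfl⟩)
      · exact (Continuous.inv₀ (by fun_prop) fun θ => by positivity).smul hrc
      · simp only [hr, hAT θ]
      · rw [norm_smul, norm_inv, Real.norm_of_nonneg (by positivity), inv_mul_le_iff₀ (by positivity)]
        linarith
    have hbound : ∀ δ > 0, avgSupp T ρ A l - δ ≤ l (avgMap T ρ A fun θ => (δ + ‖r θ‖)⁻¹ • r θ) :=
      fun δ hδ => by
      have hc1 : Continuous fun θ => (δ + ‖r θ‖)⁻¹ • r θ :=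
        (Continuous.inv₀ (by fun_prop) fun θ => by positivity).smul hrc
      have hδ1 : δ = ∫ θ in (0 : ℝ)..T, δ * ρ θ := by
        rw [intervalIntegral.integral_const_mul, hρ1, mul_one]
      conv_lhs => rw [hδ1]
      rw [avgMap, avgSupp, ← l.intervalIntegral_comp_comm
        ((by fun_prop : Continuous fun θ => ρ θ • A θ ((δ + ‖r θ‖)⁻¹ • r θ)).intervalIntegrable _ _),
        ← intervalIntegral.integral_sub
        ((by fun_prop : Continuous fun θ => ρ θ * ‖l ∘L A θ‖).intervalIntegrable _ _)
        ((by fun_prop : Continuous fun θ => δ * ρ θ).intervalIntegrable _ _)]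
      refine intervalIntegral.integral_mono_on hT.le
        ((by fun_prop : Continuous fun θ => ρ θ * ‖l ∘L A θ‖ - δ * ρ θ).intervalIntegrable _ _)
        ((by fun_prop : Continuous fun θ =>
          l (ρ θ • A θ ((δ + ‖r θ‖)⁻¹ • r θ))).intervalIntegrable _ _) fun θ _ => ?_
      rw [map_smul, hrl, inner_smul_right, real_inner_self_eq_norm_sq, smul_eq_mul, ← hrn]
      have h1 : ‖r θ‖ - δ ≤ (δ + ‖r θ‖)⁻¹ * ‖r θ‖ ^ 2 := by
        rw [inv_mul_eq_div, le_div_iff₀ (by positivity)]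
        nlinarith [sq_nonneg δ]
      nlinarith [mul_le_mul_of_nonneg_left h1 (hρ0 θ).le]
    have h1 : u < avgSupp T ρ A l := huw.trans_le (hw l)
    have h2 := hmem ((avgSupp T ρ A l - u) / 2) (by linarith)
    have h3 := hbound ((avgSupp T ρ A l - u) / 2) (by linarith)
    linarith
  have := hconv.combo_interior_closure_mem_interior hint hclos (a := 1 - s) (b := s)
    (by linarith) hs0 (by ring)
  rw [smul_zero, zero_add] at this
  obtain ⟨U, ⟨h1, h2, h3⟩, h4⟩ := interior_subset this
  exact ⟨U, h1, h2, h3, h4⟩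


/-- A vector that satisfies the support inequalities is an average of a function with values in the
unit ball. -/
theorem exists_avgMap_eq (hT : 0 < T) (hρ : Continuous ρ) (hρ0 : ∀ θ, 0 < ρ θ)
    (hρ1 : ∫ θ in (0 : ℝ)..T, ρ θ = 1)
    (hA : Continuous A) (hAT : Function.Periodic A T)
    (hnd : ∀ l : E →L[ℝ] ℝ, (∀ θ, l ∘L A θ = 0) → l = 0)
    {w : E} (hw : ∀ l, l w ≤ avgSupp T ρ A l) :
    ∃ U : ℝ → V, AEStronglyMeasurable U (volume.restrict (uIoc 0 T)) ∧
      (∀ᵐ θ ∂(volume.restrict (uIoc 0 T)), ‖U θ‖ ≤ 1) ∧ avgMap T ρ A U = w := by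
  set μ : Measure ℝ := volume.restrict (uIoc 0 T) with hμ
  have : IsFiniteMeasure μ := by rw [hμ, uIoc_of_le hT.le]; infer_instance
  -- The controls in the unit ball whose average is within `‖w‖ / (k + 1)` of `w`. In `L²` these
  -- sets are closed, convex, bounded and nested; the contraction with `s = 1 - 1 / (k + 1)` shows
  -- that they are nonempty. A common element has average `w`.
  set C : ℕ → Set (Lp V 2 μ) := fun k =>
    {u | (∀ᵐ θ ∂μ, ‖u θ‖ ≤ 1) ∧ ‖avgMap T ρ A u - w‖ ≤ (k + 1 : ℝ)⁻¹ * ‖w‖} with hC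
  have hcong : ∀ U U' : ℝ → V, U =ᵐ[μ] U' → avgMap T ρ A U = avgMap T ρ A U' := fun U U' h => by
    refine intervalIntegral.integral_congr_ae_restrict ?_
    filter_upwards [h] with θ hθ
    rw [hθ]
  have hne : ∀ k, (C k).Nonempty := fun k => by
    have hk : (0 : ℝ) < (k + 1 : ℝ)⁻¹ := by positivity
    have hk1 : (k + 1 : ℝ)⁻¹ ≤ 1 := inv_le_one_of_one_le₀ (by linarith [k.cast_nonneg (α := ℝ)])
    obtain ⟨U, hUc, -, hU1, hU2⟩ := exists_continuous_avgMap_eq_smul hT hρ hρ0 hρ1 hA hAT hnd hw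
      (s := 1 - (k + 1 : ℝ)⁻¹) (by linarith) (by linarith)
    have hmem : MemLp U 2 μ := MemLp.of_bound hUc.aestronglyMeasurable 1 (ae_of_all _ hU1)
    refine ⟨hmem.toLp U, ?_, ?_⟩
    · filter_upwards [hmem.coeFn_toLp] with θ hθ
      rw [hθ]; exact hU1 θ
    · rw [hcong _ _ hmem.coeFn_toLp, hU2, sub_smul, one_smul, sub_sub_cancel_left, norm_neg,
        norm_smul, Real.norm_of_nonneg hk.le]
  have hcl : ∀ k, IsClosed (C k) := fun k => by
    refine IsSeqClosed.isClosed fun u v hu huv => ?_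
    obtain ⟨ns, hns, hlim⟩ := (tendstoInMeasure_of_tendsto_Lp huv).exists_seq_tendsto_ae
    have hall : ∀ᵐ θ ∂μ, ∀ j, ‖u j θ‖ ≤ 1 := ae_all_iff.2 fun j => (hu j).1
    have hv1 : ∀ᵐ θ ∂μ, ‖v θ‖ ≤ 1 := by
      filter_upwards [hlim, hall] with θ h1 h2
      exact le_of_tendsto h1.norm (Eventually.of_forall fun j => h2 _)
    refine ⟨hv1, ?_⟩
    have hlimA : Tendsto (fun j => avgMap T ρ A (u (ns j))) atTop (𝓝 (avgMap T ρ A v)) := by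
      refine intervalIntegral.tendsto_integral_filter_of_dominated_convergence
        (fun θ => |ρ θ| * ‖A θ‖) (Eventually.of_forall fun j => ?_) (Eventually.of_forall fun j => ?_)
        ((by fun_prop : Continuous fun θ => |ρ θ| * ‖A θ‖).intervalIntegrable _ _) ?_
      · exact (intervalIntegrable_avg hρ hA (Lp.aestronglyMeasurable (u (ns j)))
          (hu _).1).aestronglyMeasurable_restrict_uIoc
      · rw [← ae_restrict_iff' measurableSet_uIoc]
        filter_upwards [hall] with θ hθ
        rw [norm_smul, Real.norm_eq_abs]
        gcongr
        exact (A θ).le_of_opNorm_le_of_le le_rfl (hθ _) |>.trans_eq (mul_one _)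
      · rw [← ae_restrict_iff' measurableSet_uIoc]
        filter_upwards [hlim] with θ hθ
        exact (((A θ).continuous.tendsto _).comp hθ).const_smul _
    exact le_of_tendsto (hlimA.sub_const w).norm (Eventually.of_forall fun j => (hu _).2)
  have hcv : ∀ k, Convex ℝ (C k) := fun k => by
    rintro u ⟨hu1, hu2⟩ v ⟨hv1, hv2⟩ a b ha hb hab
    have hae : (a • u + b • v : Lp V 2 μ) =ᵐ[μ] fun θ => a • u θ + b • v θ := by
      filter_upwards [Lp.coeFn_add (a • u) (b • v), Lp.coeFn_smul a u, Lp.coeFn_smul b v]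
        with θ h1 h2 h3
      rw [h1, Pi.add_apply, h2, h3]; rfl
    constructor
    · filter_upwards [hae, hu1, hv1] with θ h1 h2 h3
      rw [h1]
      exact mem_closedBall_zero_iff.1 (convex_closedBall (0 : V) 1 (mem_closedBall_zero_iff.2 h2)
        (mem_closedBall_zero_iff.2 h3) ha hb hab)
    · have hlin : avgMap T ρ A (a • u + b • v : Lp V 2 μ) =
          a • avgMap T ρ A u + b • avgMap T ρ A v := by
        rw [hcong _ _ hae, avgMap, avgMap, avgMap, ← intervalIntegral.integral_smul,
          ← intervalIntegral.integral_smul, ← intervalIntegral.integral_add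
          (f := fun θ => a • ρ θ • A θ (u θ)) (g := fun θ => b • ρ θ • A θ (v θ))
          ((intervalIntegrable_avg hρ hA (Lp.aestronglyMeasurable u) hu1).smul a)
          ((intervalIntegrable_avg hρ hA (Lp.aestronglyMeasurable v) hv1).smul b)]
        refine intervalIntegral.integral_congr fun θ _ => ?_
        simp only [map_add, map_smul, smul_add]
        rw [smul_comm a, smul_comm b]
      rw [hlin, ← mem_closedBall_iff_norm]
      exact convex_closedBall w _ (mem_closedBall_iff_norm.2 hu2) (mem_closedBall_iff_norm.2 hv2)
        ha hb hab
  have hanti : Antitone C := fun i j hij u hu => ⟨hu.1, hu.2.trans (by gcongr)⟩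
  obtain ⟨u, hu⟩ := exists_mem_iInter_of_antitone_convex C hne hcl hcv hanti
    fun u hu => Lp.norm_le_of_ae_bound zero_le_one hu.1
  refine ⟨u, Lp.aestronglyMeasurable u, (hu 0).1, ?_⟩
  rw [← sub_eq_zero, ← norm_le_zero_iff]
  have hlim : Tendsto (fun k : ℕ => (k + 1 : ℝ)⁻¹ * ‖w‖) atTop (𝓝 (0 * ‖w‖)) :=
    (tendsto_inv_atTop_zero.comp
      (tendsto_atTop_add_const_right _ _ tendsto_natCast_atTop_atTop)).mul_const _
  rw [zero_mul] at hlim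
  exact ge_of_tendsto hlim (Eventually.of_forall fun k => (hu k).2)

end Averages

/-! ### Derivatives along the control fields, and support functions of the average velocity sets -/

namespace KeplerSystem

variable {n m : ℕ} {M : Type*} [TopologicalSpace M]
    [ChartedSpace (EuclideanSpace ℝ (Fin n)) M] [IsManifold (𝓡 n) ∞ M]

section Derivatives

variable {F : Type*} [NormedAddCommGroup F] [NormedSpace ℝ F]

/-- The derivative of `f` at `x` in the direction `G_i(θ, x)`, where `q = (θ, x)`. -/
noncomputable def der (K : KeplerSystem n m M) (f : M → F) (i : Fin m) (q : ℝ × M) : F :=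
  mfderiv (𝓡 n) 𝓘(ℝ, F) f q.2 (K.G i q.1 q.2)

/-- The tangent map of `f`, composed with the smooth map `G_i` into the tangent bundle and read in
the fibre `F`. -/
theorem contMDiff_der (K : KeplerSystem n m M) {f : M → F}
    (hf : ContMDiff (𝓡 n) 𝓘(ℝ, F) ∞ f) (i : Fin m) :
    ContMDiff (𝓘(ℝ, ℝ).prod (𝓡 n)) 𝓘(ℝ, F) ∞ (K.der f i) :=
  (contMDiff_snd_tangentBundle_modelSpace (n := ∞) F 𝓘(ℝ, F)).comp
    ((hf.contMDiff_tangentMap (m := ∞) (by simp)).comp (K.G_smooth i))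

/-- The linear map `v ↦ G(θ, x) v`. -/
noncomputable def GLin (K : KeplerSystem n m M) (θ : ℝ) (x : M) :
    EuclideanSpace ℝ (Fin m) →L[ℝ] EuclideanSpace ℝ (Fin n) :=
  ∑ i, (EuclideanSpace.proj i : EuclideanSpace ℝ (Fin m) →L[ℝ] ℝ).smulRight (K.colVec i x θ)

theorem GLin_apply (K : KeplerSystem n m M) (θ : ℝ) (x : M) (v : EuclideanSpace ℝ (Fin m)) :
    K.GLin θ x v = K.GVec θ x v := by
  simp [GLin, GVec]

/-- The linear map `v ↦ df(G(θ, x) v)`. -/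
noncomputable def derLin (K : KeplerSystem n m M) (f : M → F) (q : ℝ × M) :
    EuclideanSpace ℝ (Fin m) →L[ℝ] F :=
  ∑ i, (EuclideanSpace.proj i : EuclideanSpace ℝ (Fin m) →L[ℝ] ℝ).smulRight (K.der f i q)

/-- The differential of `f` at `x`, as a map between normed spaces. -/
noncomputable def diff (f : M → F) (x : M) : EuclideanSpace ℝ (Fin n) →L[ℝ] F :=
  mfderiv (𝓡 n) 𝓘(ℝ, F) f x

/-- Each factor depends on the chart that identifies `T_x M` with `ℝⁿ`, and this chart may jump with
`x`. The product does not depend on it, so continuity in `x` is always stated for the product. -/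
theorem derLin_eq (K : KeplerSystem n m M) (f : M → F) (θ : ℝ) (x : M) :
    K.derLin f (θ, x) = diff f x ∘L K.GLin θ x := by
  ext v
  simp only [derLin, GLin, sum_apply, ContinuousLinearMap.smulRight_apply,
    ContinuousLinearMap.comp_apply, map_sum, map_smul]
  rfl

theorem contMDiff_derLin (K : KeplerSystem n m M) {f : M → F}
    (hf : ContMDiff (𝓡 n) 𝓘(ℝ, F) ∞ f) :
    ContMDiff (𝓘(ℝ, ℝ).prod (𝓡 n)) 𝓘(ℝ, EuclideanSpace ℝ (Fin m) →L[ℝ] F) ∞ (K.derLin f) := by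
  refine contMDiff_finsetSum fun i _ => ?_
  exact (ContinuousLinearMap.smulRightL ℝ (EuclideanSpace ℝ (Fin m)) F
    (EuclideanSpace.proj i)).contMDiff.comp (K.contMDiff_der hf i)

theorem continuous_derLin (K : KeplerSystem n m M) {f : M → F}
    (hf : ContMDiff (𝓡 n) 𝓘(ℝ, F) ∞ f) : Continuous (K.derLin f) :=
  (K.contMDiff_derLin hf).continuous

theorem periodic_GLin (K : KeplerSystem n m M) (x : M) :
    Function.Periodic (fun θ => K.GLin θ x) (2 * Real.pi) := fun θ => by
  have : ∀ i, K.colVec i x (θ + 2 * Real.pi) = K.colVec i x θ := fun i => K.G_periodic i θ x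
  simp only [GLin, this]

theorem periodic_derLin (K : KeplerSystem n m M) (f : M → F) (x : M) :
    Function.Periodic (fun θ => K.derLin f (θ, x)) (2 * Real.pi) := fun θ => by
  simp only [derLin_eq, K.periodic_GLin x θ]

end Derivatives

/-- A smooth map defined near a point coincides near this point with a global smooth map. -/
theorem exists_contMDiff_eventuallyEq [T2Space M] {F : Type*} [NormedAddCommGroup F]
    [NormedSpace ℝ F] {f : M → F} {U : Set M} (hU : IsOpen U)
    (hf : ContMDiffOn (𝓡 n) 𝓘(ℝ, F) ∞ f U) {q : M} (hq : q ∈ U) :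
    ∃ g : M → F, ContMDiff (𝓡 n) 𝓘(ℝ, F) ∞ g ∧ g =ᶠ[𝓝 q] f := by
  obtain ⟨b, -, hb⟩ := (SmoothBumpFunction.nhds_basis_tsupport (I := 𝓡 n) q).mem_iff.1
    (hU.mem_nhds hq)
  refine ⟨fun x => b x • f x, ?_, ?_⟩
  · refine contMDiff_of_tsupport fun x hx => ?_
    have hxU : x ∈ U := hb (tsupport_smul_subset_left _ _ hx)
    exact (b.contMDiff.contMDiffAt).smul ((hf x hxU).contMDiffAt (hU.mem_nhds hxU))
  · filter_upwards [b.eventuallyEq_one] with x hx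
    rw [hx]; simp

theorem exists_contMDiff_eq_extChartAt [T2Space M] (p : M) {q : M}
    (hq : q ∈ (extChartAt (𝓡 n) p).source) :
    ∃ g : M → EuclideanSpace ℝ (Fin n), ContMDiff (𝓡 n) 𝓘(ℝ, EuclideanSpace ℝ (Fin n)) ∞ g ∧
      g =ᶠ[𝓝 q] extChartAt (𝓡 n) p :=
  exists_contMDiff_eventuallyEq (isOpen_extChartAt_source p)
    (by rw [extChartAt_source]; exact contMDiffOn_extChartAt) hq

/-- `T_p M` is identified with `ℝⁿ` by the chart at `p` itself. -/
theorem diff_eq_id_of_eventuallyEq {g : M → EuclideanSpace ℝ (Fin n)} {p : M}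
    (hg : g =ᶠ[𝓝 p] extChartAt (𝓡 n) p) :
    diff g p = ContinuousLinearMap.id ℝ (EuclideanSpace ℝ (Fin n)) := by
  rw [diff, hg.mfderiv_eq]
  exact mfderiv_extChartAt_self

section Support

/-- The weight `ω̄(x) / (2π ω(θ, x))` of the average system. -/
noncomputable def density (K : KeplerSystem n m M) (x : M) (θ : ℝ) : ℝ :=
  K.pulseBar x * (2 * Real.pi)⁻¹ * (K.pulse θ x)⁻¹

/-- The support function of the velocity set of the average system at `x`. -/
noncomputable def supp (K : KeplerSystem n m M) (x : M)
    (l : EuclideanSpace ℝ (Fin n) →L[ℝ] ℝ) : ℝ :=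
  avgSupp (2 * Real.pi) (K.density x) (fun θ => K.GLin θ x) l

theorem pulse_pos (K : KeplerSystem n m M) (θ : ℝ) (x : M) : 0 < K.pulse θ x := by
  obtain ⟨k, hk, h⟩ := K.pulse_lower
  exact hk.trans_le (h θ x)

theorem continuous_pulse (K : KeplerSystem n m M) :
    Continuous fun q : ℝ × M => K.pulse q.1 q.2 := K.pulse_smooth.continuous

theorem continuous_pulse_left (K : KeplerSystem n m M) (x : M) :
    Continuous fun θ => K.pulse θ x :=
  K.continuous_pulse.comp (by fun_prop : Continuous fun θ : ℝ => (θ, x))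

theorem continuous_pulse_inv (K : KeplerSystem n m M) :
    Continuous fun q : ℝ × M => (K.pulse q.1 q.2)⁻¹ :=
  K.continuous_pulse.inv₀ fun q => (K.pulse_pos q.1 q.2).ne'

theorem integral_pulse_inv_pos (K : KeplerSystem n m M) (x : M) :
    0 < ∫ θ in (0 : ℝ)..(2 * Real.pi), (K.pulse θ x)⁻¹ := by
  refine intervalIntegral.intervalIntegral_pos_of_pos_on ?_ (fun θ _ => inv_pos.2 (K.pulse_pos θ x))
    Real.two_pi_pos
  exact ((K.continuous_pulse_left x).inv₀ fun θ => (K.pulse_pos θ x).ne').intervalIntegrable _ _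

theorem pulseBar_pos (K : KeplerSystem n m M) (x : M) : 0 < K.pulseBar x :=
  inv_pos.2 (mul_pos (inv_pos.2 Real.two_pi_pos) (K.integral_pulse_inv_pos x))

theorem continuous_pulseBar (K : KeplerSystem n m M) : Continuous K.pulseBar := by
  refine Continuous.inv₀ ?_ fun x =>
    (mul_pos (inv_pos.2 Real.two_pi_pos) (K.integral_pulse_inv_pos x)).ne'
  refine continuous_const.mul ?_
  exact intervalIntegral.continuous_parametric_intervalIntegral_of_continuous'
    (f := fun x θ => (K.pulse θ x)⁻¹) (K.continuous_pulse_inv.comp continuous_swap) _ _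

theorem density_pos (K : KeplerSystem n m M) (x : M) (θ : ℝ) : 0 < K.density x θ :=
  mul_pos (mul_pos (K.pulseBar_pos x) (inv_pos.2 Real.two_pi_pos)) (inv_pos.2 (K.pulse_pos θ x))

theorem continuous_density (K : KeplerSystem n m M) :
    Continuous fun q : M × ℝ => K.density q.1 q.2 :=
  (((K.continuous_pulseBar.comp continuous_fst).mul continuous_const)).mul
    (K.continuous_pulse_inv.comp continuous_swap)

theorem continuous_density_right (K : KeplerSystem n m M) (x : M) : Continuous (K.density x) :=
  K.continuous_density.comp (by fun_prop : Continuous fun θ : ℝ => (x, θ))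

theorem integral_density (K : KeplerSystem n m M) (x : M) :
    ∫ θ in (0 : ℝ)..(2 * Real.pi), K.density x θ = 1 := by
  have h := K.integral_pulse_inv_pos x
  have hpi := Real.pi_pos
  simp only [density]
  rw [intervalIntegral.integral_const_mul, pulseBar, mul_assoc,
    inv_mul_cancel₀ (mul_pos (inv_pos.2 Real.two_pi_pos) h).ne']

theorem periodic_density (K : KeplerSystem n m M) (x : M) :
    Function.Periodic (K.density x) (2 * Real.pi) := fun θ => by
  simp only [density, K.pulse_periodic]

theorem GBar_eq (K : KeplerSystem n m M) (x : M) (U : ℝ → EuclideanSpace ℝ (Fin m)) :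
    K.GBar x U = avgMap (2 * Real.pi) (K.density x) (fun θ => K.GLin θ x) U := by
  rw [GBar, avgMap, ← intervalIntegral.integral_smul]
  simp only [density, GLin_apply, mul_smul]

/-- Pulling the form back from a fixed space by `diff f x` leaves only `derLin f` under the
integral, which is continuous in `x`. -/
theorem continuous_supp_diff (K : KeplerSystem n m M) {F : Type*} [NormedAddCommGroup F]
    [NormedSpace ℝ F] {f : M → F} (hf : ContMDiff (𝓡 n) 𝓘(ℝ, F) ∞ f) :
    Continuous fun q : (F →L[ℝ] ℝ) × M => K.supp q.2 (q.1 ∘L diff f q.2) := by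
  refine intervalIntegral.continuous_parametric_intervalIntegral_of_continuous'
    (f := fun (q : (F →L[ℝ] ℝ) × M) θ =>
      K.density q.2 θ * ‖(q.1 ∘L diff f q.2) ∘L K.GLin θ q.2‖) ?_ _ _
  refine (K.continuous_density.comp (by fun_prop :
    Continuous fun q : ((F →L[ℝ] ℝ) × M) × ℝ => (q.1.2, q.2))).mul (Continuous.norm ?_)
  simp only [ContinuousLinearMap.comp_assoc, ← derLin_eq]
  have := (K.continuous_derLin hf).comp
    (by fun_prop : Continuous fun q : ((F →L[ℝ] ℝ) × M) × ℝ => (q.2, q.1.2))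
  exact (continuous_fst.comp continuous_fst).clm_comp this

variable [T2Space M]

/-- At the fixed point `x` the column is its own image by the differential of the chart at `x`, and
that is a smooth function of `θ`. -/
theorem colVec_smooth (K : KeplerSystem n m M) (i : Fin m) (x : M) :
    ContDiff ℝ ∞ (K.colVec i x) := by
  obtain ⟨g, hg, hgx⟩ := exists_contMDiff_eq_extChartAt (n := n) x (mem_extChartAt_source x)
  have h : K.colVec i x = fun θ => K.der g i (θ, x) := by
    funext θ
    have := congrArg (fun L : EuclideanSpace ℝ (Fin n) →L[ℝ] EuclideanSpace ℝ (Fin n) =>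
      L (K.G i θ x)) (diff_eq_id_of_eventuallyEq hgx)
    exact this.symm
  rw [h, ← contMDiff_iff_contDiff]
  exact (K.contMDiff_der hg i).comp (contMDiff_id.prodMk contMDiff_const)

theorem continuous_GLin (K : KeplerSystem n m M) (x : M) : Continuous fun θ => K.GLin θ x := by
  refine continuous_finsetSum _ fun i _ => ?_
  exact (ContinuousLinearMap.smulRightL ℝ (EuclideanSpace ℝ (Fin m)) (EuclideanSpace ℝ (Fin n))
    (EuclideanSpace.proj i)).continuous.comp (K.colVec_smooth i x).continuous

/-- A form that kills `G(θ, x)` for all `θ` kills all `θ`-derivatives of the columns at `θ = 0`, and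
these span. The rank condition itself enters the argument only through this nondegeneracy. -/
theorem FullRank.eq_zero {K : KeplerSystem n m M} (hK : K.FullRank) (x : M)
    {l : EuclideanSpace ℝ (Fin n) →L[ℝ] ℝ} (hl : ∀ θ, l ∘L K.GLin θ x = 0) : l = 0 := by
  have hcol : ∀ i, l ∘ K.colVec i x = 0 := fun i => by
    funext θ
    have := congrArg (fun L : EuclideanSpace ℝ (Fin m) →L[ℝ] ℝ => L (EuclideanSpace.single i 1))
      (hl θ)
    simpa [GLin_apply, GVec, Finset.sum_ite_eq] using this
  have hspan : Submodule.span ℝ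
      (range fun q : ℕ × Fin m => iteratedDeriv q.1 (K.colVec q.2 x) 0) = ⊤ := by
    refine Submodule.eq_top_of_finrank_eq ?_
    rw [finrank_euclideanSpace_fin]
    exact hK 0 x
  have hker : Submodule.span ℝ (range fun q : ℕ × Fin m => iteratedDeriv q.1 (K.colVec q.2 x) 0)
      ≤ LinearMap.ker l.toLinearMap := by
    rw [Submodule.span_le]
    rintro _ ⟨⟨j, i⟩, rfl⟩
    have h := l.iteratedFDeriv_comp_left (i := j) (n := ∞) (x := 0)
      (K.colVec_smooth i x).contDiffAt (by exact_mod_cast le_top)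
    rw [hcol i] at h
    have h2 := congrArg (fun L => L fun _ => (1 : ℝ)) h
    simp only [SetLike.mem_coe, LinearMap.mem_ker]
    rw [iteratedDeriv_eq_iteratedFDeriv]
    refine Eq.trans h2.symm ?_
    rw [show (0 : ℝ → ℝ) = fun _ => 0 from rfl, iteratedFDeriv_fun_zero]
    rfl
  rw [hspan] at hker
  ext v
  exact hker (Submodule.mem_top (x := v))

theorem apply_le_supp (K : KeplerSystem n m M) {x : M} {w : EuclideanSpace ℝ (Fin n)}
    (hw : w ∈ K.velocitySet x) (l : EuclideanSpace ℝ (Fin n) →L[ℝ] ℝ) : l w ≤ K.supp x l := by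
  obtain ⟨U, hU1, hU2, rfl⟩ := hw
  rw [Measure.restrict_congr_set Ioc_ae_eq_Icc.symm, ← uIoc_of_le Real.two_pi_pos.le] at hU1 hU2
  rw [GBar_eq]
  exact (apply_avgMap_le_avgSupp Real.two_pi_pos.le (K.continuous_density_right x)
    (fun θ => (K.density_pos x θ).le) (K.continuous_GLin x) hU1 hU2 l).trans_eq (one_mul _)

/-- The converse of `apply_le_supp`: the velocity set is the intersection of its supporting
half-spaces, so membership becomes a family of inequalities that pass to limits. -/
theorem FullRank.mem_velocitySet {K : KeplerSystem n m M} (hK : K.FullRank) {x : M}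
    {w : EuclideanSpace ℝ (Fin n)} (hw : ∀ l, l w ≤ K.supp x l) : w ∈ K.velocitySet x := by
  obtain ⟨U, hU1, hU2, hU3⟩ := exists_avgMap_eq Real.two_pi_pos (K.continuous_density_right x)
    (K.density_pos x) (K.integral_density x) (K.continuous_GLin x)
    (K.periodic_GLin x) (fun l => hK.eq_zero x) hw
  rw [uIoc_of_le Real.two_pi_pos.le, Measure.restrict_congr_set Ioc_ae_eq_Icc] at hU1 hU2
  exact ⟨U, hU1, hU2, by rw [GBar_eq, hU3]⟩

/-- Dual form of the fact that the velocity set contains a ball around `0`. -/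
theorem FullRank.norm_le_supp {K : KeplerSystem n m M} (hK : K.FullRank) (x : M) :
    ∃ C > 0, ∀ l, ‖l‖ ≤ C * K.supp x l :=
  norm_le_mul_avgSupp Real.two_pi_pos (K.continuous_density_right x)
    (K.density_pos x) (K.continuous_GLin x) (K.periodic_GLin x) (fun _ => hK.eq_zero x)

end Support

end KeplerSystem

/-! ### Absolutely continuous and Lipschitz curves on a manifold -/

section CurveLemmas

variable {n : ℕ} {M : Type*} [TopologicalSpace M] [ChartedSpace (EuclideanSpace ℝ (Fin n)) M]

open KeplerSystem

theorem HasVelocityAt.hasDerivAt_comp {F : Type*} [NormedAddCommGroup F] [NormedSpace ℝ F]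
    {x : C(ℝ, M)} {t : ℝ} {w : EuclideanSpace ℝ (Fin n)} (hx : HasVelocityAt x t w)
    {f : M → F} (hf : MDifferentiableAt (𝓡 n) 𝓘(ℝ, F) f (x t)) :
    HasDerivAt (fun s => f (x s)) (diff f (x t) w) t := by
  have h : HasFDerivAt (fun s => f (x s)) (diff f (x t) ∘L (1 : ℝ →L[ℝ] ℝ).smulRight w) t :=
    (hf.hasMFDerivAt.comp t hx).hasFDerivAt
  exact h.hasDerivAt.congr_deriv (by simp)

/-- A curve is Lipschitz on `[0, T]` if its composition with any smooth function is. -/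
def LipCurveOn (n : ℕ) {M : Type*} [TopologicalSpace M] [ChartedSpace (EuclideanSpace ℝ (Fin n)) M]
    (x : C(ℝ, M)) (T : ℝ) : Prop :=
  ∀ f : M → ℝ, ContMDiff (𝓡 n) 𝓘(ℝ, ℝ) ∞ f →
    ∃ C : ℝ, ∀ s ∈ Icc 0 T, ∀ t ∈ Icc 0 T, |f (x s) - f (x t)| ≤ C * |s - t|

theorem LipCurveOn.lipschitzOnWith {x : C(ℝ, M)} {T : ℝ} (hx : LipCurveOn n x T)
    {g : M → EuclideanSpace ℝ (Fin n)} (hg : ContMDiff (𝓡 n) 𝓘(ℝ, EuclideanSpace ℝ (Fin n)) ∞ g) :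
    ∃ C : NNReal, LipschitzOnWith C (fun t => g (x t)) (Icc 0 T) := by
  have hi : ∀ i, ContMDiff (𝓡 n) 𝓘(ℝ, ℝ) ∞ fun q => g q i := fun i =>
    (EuclideanSpace.proj i : EuclideanSpace ℝ (Fin n) →L[ℝ] ℝ).contMDiff.comp hg
  choose C hC using fun i => hx _ (hi i)
  refine ⟨∑ i, (C i).toNNReal, LipschitzOnWith.of_dist_le_mul fun s hs t ht => ?_⟩
  rw [dist_eq_norm, ← (EuclideanSpace.basisFun (Fin n) ℝ).sum_repr (g (x s) - g (x t))]
  refine (norm_sum_le _ _).trans ?_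
  push_cast
  rw [Finset.sum_mul]
  refine Finset.sum_le_sum fun i _ => ?_
  rw [norm_smul]
  simp only [EuclideanSpace.basisFun_repr, EuclideanSpace.basisFun_apply, PiLp.sub_apply,
    PiLp.norm_single, norm_one, mul_one, Real.norm_eq_abs, Real.dist_eq]
  refine (hC i s hs t ht).trans ?_
  gcongr
  exact Real.le_coe_toNNReal _

/-- Locally `f` is the chart followed by a map that is `C¹` on the model space, hence locally
Lipschitz, and Lipschitz maps preserve absolute continuity. -/
theorem ACCurveOn.comp_smooth [IsManifold (𝓡 n) ∞ M] {x : C(ℝ, M)} {T : ℝ} (hT : 0 ≤ T)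
    (hx : ACCurveOn (n := n) x T) {f : M → ℝ} (hf : ContMDiff (𝓡 n) 𝓘(ℝ, ℝ) ∞ f) :
    AbsolutelyContinuousOnInterval (fun t => f (x t)) 0 T := by
  refine AbsolutelyContinuousOnInterval.of_locally hT fun t _ => ?_
  set φ := extChartAt (𝓡 n) (x t) with hφ
  have htarget : φ.target ∈ 𝓝 (φ (x t)) := extChartAt_target_mem_nhds (x t)
  have hsm : ContDiffAt ℝ 1 (f ∘ φ.symm) (φ (x t)) := by
    have h1 : ContMDiffOn 𝓘(ℝ, EuclideanSpace ℝ (Fin n)) 𝓘(ℝ, ℝ) ∞ (f ∘ φ.symm) φ.target :=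
      hf.comp_contMDiffOn (contMDiffOn_extChartAt_symm (x t))
    exact ((contMDiffOn_iff_contDiffOn.1 h1).contDiffAt htarget).of_le (by exact_mod_cast le_top)
  obtain ⟨C, s, hs, hlip⟩ := hsm.exists_lipschitzOnWith
  have hsrc : ∀ᶠ u in 𝓝 t, x u ∈ φ.source :=
    x.continuous.continuousAt.eventually (extChartAt_source_mem_nhds (x t))
  have hcont : ContinuousAt (fun u => φ (x u)) t :=
    (continuousAt_extChartAt (x t)).comp x.continuous.continuousAt
  refine ⟨{u | x u ∈ φ.source ∧ φ (x u) ∈ s}, hsrc.and (hcont hs), fun a b hab ha hle hb => ?_⟩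
  have hAC := hx (x t) a b ha hle hb fun u hu => (hab hu).1
  refine (hlip.comp_absolutelyContinuousOnInterval hAC fun u hu => ?_).congr fun u hu => ?_
  · rw [uIcc_of_le hle] at hu; exact (hab hu).2
  · rw [uIcc_of_le hle] at hu
    simp only [Function.comp]
    rw [φ.left_inv (hab hu).1]

theorem hasVelocityAt_mfderiv {x : C(ℝ, M)} {t : ℝ}
    (hx : MDifferentiableAt 𝓘(ℝ, ℝ) (𝓡 n) x t) :
    ∃ w : EuclideanSpace ℝ (Fin n), HasVelocityAt x t w := by
  refine ⟨(mfderiv 𝓘(ℝ, ℝ) (𝓡 n) x t : ℝ →L[ℝ] EuclideanSpace ℝ (Fin n)) 1, ?_⟩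
  have : ((1 : ℝ →L[ℝ] ℝ).smulRight
      ((mfderiv 𝓘(ℝ, ℝ) (𝓡 n) x t : ℝ →L[ℝ] EuclideanSpace ℝ (Fin n)) 1)) =
      (mfderiv 𝓘(ℝ, ℝ) (𝓡 n) x t : ℝ →L[ℝ] EuclideanSpace ℝ (Fin n)) := by
    ext; simp; rfl
  exact hx.hasMFDerivAt.congr_mfderiv this.symm

variable [IsManifold (𝓡 n) ∞ M] [T2Space M]

theorem LipCurveOn.acCurveOn {x : C(ℝ, M)} {T : ℝ} (hx : LipCurveOn n x T) :
    ACCurveOn (n := n) x T := by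
  intro p a b ha hab hb hsrc
  refine AbsolutelyContinuousOnInterval.of_locally hab fun t ht => ?_
  obtain ⟨g, hg, hgp⟩ := exists_contMDiff_eq_extChartAt p (hsrc t ht)
  obtain ⟨C, hC⟩ := hx.lipschitzOnWith hg
  refine ⟨_, x.continuous.continuousAt hgp, fun r s hrs hr hle hs => ?_⟩
  have hsub : uIcc r s ⊆ Icc 0 T := by
    rw [uIcc_of_le hle]; exact Icc_subset_Icc (ha.trans hr) (hs.trans hb)
  refine (hC.mono hsub).absolutelyContinuousOnInterval.congr fun u hu => ?_
  rw [uIcc_of_le hle] at hu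
  exact hrs hu

/-- Almost everywhere differentiability of Lipschitz maps, applied to countably many global maps
that coincide with charts on open sets covering `M`; the inverse chart carries it back to the curve.
-/
theorem LipCurveOn.ae_hasVelocityAt [SecondCountableTopology M] {x : C(ℝ, M)} {T : ℝ}
    (hx : LipCurveOn n x T) :
    ∀ᵐ t ∂(volume.restrict (Icc 0 T)), t ∈ Ioo 0 T ∧
      ∃ w : EuclideanSpace ℝ (Fin n), HasVelocityAt x t w := by
  choose g hg hgp using fun p : M =>
    exists_contMDiff_eq_extChartAt (n := n) p (mem_extChartAt_source p)
  obtain ⟨s, hsc, hs⟩ := TopologicalSpace.countable_cover_nhds fun p : M =>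
    interior_mem_nhds.2 ((hgp p).and (extChartAt_source_mem_nhds (I := 𝓡 n) p))
  have hdiff : ∀ᵐ t : ℝ, ∀ p ∈ s, t ∈ Icc 0 T →
      DifferentiableWithinAt ℝ (fun t => g p (x t)) (Icc 0 T) t := by
    rw [ae_ball_iff hsc]
    intro p _
    obtain ⟨C, hC⟩ := hx.lipschitzOnWith (hg p)
    exact hC.ae_differentiableWithinAt_of_mem
  have hIoo : ∀ᵐ t ∂(volume.restrict (Icc 0 T)), t ∈ Ioo 0 T := by
    rw [← Measure.restrict_congr_set Ioo_ae_eq_Icc]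
    exact ae_restrict_mem measurableSet_Ioo
  filter_upwards [hIoo, ae_restrict_of_ae hdiff] with t ht h
  refine ⟨ht, hasVelocityAt_mfderiv ?_⟩
  have hxt : x t ∈ ⋃ p ∈ s, interior {q | (g p q = extChartAt (𝓡 n) p q) ∧
      q ∈ (extChartAt (𝓡 n) p).source} := by
    have := hs.symm ▸ mem_univ (x t)
    exact this
  simp only [mem_iUnion] at hxt
  obtain ⟨p, hp, hint⟩ := hxt
  have hd : DifferentiableAt ℝ (fun t => g p (x t)) t :=
    (h p hp (Ioo_subset_Icc_self ht)).differentiableAt (Icc_mem_nhds ht.1 ht.2)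
  have hev : x =ᶠ[𝓝 t] (extChartAt (𝓡 n) p).symm ∘ fun t => g p (x t) := by
    filter_upwards [x.continuous.continuousAt (isOpen_interior.mem_nhds hint)] with u hu
    have := interior_subset hu
    simp only [Function.comp]
    rw [this.1, (extChartAt (𝓡 n) p).left_inv this.2]
  refine MDifferentiableAt.congr_of_eventuallyEq ?_ hev
  have hmem := interior_subset hint
  have htarget : g p (x t) ∈ (extChartAt (𝓡 n) p).target := by
    rw [hmem.1]; exact (extChartAt (𝓡 n) p).map_source hmem.2
  refine MDifferentiableAt.comp t ?_ hd.mdifferentiableAt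
  exact ((contMDiffOn_extChartAt_symm (n := ∞) p).contMDiffAt
    ((isOpen_extChartAt_target p).mem_nhds htarget)).mdifferentiableAt (by simp)

end CurveLemmas

/-! ### Uniformity in the angle, and the averaging estimate -/

theorem Function.Periodic.exists_norm_le {F : Type*} [SeminormedAddCommGroup F] {q : ℝ → F} {T : ℝ}
    (hq : Function.Periodic q T) (hT : 0 < T) (hc : Continuous q) : ∃ C > 0, ∀ θ, ‖q θ‖ ≤ C := by
  obtain ⟨C, hC⟩ := isCompact_Icc.exists_bound_of_continuousOn (s := Icc 0 T) hc.continuousOn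
  refine ⟨max C 1, by positivity, fun θ => ?_⟩
  obtain ⟨θ', hθ', h⟩ := hq.exists_mem_Ico₀ hT θ
  rw [h]
  exact (hC _ (Ico_subset_Icc_self hθ')).trans (le_max_left _ _)

/-- Compactness of one period gives a neighbourhood of `p` valid for all angles in it, and
periodicity gives the other angles. -/
theorem eventually_forall_dist_lt_of_periodic {M F : Type*} [TopologicalSpace M]
    [PseudoMetricSpace F] {q : ℝ × M → F} {T : ℝ} (hT : 0 < T)
    (hq : ∀ x, Function.Periodic (fun θ => q (θ, x)) T) (hc : Continuous q) (p : M) {κ : ℝ}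
    (hκ : 0 < κ) : ∀ᶠ x in 𝓝 p, ∀ θ, dist (q (θ, x)) (q (θ, p)) < κ := by
  have h : ∀ᶠ x in 𝓝 p, ∀ θ ∈ Icc 0 T, dist (q (θ, x)) (q (θ, p)) < κ := by
    refine isCompact_Icc.eventually_forall_of_forall_eventually fun θ _ => ?_
    have h1 : Continuous fun z : M × ℝ => dist (q (z.2, z.1)) (q (z.2, p)) := by fun_prop
    refine h1.continuousAt.eventually (gt_mem_nhds ?_)
    simpa using hκ
  filter_upwards [h] with x hx θ
  obtain ⟨j, hj, -⟩ := existsUnique_zsmul_near_of_pos' hT θ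
  have e1 := (hq x).sub_zsmul_eq (x := θ) j
  have e2 := (hq p).sub_zsmul_eq (x := θ) j
  rw [← e1, ← e2]
  exact hx _ (Ico_subset_Icc_self hj)

namespace KeplerSystem

variable {n m : ℕ} {M : Type*} [TopologicalSpace M]
    [ChartedSpace (EuclideanSpace ℝ (Fin n)) M] [IsManifold (𝓡 n) ∞ M]

theorem GApply_eq (K : KeplerSystem n m M) (θ : ℝ) (x : M) (v : EuclideanSpace ℝ (Fin m)) :
    (K.GApply θ x v : EuclideanSpace ℝ (Fin n)) = K.GLin θ x v := by
  rw [GLin_apply]; rfl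

/-- The linear form `v ↦ g(θ, x) v`, where `q = (θ, x)`. -/
noncomputable def gLin (K : KeplerSystem n m M) (q : ℝ × M) :
    EuclideanSpace ℝ (Fin m) →L[ℝ] ℝ :=
  ∑ i, (EuclideanSpace.proj i : EuclideanSpace ℝ (Fin m) →L[ℝ] ℝ).smulRight (K.g i q.1 q.2)

theorem gLin_apply (K : KeplerSystem n m M) (θ : ℝ) (x : M) (v : EuclideanSpace ℝ (Fin m)) :
    K.gLin (θ, x) v = K.gApply θ x v := by
  simp [gLin, gApply]

theorem continuous_gLin (K : KeplerSystem n m M) : Continuous K.gLin := by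
  refine continuous_finsetSum _ fun i _ => ?_
  exact (ContinuousLinearMap.smulRightL ℝ (EuclideanSpace ℝ (Fin m)) ℝ
    (EuclideanSpace.proj i)).continuous.comp (K.g_smooth i).continuous

theorem periodic_gLin (K : KeplerSystem n m M) (x : M) :
    Function.Periodic (fun θ => K.gLin (θ, x)) (2 * Real.pi) := fun θ => by
  simp only [gLin, K.g_periodic]

variable {K : KeplerSystem n m M}

/-- Velocities are read only through smooth functions on `M`, which makes the averaging estimate
independent of coordinates. -/
theorem IsSolution.ae_hasDerivAt {ε T : ℝ} {θ : ℝ → ℝ} {x : C(ℝ, M)}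
    (h : K.IsSolution ε T θ x) :
    ∃ v : ℝ → EuclideanSpace ℝ (Fin m), ∀ᵐ t ∂(volume.restrict (Icc 0 T)), ‖v t‖ ≤ ε ∧
      HasDerivAt θ (K.pulse (θ t) (x t) + K.gLin (θ t, x t) (v t)) t ∧
      ∀ f : M → ℝ, ContMDiff (𝓡 n) 𝓘(ℝ, ℝ) ∞ f →
        HasDerivAt (fun s => f (x s)) (K.derLin f (θ t, x t) (v t)) t := by
  obtain ⟨-, -, v, -, hv, hae⟩ := h
  refine ⟨v, ?_⟩
  filter_upwards [hae, ae_restrict_mem measurableSet_Icc] with t ⟨h1, h2⟩ ht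
  refine ⟨hv t ht, by rwa [gLin_apply], fun f hf => ?_⟩
  rw [derLin_eq, ContinuousLinearMap.comp_apply, ← GApply_eq]
  exact h2.hasDerivAt_comp (hf.mdifferentiable (by simp) _)

variable (K) in
/-- Solutions of the Kepler system that remain in a compact set are uniformly Lipschitz. -/
theorem exists_lipschitz_bound {S : Set M} (hS : IsCompact S) {f : M → ℝ}
    (hf : ContMDiff (𝓡 n) 𝓘(ℝ, ℝ) ∞ f) :
    ∃ C : ℝ, ∀ (ε T : ℝ) (θ : ℝ → ℝ) (x : C(ℝ, M)), 0 < ε → K.IsSolution ε T θ x →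
      ∀ a b, 0 ≤ a → a ≤ b → b ≤ T → (∀ t ∈ Icc a b, x t ∈ S) →
        |f (x b) - f (x a)| ≤ C * ε * (b - a) := by
  obtain ⟨C, hC⟩ := (isCompact_Icc.prod hS).exists_bound_of_continuousOn
    (s := Icc 0 (2 * Real.pi) ×ˢ S) (K.continuous_derLin hf).continuousOn
  have hC' : ∀ θ, ∀ x ∈ S, ‖K.derLin f (θ, x)‖ ≤ C := fun θ x hx => by
    obtain ⟨θ', hθ', h⟩ := (K.periodic_derLin f x).exists_mem_Ico₀ Real.two_pi_pos θ
    rw [h]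
    exact hC (θ', x) ⟨Ico_subset_Icc_self hθ', hx⟩
  refine ⟨C, fun ε T θ x hε hsol a b ha hab hb hx => ?_⟩
  obtain ⟨v, hv⟩ := hsol.ae_hasDerivAt
  have hac := (hsol.2.1.comp_smooth (ha.trans (hab.trans hb)) hf).mono (c := a) (d := b)
    (by rw [uIcc_of_le hab, uIcc_of_le (ha.trans (hab.trans hb))]; exact Icc_subset_Icc ha hb)
  refine abs_sub_le_of_ae_deriv_le hab hac ?_
  filter_upwards [ae_restrict_of_ae_restrict_of_subset (Icc_subset_Icc ha hb) hv,
    ae_restrict_mem measurableSet_Icc] with t ⟨h1, _, h3⟩ ht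
  refine ⟨_, h3 f hf, ?_⟩
  rw [← Real.norm_eq_abs]
  exact ContinuousLinearMap.le_of_opNorm_le_of_le _ (hC' _ _ (hx t ht)) h1

variable (K) in
/-- The averaging estimate: near a point, the increment of a smooth function along solutions of
the Kepler system is bounded by the support function of the average system. -/
theorem exists_averaging_bound {f : M → ℝ} (hf : ContMDiff (𝓡 n) 𝓘(ℝ, ℝ) ∞ f) (p : M) {η : ℝ}
    (hη : 0 < η) :
    ∃ N ∈ 𝓝 p, ∃ ε₀ > 0, ∃ C : ℝ, ∀ (ε T : ℝ) (θ : ℝ → ℝ) (x : C(ℝ, M)), 0 < ε → ε < ε₀ →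
      K.IsSolution ε T θ x → ∀ a b, 0 ≤ a → a ≤ b → b ≤ T → (∀ t ∈ Icc a b, x t ∈ N) →
        f (x b) - f (x a) ≤ ε * ((K.supp p (diff f p) + η) * (b - a) + C) := by
  obtain ⟨k, hk, hpulse⟩ := K.pulse_lower
  set c : ℝ := K.pulseBar p * (2 * Real.pi)⁻¹ with hc
  have hcpos : 0 < c := mul_pos (K.pulseBar_pos p) (inv_pos.2 Real.two_pi_pos)
  set hbar := K.supp p (diff f p) with hhbar
  set h : ℝ → ℝ := fun θ => ‖K.derLin f (θ, p)‖ with hh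
  have hcont : Continuous h := ((K.continuous_derLin hf).comp (by fun_prop)).norm
  have hper : Function.Periodic h (2 * Real.pi) := fun θ => by
    simp only [hh, K.periodic_derLin f p θ]
  -- The corrector. `ψ` is the deviation of `h` from its average, divided by the pulsation at `p`
  -- (up to the factor `c`). It has mean zero, so its primitive `Ψ` is periodic and bounded. The
  -- function `f(x) - ε c⁻¹ Ψ(θ)` then has derivative at most `ε (hbar + η)`: the rotation of `θ`
  -- makes the correction cancel the oscillation of `h`.
  set ψ : ℝ → ℝ := fun θ => K.density p θ * (h θ - hbar) with hψ
  have hψc : Continuous ψ := (K.continuous_density_right p).mul (hcont.sub continuous_const)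
  have hψper : Function.Periodic ψ (2 * Real.pi) := fun θ => by
    simp only [hψ, hper θ, K.periodic_density p θ]
  have hψ0 : ∫ θ in (0 : ℝ)..(2 * Real.pi), ψ θ = 0 := by
    simp only [hψ, mul_sub]
    rw [intervalIntegral.integral_sub
      (f := fun θ => K.density p θ * h θ) (g := fun θ => K.density p θ * hbar)
      (((K.continuous_density_right p).mul hcont).intervalIntegrable _ _)
      (((K.continuous_density_right p).mul continuous_const).intervalIntegrable _ _),
      intervalIntegral.integral_mul_const, K.integral_density, one_mul, sub_eq_zero, hhbar, supp,
      avgSupp]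
    simp only [hh, derLin_eq]
  set Ψ : ℝ → ℝ := fun θ => ∫ s in (0 : ℝ)..θ, ψ s with hΨ
  have hΨd : ∀ θ, HasDerivAt Ψ (ψ θ) θ := fun θ => hψc.integral_hasStrictDerivAt 0 θ |>.hasDerivAt
  have hΨper : Function.Periodic Ψ (2 * Real.pi) := fun θ => by
    simp only [hΨ]
    rw [← intervalIntegral.integral_add_adjacent_intervals (hψc.intervalIntegrable 0 θ)
      (hψc.intervalIntegrable θ _), hψper.intervalIntegral_add_eq θ 0, zero_add, hψ0, add_zero]
  obtain ⟨CΨ, hCΨ, hΨb⟩ := hΨper.exists_norm_le Real.two_pi_pos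
    (continuous_iff_continuousAt.2 fun θ => (hΨd θ).continuousAt)
  obtain ⟨Cψ, hCψ, hψb⟩ := hψper.exists_norm_le Real.two_pi_pos hψc
  have hΨlip : LipschitzWith Cψ.toNNReal Ψ :=
    lipschitzWith_of_nnnorm_deriv_le (fun θ => (hΨd θ).differentiableAt) fun θ => by
      rw [(hΨd θ).deriv, ← NNReal.coe_le_coe, coe_nnnorm]
      exact (hψb θ).trans (Real.le_coe_toNNReal _)
  obtain ⟨B, hB, hBb⟩ := Function.Periodic.exists_norm_le (q := fun θ => h θ - hbar)
    (fun θ => by simp only [hper θ]) Real.two_pi_pos (hcont.sub continuous_const)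
  obtain ⟨Cg, hCg, hgb⟩ := (K.periodic_gLin p).exists_norm_le Real.two_pi_pos
    (K.continuous_gLin.comp (by fun_prop))
  have e1 := eventually_forall_dist_lt_of_periodic Real.two_pi_pos (fun x => K.periodic_derLin f x)
    (K.continuous_derLin hf) p (κ := η / 3) (by positivity)
  have e2 := eventually_forall_dist_lt_of_periodic Real.two_pi_pos
    (fun x θ => K.pulse_periodic θ x) K.continuous_pulse p (κ := η * k / (3 * B)) (by positivity)
  have e3 := eventually_forall_dist_lt_of_periodic Real.two_pi_pos (fun x => K.periodic_gLin x)
    K.continuous_gLin p (κ := 1) one_pos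
  -- The margin `η` is spent in three equal parts: on the variation of `df ∘ G` between `p` and `x`,
  -- on the variation of the pulsation, and on the perturbation `g v` of the angular speed, which
  -- the bound on `ε` makes small. The constant is twice the bound of the corrector.
  refine ⟨_, e1.and (e2.and e3), η * k / (3 * B * (Cg + 1)), by positivity, c⁻¹ * (2 * CΨ),
    fun ε T θ x hε hε0 hsol a b ha hab hb hx => ?_⟩
  obtain ⟨v, hv⟩ := hsol.ae_hasDerivAt
  have hsub : uIcc a b ⊆ uIcc 0 T := by
    rw [uIcc_of_le hab, uIcc_of_le (ha.trans (hab.trans hb))]; exact Icc_subset_Icc ha hb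
  have hac1 := (hsol.2.1.comp_smooth (ha.trans (hab.trans hb)) hf).mono hsub
  have hac2 := (hΨlip.lipschitzOnWith (s := univ)).comp_absolutelyContinuousOnInterval
    (hsol.1.mono hsub) fun t _ => mem_univ _
  have key := (hac1.fun_sub (hac2.const_mul (ε * c⁻¹))).sub_le_of_ae_deriv_le
    (c := ε * (hbar + η)) hab (by
    filter_upwards [ae_restrict_of_ae_restrict_of_subset (Icc_subset_Icc ha hb) hv,
      ae_restrict_mem measurableSet_Icc] with t ⟨h1, h2, h3⟩ ht
    refine ⟨_, (h3 f hf).fun_sub (((hΨd (θ t)).comp t h2).const_mul (ε * c⁻¹)), ?_⟩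
    obtain ⟨hx1, hx2, hx3⟩ := hx t ht
    replace hx1 := hx1 (θ t)
    replace hx2 := hx2 (θ t)
    replace hx3 := hx3 (θ t)
    dsimp only at hx2
    set ϖ := K.pulse (θ t) (x t)
    set ϖ' := K.pulse (θ t) p with hϖ'
    have hϖ'k : k ≤ ϖ' := hpulse _ _
    have hϖ'0 : 0 < ϖ' := hk.trans_le hϖ'k
    have hd : K.derLin f (θ t, x t) (v t) ≤ ε * (h (θ t) + η / 3) := by
      have i1 : ‖K.derLin f (θ t, x t)‖ ≤ h (θ t) + η / 3 := by
        have := norm_le_norm_add_norm_sub' (K.derLin f (θ t, x t)) (K.derLin f (θ t, p))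
        rw [← dist_eq_norm] at this
        linarith
      refine (le_abs_self _).trans ?_
      rw [← Real.norm_eq_abs, mul_comm]
      exact ContinuousLinearMap.le_of_opNorm_le_of_le _ i1 h1
    have hg : |K.gLin (θ t, x t) (v t)| ≤ (Cg + 1) * ε := by
      have i1 : ‖K.gLin (θ t, x t)‖ ≤ Cg + 1 := by
        have := norm_le_norm_add_norm_sub' (K.gLin (θ t, x t)) (K.gLin (θ t, p))
        rw [← dist_eq_norm] at this
        linarith [hgb (θ t)]
      rw [← Real.norm_eq_abs]
      exact ContinuousLinearMap.le_of_opNorm_le_of_le _ i1 h1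
    have hgε : (Cg + 1) * ε ≤ η * k / (3 * B) := by
      have : (Cg + 1) * (η * k / (3 * B * (Cg + 1))) = η * k / (3 * B) := by field_simp
      rw [← this]; gcongr
    set γ := K.gLin (θ t, x t) (v t)
    have hψval : c⁻¹ * ψ (θ t) = ϖ'⁻¹ * (h (θ t) - hbar) := by
      simp only [hψ, density]
      rw [← hc, ← hϖ']
      field_simp
    have hdiff : |(ϖ - ϖ') + γ| ≤ 2 * (η * k / (3 * B)) := by
      refine (abs_add_le _ _).trans ?_
      rw [Real.dist_eq] at hx2
      linarith
    have hsplit : ε * c⁻¹ * (ψ (θ t) * (ϖ + γ)) =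
        ε * ((h (θ t) - hbar) + ϖ'⁻¹ * (h (θ t) - hbar) * ((ϖ - ϖ') + γ)) := by
      rw [show ε * c⁻¹ * (ψ (θ t) * (ϖ + γ)) = ε * (c⁻¹ * ψ (θ t)) * (ϖ + γ) by ring, hψval]
      field_simp
      ring
    have hrem : |ϖ'⁻¹ * (h (θ t) - hbar) * ((ϖ - ϖ') + γ)| ≤ 2 * (η / 3) := by
      rw [abs_mul, abs_mul, abs_of_pos (inv_pos.2 hϖ'0)]
      calc ϖ'⁻¹ * |h (θ t) - hbar| * |(ϖ - ϖ') + γ|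
          ≤ k⁻¹ * B * (2 * (η * k / (3 * B))) := by
            gcongr
            exact hBb (θ t)
        _ = 2 * (η / 3) := by field_simp
    rw [hsplit]
    have := neg_abs_le (ϖ'⁻¹ * (h (θ t) - hbar) * ((ϖ - ϖ') + γ))
    have h5 : ε * (h (θ t) + η / 3) - ε * ((h (θ t) - hbar) +
        ϖ'⁻¹ * (h (θ t) - hbar) * ((ϖ - ϖ') + γ)) ≤ ε * (hbar + η) := by
      rw [← mul_sub]
      gcongr
      linarith
    linarith)
  have hb1 := hΨb (θ a)
  have hb2 := hΨb (θ b)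
  rw [Real.norm_eq_abs, abs_le] at hb1 hb2
  have : ε * c⁻¹ * (Ψ (θ b) - Ψ (θ a)) ≤ ε * c⁻¹ * (2 * CΨ) := by gcongr; linarith
  nlinarith

end KeplerSystem

/-! ### Compactness of families of curves -/

section Separation

variable {n : ℕ} {M : Type*} [TopologicalSpace M] [T2Space M] [SecondCountableTopology M]
  [ChartedSpace (EuclideanSpace ℝ (Fin n)) M] [IsManifold (𝓡 n) ∞ M]

variable (n) in
theorem exists_contMDiff_separating {a b : M} (hab : a ≠ b) :
    ∃ f : M → ℝ, ContMDiff (𝓡 n) 𝓘(ℝ, ℝ) ∞ f ∧ f a = 0 ∧ f b = 1 := by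
  have := Manifold.locallyCompact_of_finiteDimensional (M := M) (𝓡 n)
  obtain ⟨f, hf, -, h0, h1⟩ := exists_contMDiff_zero_iff_one_iff_of_isClosed (n := (⊤ : ℕ∞)) (𝓡 n)
    (isClosed_singleton (x := a)) (isClosed_singleton (x := b)) (by simpa using hab)
  exact ⟨f, hf, (h0 a).1 rfl, (h1 b).1 rfl⟩

/-- Arzelà-Ascoli: the curves in a compact set that are Lipschitz with given constants, when
composed with smooth functions, form a compact set. -/
theorem isCompact_lipschitz_curves {I : Set ℝ} {S : Set M} (hS : IsCompact S)
    (C : (M → ℝ) → ℝ) :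
    IsCompact {z : C(I, M) | (∀ t, z t ∈ S) ∧ ∀ f : M → ℝ, ContMDiff (𝓡 n) 𝓘(ℝ, ℝ) ∞ f →
      ∀ s t, |f (z s) - f (z t)| ≤ C f * |(s : ℝ) - t|} := by
  have := Manifold.locallyCompact_of_finiteDimensional (M := M) (𝓡 n)
  let _ : MetricSpace M := TopologicalSpace.metrizableSpaceMetric M
  set Q : Set (I → M) := {z | (∀ t, z t ∈ S) ∧ ∀ f : M → ℝ, ContMDiff (𝓡 n) 𝓘(ℝ, ℝ) ∞ f →
      ∀ s t, |f (z s) - f (z t)| ≤ C f * |(s : ℝ) - t|} with hQ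
  -- No metric on `M` is related to the Lipschitz bounds, so a common modulus of continuity is
  -- extracted. The pairs of points of `S` at distance at least `η` form a compact set, on which
  -- finitely many smooth functions suffice to separate each pair by more than `1 / 2`; the
  -- Lipschitz constants of these functions exclude such pairs at close times.
  have modulus : ∀ η > 0, ∃ δ > 0, ∀ z ∈ Q, ∀ s t : I, dist s t < δ → dist (z s) (z t) < η := by
    intro η hη
    have hP : IsCompact ((S ×ˢ S) ∩ {q : M × M | η ≤ dist q.1 q.2}) :=
      (hS.prod hS).inter_right (isClosed_le continuous_const continuous_dist)
    have hsep : ∀ q : M × M, ∃ f : M → ℝ, ContMDiff (𝓡 n) 𝓘(ℝ, ℝ) ∞ f ∧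
        (q.1 ≠ q.2 → f q.1 = 0 ∧ f q.2 = 1) := fun q => by
      by_cases h : q.1 = q.2
      · exact ⟨fun _ => 0, contMDiff_const, fun h' => absurd h h'⟩
      · obtain ⟨f, hf, h0, h1⟩ := exists_contMDiff_separating n h
        exact ⟨f, hf, fun _ => ⟨h0, h1⟩⟩
    choose f hf hfq using hsep
    obtain ⟨t, ht, hcov⟩ := hP.elim_nhds_subcover
      (fun q => {q' : M × M | q.1 ≠ q.2 → 1 / 2 < |f q q'.1 - f q q'.2|}) fun q hq => by
        have hne : q.1 ≠ q.2 := dist_pos.1 (hη.trans_le hq.2)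
        have hc : Continuous fun q' : M × M => |f q q'.1 - f q q'.2| :=
          (((hf q).continuous.comp continuous_fst).sub ((hf q).continuous.comp continuous_snd)).abs
        have : ∀ᶠ q' in 𝓝 q, 1 / 2 < |f q q'.1 - f q q'.2| := by
          refine hc.continuousAt.eventually (lt_mem_nhds ?_)
          dsimp only
          rw [(hfq q hne).1, (hfq q hne).2]
          norm_num
        filter_upwards [this] with q' h _ using h
    have hδ : ∀ᶠ δ in 𝓝[>] (0 : ℝ), ∀ q ∈ t, |C (f q)| * δ < 1 / 2 := by
      rw [Finset.eventually_all]
      intro q _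
      have hc : Continuous fun δ : ℝ => |C (f q)| * δ := by fun_prop
      exact (hc.tendsto 0).mono_left nhdsWithin_le_nhds |>.eventually (gt_mem_nhds (by norm_num))
    obtain ⟨δ, hδ, hδ0⟩ := (hδ.and self_mem_nhdsWithin).exists
    refine ⟨δ, hδ0, fun z hz s u hsu => ?_⟩
    by_contra! hge
    have hmem := hcov (show (z s, z u) ∈ _ from ⟨⟨hz.1 s, hz.1 u⟩, hge⟩)
    simp only [mem_iUnion] at hmem
    obtain ⟨q, hq, hlt⟩ := hmem
    have hne : q.1 ≠ q.2 := dist_pos.1 (hη.trans_le (ht q hq).2)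
    have h1 := hlt hne
    have h2 := hz.2 (f q) (hf q) s u
    have h3 := hδ q hq
    rw [Subtype.dist_eq, Real.dist_eq] at hsu
    have h4 : C (f q) * |(s : ℝ) - u| ≤ |C (f q)| * δ :=
      mul_le_mul (le_abs_self _) hsu.le (abs_nonneg _) (abs_nonneg _)
    dsimp only at h1
    linarith
  have hQc : IsCompact Q := by
    refine (isCompact_univ_pi fun _ : I => hS).of_isClosed_subset ?_ fun z hz t _ => hz.1 t
    have : Q = (⋂ t : I, {z | z t ∈ S}) ∩ ⋂ (f : M → ℝ) (_ : ContMDiff (𝓡 n) 𝓘(ℝ, ℝ) ∞ f)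
        (s : I) (t : I), {z : I → M | |f (z s) - f (z t)| ≤ C f * |(s : ℝ) - t|} := by
      ext z; simp [hQ]
    rw [this]
    refine (isClosed_iInter fun t => hS.isClosed.preimage (continuous_apply t)).inter ?_
    refine isClosed_iInter fun f => isClosed_iInter fun hf => isClosed_iInter fun s =>
      isClosed_iInter fun t => ?_
    exact isClosed_le (((hf.continuous.comp (continuous_apply s)).sub
      (hf.continuous.comp (continuous_apply t))).abs) continuous_const
  refine ArzelaAscoli.isCompact_of_equicontinuous _ ?_ ?_
  · have himg : ContinuousMap.toFun '' {z : C(I, M) | (∀ t, z t ∈ S) ∧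
        ∀ f : M → ℝ, ContMDiff (𝓡 n) 𝓘(ℝ, ℝ) ∞ f →
        ∀ s t, |f (z s) - f (z t)| ≤ C f * |(s : ℝ) - t|} = Q := by
      ext z
      constructor
      · rintro ⟨z, hz, rfl⟩; exact hz
      · intro hz
        refine ⟨⟨z, Metric.continuous_iff.2 fun s η hη => ?_⟩, hz, rfl⟩
        obtain ⟨δ, hδ, h⟩ := modulus η hη
        exact ⟨δ, hδ, fun u hu => h z hz u s hu⟩
    rw [himg]
    exact hQc
  · refine fun s => Metric.equicontinuousAt_iff.2 fun η hη => ?_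
    obtain ⟨δ, hδ, h⟩ := modulus η hη
    exact ⟨δ, hδ, fun u hu z => h z.1 z.2 s u (by rwa [dist_comm])⟩

end Separation

/-! ### Limits of Kepler solutions in slow time -/

namespace KeplerSystem

variable {n m : ℕ} {M : Type*} [TopologicalSpace M]
    [ChartedSpace (EuclideanSpace ℝ (Fin n)) M] [IsManifold (𝓡 n) ∞ M]
    {K : KeplerSystem n m M}

theorem slowCurve_apply {ε T : ℝ} (hε : 0 < ε) (x : C(ℝ, M)) {τ : ℝ} (h0 : 0 ≤ τ)
    (hτ : τ ≤ ε * T) : slowCurve ε T x τ = x (τ / ε) := by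
  have h1 : τ / ε ≤ T := by rw [div_le_iff₀ hε]; linarith
  have h2 : 0 ≤ τ / ε := by positivity
  simp [slowCurve, h1, h2]

/-- Velocities are of order `ε` in `S`, and the clamped time change is `1 / ε`-Lipschitz: the
factors cancel, and the constants do not depend on `ε`. -/
theorem exists_slowCurve_lipschitz {S : Set M} (hS : IsCompact S) (K : KeplerSystem n m M) :
    ∃ C : (M → ℝ) → ℝ, ∀ (ε T : ℝ) (θ : ℝ → ℝ) (x : C(ℝ, M)), 0 < ε → 0 ≤ T →
      K.IsSolution ε T θ x → (∀ t ∈ Icc 0 T, x t ∈ S) →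
      (∀ τ, slowCurve ε T x τ ∈ S) ∧ ∀ f : M → ℝ, ContMDiff (𝓡 n) 𝓘(ℝ, ℝ) ∞ f →
        ∀ s t, |f (slowCurve ε T x s) - f (slowCurve ε T x t)| ≤ C f * |s - t| := by
  have := fun f : M → ℝ => fun hf : ContMDiff (𝓡 n) 𝓘(ℝ, ℝ) ∞ f => K.exists_lipschitz_bound hS hf
  choose! C hC using this
  refine ⟨fun f => |C f|, fun ε T θ x hε hT hsol hx => ⟨fun τ => ?_, fun f hf => ?_⟩⟩
  · exact hx _ ⟨le_max_left _ _, max_le hT (min_le_right _ _)⟩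
  · have key : ∀ s t, s ≤ t →
        |f (slowCurve ε T x t) - f (slowCurve ε T x s)| ≤ |C f| * |t - s| := fun s t hst => by
      set cl : ℝ → ℝ := fun τ => max 0 (min (τ / ε) T)
      have hcl : cl s ≤ cl t := max_le_max_left _ (min_le_min_right _ (by gcongr))
      have hb := hC f hf ε T θ x hε hsol (cl s) (cl t) (le_max_left _ _) hcl
        (max_le hT (min_le_right _ _)) fun u hu => hx u
          ⟨(le_max_left _ _).trans hu.1, hu.2.trans (max_le hT (min_le_right _ _))⟩
      refine hb.trans ?_
      have h1 : cl t - cl s ≤ (t - s) / ε := by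
        have := abs_max_sub_max_le_abs (min (t / ε) T) (min (s / ε) T) 0
        have h2 := abs_min_sub_min_le_max (t / ε) T (s / ε) T
        rw [sub_self, abs_zero, max_eq_left (abs_nonneg _), ← sub_div,
          abs_of_nonneg (div_nonneg (sub_nonneg.2 hst) hε.le)] at h2
        rw [max_comm, max_comm (min (s / ε) T)] at this
        exact (le_abs_self _).trans (this.trans h2)
      calc C f * ε * (cl t - cl s) ≤ |C f| * ε * ((t - s) / ε) := by
            have := sub_nonneg.2 hcl
            gcongr
            exact le_abs_self _
        _ = |C f| * (t - s) := by field_simp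
        _ ≤ |C f| * |t - s| := by gcongr; exact le_abs_self _
    intro s t
    rcases le_total s t with h | h
    · rw [abs_sub_comm, abs_sub_comm s]; exact key s t h
    · exact key t s h

variable [T2Space M]

/-- Every linear form on a tangent space is the differential of a smooth function. -/
theorem exists_diff_eq (p : M) (l : EuclideanSpace ℝ (Fin n) →L[ℝ] ℝ) :
    ∃ f : M → ℝ, ContMDiff (𝓡 n) 𝓘(ℝ, ℝ) ∞ f ∧ diff f p = l := by
  obtain ⟨g, hg, hgp⟩ := exists_contMDiff_eq_extChartAt (n := n) p (mem_extChartAt_source p)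
  refine ⟨fun x => l (g x), l.contMDiff.comp hg, ?_⟩
  have h1 : diff (n := n) (fun x => l (g x)) p = l ∘L diff g p := by
    have := mfderiv_comp (M := M) p (I := 𝓡 n) (I' := 𝓘(ℝ, EuclideanSpace ℝ (Fin n))) (I'' := 𝓘(ℝ, ℝ))
      (g := l) (f := g) l.mdifferentiableAt (hg.mdifferentiable (by simp) p)
    rw [l.mfderiv_eq] at this
    exact this
  rw [h1, diff_eq_id_of_eventuallyEq hgp, ContinuousLinearMap.comp_id]

variable [SecondCountableTopology M]

/-- A Lipschitz curve whose increments are locally controlled by the support function is a solution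
of the average system. -/
theorem FullRank.isAvgSolution_of_local_bound (hK : K.FullRank) {y : C(ℝ, M)} {T : ℝ}
    (hlip : LipCurveOn n y T)
    (hloc : ∀ f : M → ℝ, ContMDiff (𝓡 n) 𝓘(ℝ, ℝ) ∞ f → ∀ p, ∀ η > 0, ∃ N ∈ 𝓝 p, ∀ a b, 0 ≤ a →
      a ≤ b → b < T → (∀ t ∈ Icc a b, y t ∈ N) →
      f (y b) - f (y a) ≤ (K.supp p (diff f p) + η) * (b - a)) :
    K.IsAvgSolution T y := by
  refine ⟨hlip.acCurveOn, ?_⟩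
  filter_upwards [hlip.ae_hasVelocityAt] with t ⟨ht, w, hw⟩
  refine ⟨w, hK.mem_velocitySet fun l => ?_, hw⟩
  obtain ⟨f, hf, hfl⟩ := exists_diff_eq (y t) l
  have hd := hw.hasDerivAt_comp (hf.mdifferentiable (by simp) (y t))
  rw [hfl] at hd
  refine le_of_forall_pos_le_add fun η hη => ?_
  obtain ⟨N, hN, hbound⟩ := hloc f hf (y t) η hη
  rw [hfl] at hbound
  -- Difference quotients from the right suffice, as the derivative exists. On a small interval the
  -- curve stays in the neighbourhood where the increments are bounded.
  have hslope := (hasDerivAt_iff_tendsto_slope.1 hd).mono_left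
    (nhdsWithin_mono t (show Ioi t ⊆ {t}ᶜ from fun b hb => ne_of_gt hb))
  refine le_of_tendsto hslope ?_
  obtain ⟨δ, hδ, hball⟩ := Metric.mem_nhds_iff.1 (y.continuous.continuousAt hN)
  have : Ioo t (min (t + δ) T) ∈ 𝓝[>] t := Ioo_mem_nhdsGT (lt_min (by linarith) ht.2)
  filter_upwards [this] with b hb
  have hb2 := lt_min_iff.1 hb.2
  rw [slope_def_field, div_le_iff₀ (sub_pos.2 hb.1)]
  refine hbound t b ht.1.le hb.1.le hb2.2 fun s hs => ?_
  refine hball ?_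
  rw [Metric.mem_ball, Real.dist_eq, abs_lt]
  constructor <;> linarith [hs.1, hs.2]

/-- Limits of curves of the Kepler system in slow time are solutions of the average system. -/
theorem FullRank.isAvgSolution_of_tendsto (hK : K.FullRank) {x₀ x₁ : M} {T : ℝ → ℝ}
    {θ : ℝ → ℝ → ℝ} {x : ℝ → C(ℝ, M)} {S : Set M} (hS : IsCompact S) {𝓕 : Filter ℝ} [𝓕.NeBot]
    (h𝓕 : 𝓕 ≤ 𝓝[>] 0)
    (hsol : ∀ᶠ ε in 𝓕, 0 ≤ T ε ∧ K.IsSolution ε (T ε) (θ ε) (x ε) ∧ x ε 0 = x₀ ∧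
      x ε (T ε) = x₁ ∧ ∀ t ∈ Icc 0 (T ε), x ε t ∈ S)
    {T₀ T' : ℝ} (hT0 : 0 ≤ T') (hT' : T' ≤ T₀) (hT : Tendsto (fun ε => ε * T ε) 𝓕 (𝓝 T'))
    {y : C(Icc (0 : ℝ) T₀, M)}
    (hy : Tendsto (fun ε => (slowCurve ε (T ε) (x ε)).restrict (Icc 0 T₀)) 𝓕 (𝓝 y)) :
    K.IsAvgSolution T' (y.IccExtend (hT0.trans hT')) ∧
      y.IccExtend (hT0.trans hT') 0 = x₀ ∧ y.IccExtend (hT0.trans hT') T' = x₁ := by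
  have h0 := hT0.trans hT'
  set Y := y.IccExtend h0 with hY
  have hpos : ∀ᶠ ε in 𝓕, (0 : ℝ) < ε := h𝓕 self_mem_nhdsWithin
  have hε0 : Tendsto (fun ε : ℝ => ε) 𝓕 (𝓝 0) := (h𝓕.trans nhdsWithin_le_nhds)
  obtain ⟨C, hC⟩ := exists_slowCurve_lipschitz hS K
  have hYapp : ∀ τ (hτ : τ ∈ Icc 0 T₀), Y τ = y ⟨τ, hτ⟩ := fun τ hτ => by
    simp [hY, ContinuousMap.coe_IccExtend, IccExtend_of_mem _ _ hτ]
  have hpt : ∀ τ ∈ Icc 0 T₀, Tendsto (fun ε => slowCurve ε (T ε) (x ε) τ) 𝓕 (𝓝 (Y τ)) :=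
    fun τ hτ => by
      rw [hYapp τ hτ]
      exact ((continuous_eval_const (⟨τ, hτ⟩ : Icc 0 T₀)).tendsto y).comp hy
  have hYlip : ∀ f : M → ℝ, ContMDiff (𝓡 n) 𝓘(ℝ, ℝ) ∞ f → ∀ s ∈ Icc 0 T₀, ∀ t ∈ Icc 0 T₀,
      |f (Y s) - f (Y t)| ≤ C f * |s - t| := fun f hf s hs t ht => by
    refine le_of_tendsto (((hf.continuous.tendsto _).comp (hpt s hs)).sub
      ((hf.continuous.tendsto _).comp (hpt t ht))).abs ?_
    filter_upwards [hsol, hpos] with ε h1 h2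
    exact (hC ε (T ε) (θ ε) (x ε) h2 h1.1 h1.2.1 h1.2.2.2.2).2 f hf s t
  have hsub : Icc 0 T' ⊆ Icc 0 T₀ := Icc_subset_Icc_right hT'
  refine ⟨hK.isAvgSolution_of_local_bound (fun f hf => ⟨C f, fun s hs t ht =>
    hYlip f hf s (hsub hs) t (hsub ht)⟩) fun f hf p η hη => ?_, ?_, ?_⟩
  · obtain ⟨N, hN, ε₀, hε₀, C', hN'⟩ := K.exists_averaging_bound hf p hη
    refine ⟨interior N, interior_mem_nhds.2 hN, fun a b ha hab hb hYN => ?_⟩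
    have hev : ∀ᶠ ε in 𝓕, ∀ τ ∈ Icc a b, slowCurve ε (T ε) (x ε) τ ∈ interior N := by
      have hcomp : IsCompact ((↑) ⁻¹' Icc a b : Set (Icc (0 : ℝ) T₀)) :=
        (isClosed_Icc.preimage continuous_subtype_val).isCompact
      have := (ContinuousMap.tendsto_nhds_compactOpen.1 hy) _ hcomp _ isOpen_interior
        fun τ hτ => by rw [← hYapp τ τ.2]; exact hYN τ hτ
      filter_upwards [this] with ε h τ hτ
      exact h (x := ⟨τ, ha.trans hτ.1, hτ.2.trans (hb.le.trans hT')⟩) hτ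
    have haI : a ∈ Icc 0 T₀ := ⟨ha, hab.trans (hb.le.trans hT')⟩
    have hbI : b ∈ Icc 0 T₀ := ⟨ha.trans hab, hb.le.trans hT'⟩
    have hlim : Tendsto (fun ε => (K.supp p (diff f p) + η) * (b - a) + ε * C') 𝓕
        (𝓝 ((K.supp p (diff f p) + η) * (b - a) + 0 * C')) :=
      tendsto_const_nhds.add (hε0.mul_const _)
    rw [zero_mul, add_zero] at hlim
    refine le_of_tendsto_of_tendsto (((hf.continuous.tendsto _).comp (hpt b hbI)).sub
      ((hf.continuous.tendsto _).comp (hpt a haI))) hlim ?_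
    -- Since `b < T'`, eventually `b < ε T ε`: on `[a, b]` the slow curve is the rescaled solution
    -- and not its constant prolongation. The averaging error is `ε C'` and disappears in the limit.
    filter_upwards [hev, hsol, hpos, hε0.eventually (gt_mem_nhds hε₀),
      hT.eventually (lt_mem_nhds hb)] with ε h1 h2 h3 h4 h5
    have hbT : b / ε ≤ T ε := by rw [div_le_iff₀ h3]; linarith
    have := hN' ε (T ε) (θ ε) (x ε) h3 h4 h2.2.1 (a / ε) (b / ε) (by positivity) (by gcongr) hbT
      fun t ht => by
        have ht1 : a ≤ ε * t := by rw [mul_comm, ← div_le_iff₀ h3]; exact ht.1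
        have ht2 : ε * t ≤ b := by rw [mul_comm, ← le_div_iff₀ h3]; exact ht.2
        have := interior_subset (h1 (ε * t) ⟨ht1, ht2⟩)
        rwa [slowCurve_apply h3 _ (ha.trans ht1) (ht2.trans h5.le),
          mul_div_cancel_left₀ _ h3.ne'] at this
    simp only [Function.comp]
    rw [slowCurve_apply h3 _ (ha.trans hab) h5.le, slowCurve_apply h3 _ ha (hab.trans h5.le)]
    refine this.trans_eq ?_
    field_simp
  · refine tendsto_nhds_unique (hpt 0 ⟨le_rfl, h0⟩) (tendsto_const_nhds.congr' ?_)
    filter_upwards [hsol, hpos] with ε h1 h2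
    rw [slowCurve_apply h2 _ le_rfl (mul_nonneg h2.le h1.1), zero_div, h1.2.2.1]
  -- The slow curve equals `x₁` at time `ε T ε`, which tends to `T'`; the uniform Lipschitz bound
  -- for a function that separates `Y T'` from `x₁` gives a contradiction.
  · by_contra hne
    obtain ⟨f, hf, hf0, hf1⟩ := exists_contMDiff_separating n hne
    have hlim := (hf.continuous.tendsto _).comp (hpt T' ⟨hT0, hT'⟩)
    have hlim2 : Tendsto (fun ε => C f * |T' - ε * T ε|) 𝓕 (𝓝 (C f * |T' - T'|)) :=
      ((tendsto_const_nhds.sub hT).abs).const_mul _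
    rw [sub_self, abs_zero, mul_zero] at hlim2
    have : |f (Y T') - f x₁| ≤ 0 := by
      refine le_of_tendsto_of_tendsto (hlim.sub_const _).abs hlim2 ?_
      filter_upwards [hsol, hpos] with ε h1 h2
      have h3 := (hC ε (T ε) (θ ε) (x ε) h2 h1.1 h1.2.1 h1.2.2.2.2).2 f hf T' (ε * T ε)
      rwa [slowCurve_apply (τ := ε * T ε) h2 _ (mul_nonneg h2.le h1.1) le_rfl,
        mul_div_cancel_left₀ _ h2.ne', h1.2.2.2.1] at h3
    rw [hf0, hf1] at this
    norm_num at this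

end KeplerSystem

/-! ### Steering a system that is linear in the control -/

section Steering

variable {E V : Type*} [NormedAddCommGroup E] [NormedSpace ℝ E] [CompleteSpace E]
  [NormedAddCommGroup V] [NormedSpace ℝ V]

/-- Picard-Lindelöf. With speed at most `b` the solution cannot leave the ball of radius `b σ`
before time `σ`; outside `[0, σ]` it is prolonged by constants. -/
theorem exists_integral_solution {f : ℝ → E → E} {σ b k : ℝ} (hσ : 0 ≤ σ) (hb : 0 ≤ b) {z₀ : E}
    (hlip : ∀ s, ∀ z ∈ Metric.closedBall z₀ (b * σ), ∀ z' ∈ Metric.closedBall z₀ (b * σ),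
      ‖f s z - f s z'‖ ≤ k * ‖z - z'‖)
    (hc : ∀ z ∈ Metric.closedBall z₀ (b * σ), Continuous fun s => f s z)
    (hfb : ∀ s, ∀ z ∈ Metric.closedBall z₀ (b * σ), ‖f s z‖ ≤ b) :
    ∃ z : ℝ → E, LipschitzWith b.toNNReal z ∧ (∀ s, z s ∈ Metric.closedBall z₀ (b * σ)) ∧
      ∀ s ∈ Icc 0 σ, z s = z₀ + ∫ τ in (0 : ℝ)..s, f τ (z τ) := by
  have hpl : IsPicardLindelof f (⟨0, left_mem_Icc.2 hσ⟩ : Icc 0 σ) z₀ (b * σ).toNNReal 0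
      b.toNNReal k.toNNReal := by
    have hr : ((b * σ).toNNReal : ℝ) = b * σ := Real.coe_toNNReal _ (mul_nonneg hb hσ)
    refine ⟨fun s _ => LipschitzOnWith.of_dist_le_mul fun z hz z' hz' => ?_, fun z hz => ?_,
      fun s _ z hz => ?_, ?_⟩
    · rw [hr] at hz hz'
      rw [dist_eq_norm, dist_eq_norm]
      exact (hlip s z hz z' hz').trans (by gcongr; exact Real.le_coe_toNNReal k)
    · rw [hr] at hz
      exact (hc z hz).continuousOn
    · rw [hr] at hz
      exact (hfb s z hz).trans (Real.le_coe_toNNReal b)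
    · rw [hr, Real.coe_toNNReal _ hb]
      simp [hσ]
  obtain ⟨α, hα⟩ := ODE.FunSpace.exists_isFixedPt_next hpl (Metric.mem_closedBall_self le_rfl)
  refine ⟨α.compProj, ?_, fun s => ?_, fun s hs => ?_⟩
  · have := α.lipschitzWith.comp (LipschitzWith.projIcc hσ)
    rwa [mul_one] at this
  · have := α.compProj_mem_closedBall hpl.mul_max_le (t := s)
    rwa [Real.coe_toNNReal _ (mul_nonneg hb hσ)] at this
  · have h1 := congrArg (fun β : ODE.FunSpace _ _ _ _ => β ⟨s, hs⟩) hα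
    simp only [ODE.FunSpace.next_apply, ODE.picard_apply] at h1
    rw [ODE.FunSpace.compProj_of_mem hs]
    exact h1.symm

/-- Exact steering by small corrections of the control, for a system whose vector fields are nearly
constant in the state. -/
theorem exists_steering {A : ℝ → E → V →L[ℝ] E} {u : ℝ → V} {W : ℝ → E →L[ℝ] V}
    {p z₀ d : E} {R a L Q Q' r σ Δ ρ : ℝ} (hσ : 0 ≤ σ) (ha : 0 ≤ a) (hL : 0 ≤ L) (hQ : 0 ≤ Q)
    (hr : 0 ≤ r) (hΔ : 0 < Δ)
    (hAc : ContinuousOn (Function.uncurry A) (univ ×ˢ Metric.closedBall p R))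
    (hAb : ∀ s, ∀ z ∈ Metric.closedBall p R, ‖A s z‖ ≤ a)
    (hAl : ∀ s, ∀ z ∈ Metric.closedBall p R, ∀ z' ∈ Metric.closedBall p R,
      ‖A s z - A s z'‖ ≤ L * ‖z - z'‖)
    (huc : Continuous u) (hWc : Continuous W)
    (hu : ∀ s c, ‖c‖ ≤ r → ‖u s + W s c‖ ≤ Q) (hW : ∀ s, ‖W s‖ ≤ Q')
    (hmain : ∀ c, ∫ s in (0 : ℝ)..σ, A s p (u s + W s c) = Δ • c + d)
    (hρ : ρ = ‖z₀ - p‖ + a * Q * σ) (hρR : ρ ≤ R) (h1 : L * Q * σ ≤ 1 / 2)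
    (h2 : L * ρ * Q * σ ≤ Δ * r)
    (h3 : (L * (2 * (a * Q' * σ)) * Q + L * ρ * Q') * σ ≤ Δ / 2) :
    ∃ c, ‖c‖ ≤ r ∧ ∃ z : ℝ → E, LipschitzWith (a * Q).toNNReal z ∧ z 0 = z₀ ∧ z σ = z₀ + d ∧
      (∀ s, z s ∈ Metric.closedBall p ρ) ∧
      ∀ s ∈ Ioo 0 σ, HasDerivAt z (A s (z s) (u s + W s c)) s := by
  have hQ' : 0 ≤ Q' := (norm_nonneg _).trans (hW 0)
  have hball : Metric.closedBall z₀ (a * Q * σ) ⊆ Metric.closedBall p ρ := by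
    refine Metric.closedBall_subset_closedBall' ?_
    rw [dist_eq_norm, hρ]; linarith
  have hρ0 : 0 ≤ ρ := by rw [hρ]; positivity
  have hballR := Metric.closedBall_subset_closedBall hρR (x := p)
  have hpR : p ∈ Metric.closedBall p R := Metric.mem_closedBall_self (hρ0.trans hρR)
  have hcu : ∀ c, Continuous fun s => u s + W s c := fun c =>
    huc.add (hWc.clm_apply continuous_const)
  have hsol : ∀ c : E, ∃ z : ℝ → E, ‖c‖ ≤ r → LipschitzWith (a * Q).toNNReal z ∧
      (∀ s, z s ∈ Metric.closedBall p ρ) ∧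
      ∀ s ∈ Icc 0 σ, z s = z₀ + ∫ τ in (0 : ℝ)..s, A τ (z τ) (u τ + W τ c) := fun c => by
    by_cases hc : ‖c‖ ≤ r
    · obtain ⟨z, hz1, hz2, hz3⟩ := exists_integral_solution (f := fun s z => A s z (u s + W s c))
        (k := L * Q) (z₀ := z₀) hσ (mul_nonneg ha hQ)
        (fun s z hz z' hz' => by
          rw [← sub_apply]
          refine ((A s z - A s z').le_of_opNorm_le_of_le
            (hAl s z (hballR (hball hz)) z' (hballR (hball hz'))) (hu s c hc)).trans_eq ?_
          ring)
        (fun z hz => by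
          have : Continuous fun s => A s z := hAc.comp_continuous (f := fun s : ℝ => (s, z))
            (by fun_prop) fun s => ⟨mem_univ _, hballR (hball hz)⟩
          exact this.clm_apply (hcu c))
        (fun s z hz => (A s z).le_of_opNorm_le_of_le (hAb s z (hballR (hball hz))) (hu s c hc))
      exact ⟨z, fun _ => ⟨hz1, fun s => hball (hz2 s), hz3⟩⟩
    · exact ⟨fun _ => z₀, fun h => absurd h hc⟩
  choose z hz using hsol
  have hAz : ∀ c, ‖c‖ ≤ r → Continuous fun s => A s (z c s) := fun c hc =>
    hAc.comp_continuous (continuous_id.prodMk (hz c hc).1.continuous)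
      fun s => ⟨mem_univ _, hballR ((hz c hc).2.1 s)⟩
  have hAp : Continuous fun s => A s p := hAc.comp_continuous (f := fun s : ℝ => (s, p))
    (by fun_prop) fun s => ⟨mem_univ _, hpR⟩
  have hzR : ∀ c, ‖c‖ ≤ r → ∀ s, z c s ∈ Metric.closedBall p R := fun c hc s =>
    hballR ((hz c hc).2.1 s)
  -- The error made by freezing `A` at `p`. The endpoint is `z₀ + d + (Δ • c + D c)`, so the target
  -- is hit exactly when `c = -Δ⁻¹ • D c`. The hypotheses `h2` and `h3` make this map a contraction
  -- of the ball of radius `r` into itself.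
  set D : E → E := fun c => ∫ s in (0 : ℝ)..σ, (A s (z c s) - A s p) (u s + W s c) with hD
  have hend : ∀ c, ‖c‖ ≤ r → z c σ = z₀ + (Δ • c + d) + D c := fun c hc => by
    have i1 : IntervalIntegrable (fun s => A s (z c s) (u s + W s c)) volume 0 σ :=
      ((hAz c hc).clm_apply (hcu c)).intervalIntegrable _ _
    have i2 : IntervalIntegrable (fun s => A s p (u s + W s c)) volume 0 σ :=
      (hAp.clm_apply (hcu c)).intervalIntegrable _ _
    have : D c = (∫ s in (0 : ℝ)..σ, A s (z c s) (u s + W s c)) - (Δ • c + d) := by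
      rw [← hmain c, ← intervalIntegral.integral_sub i1 i2]
      rfl
    rw [(hz c hc).2.2 σ (right_mem_Icc.2 hσ), this]
    abel
  have hdist : ∀ c c', ‖c‖ ≤ r → ‖c'‖ ≤ r → ∀ s ∈ Icc 0 σ,
      ‖z c s - z c' s‖ ≤ 2 * (a * Q' * σ) * ‖c - c'‖ := fun c c' hc hc' => by
    obtain ⟨s₀, hs₀, hmax⟩ := isCompact_Icc.exists_isMaxOn (nonempty_Icc.2 hσ)
      (f := fun s => ‖z c s - z c' s‖)
      ((hz c hc).1.continuous.sub (hz c' hc').1.continuous).norm.continuousOn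
    set m := ‖z c s₀ - z c' s₀‖ with hm
    have hmle : m ≤ (L * m * Q + a * (Q' * ‖c - c'‖)) * σ := by
      have i1 : IntervalIntegrable (fun s => A s (z c s) (u s + W s c)) volume 0 s₀ :=
        ((hAz c hc).clm_apply (hcu c)).intervalIntegrable _ _
      have i2 : IntervalIntegrable (fun s => A s (z c' s) (u s + W s c')) volume 0 s₀ :=
        ((hAz c' hc').clm_apply (hcu c')).intervalIntegrable _ _
      have hbd : ‖z c s₀ - z c' s₀‖ ≤ (L * m * Q + a * (Q' * ‖c - c'‖)) * |s₀ - 0| := by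
        rw [(hz c hc).2.2 s₀ hs₀, (hz c' hc').2.2 s₀ hs₀, add_sub_add_left_eq_sub,
          ← intervalIntegral.integral_sub i1 i2]
        refine intervalIntegral.norm_integral_le_of_norm_le_const fun s hs => ?_
        rw [uIoc_of_le hs₀.1] at hs
        have hsI : s ∈ Icc 0 σ := ⟨hs.1.le, hs.2.trans hs₀.2⟩
        have e : A s (z c s) (u s + W s c) - A s (z c' s) (u s + W s c') =
            (A s (z c s) - A s (z c' s)) (u s + W s c) + A s (z c' s) (W s (c - c')) := by
          simp only [sub_apply, map_add, map_sub]; abel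
        rw [e]
        refine (norm_add_le _ _).trans (add_le_add ?_ ?_)
        · refine ContinuousLinearMap.le_of_opNorm_le_of_le _
            ((hAl s _ (hzR c hc s) _ (hzR c' hc' s)).trans ?_) (hu s c hc)
          gcongr
          exact hmax hsI
        · exact ContinuousLinearMap.le_of_opNorm_le_of_le _ (hAb s _ (hzR c' hc' s))
            ((W s).le_of_opNorm_le (hW s) _)
      refine hbd.trans ?_
      rw [sub_zero, abs_of_nonneg hs₀.1]
      gcongr
      exact hs₀.2
    -- The estimate is made at the time where the two solutions are farthest apart, so `h1` lets
    -- half of `m` be absorbed and no Gronwall inequality is needed.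
    have : L * m * Q * σ ≤ 1 / 2 * m := by
      calc L * m * Q * σ = L * Q * σ * m := by ring
        _ ≤ 1 / 2 * m := by gcongr
    intro s hs
    refine le_trans (hmax hs) ?_
    change m ≤ _
    linarith
  have hDb : ∀ c, ‖c‖ ≤ r → ‖D c‖ ≤ L * ρ * Q * σ := fun c hc => by
    have : ‖D c‖ ≤ (L * ρ * Q) * |σ - 0| :=
      intervalIntegral.norm_integral_le_of_norm_le_const fun s _ =>
        ContinuousLinearMap.le_of_opNorm_le_of_le _ ((hAl s _ (hzR c hc s) _ hpR).trans
          (by gcongr; exact mem_closedBall_iff_norm.1 ((hz c hc).2.1 s))) (hu s c hc)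
    rwa [sub_zero, abs_of_nonneg hσ] at this
  have hDl : ∀ c c', ‖c‖ ≤ r → ‖c'‖ ≤ r → ‖D c - D c'‖ ≤ Δ / 2 * ‖c - c'‖ :=
    fun c c' hc hc' => by
    have i1 : IntervalIntegrable (fun s => (A s (z c s) - A s p) (u s + W s c)) volume 0 σ :=
      (((hAz c hc).sub hAp).clm_apply (hcu c)).intervalIntegrable _ _
    have i2 : IntervalIntegrable (fun s => (A s (z c' s) - A s p) (u s + W s c')) volume 0 σ :=
      (((hAz c' hc').sub hAp).clm_apply (hcu c')).intervalIntegrable _ _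
    have : ‖D c - D c'‖ ≤ (L * (2 * (a * Q' * σ) * ‖c - c'‖) * Q + L * ρ * (Q' * ‖c - c'‖))
        * |σ - 0| := by
      rw [hD]
      dsimp only
      rw [← intervalIntegral.integral_sub i1 i2]
      refine intervalIntegral.norm_integral_le_of_norm_le_const fun s hs => ?_
      rw [uIoc_of_le hσ] at hs
      have e : (A s (z c s) - A s p) (u s + W s c) - (A s (z c' s) - A s p) (u s + W s c') =
          (A s (z c s) - A s (z c' s)) (u s + W s c) + (A s (z c' s) - A s p) (W s (c - c')) := by
        simp only [sub_apply, map_add, map_sub]; abel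
      rw [e]
      refine (norm_add_le _ _).trans (add_le_add ?_ ?_)
      · refine ContinuousLinearMap.le_of_opNorm_le_of_le _
          ((hAl s _ (hzR c hc s) _ (hzR c' hc' s)).trans ?_) (hu s c hc)
        gcongr
        exact hdist c c' hc hc' s ⟨hs.1.le, hs.2⟩
      · exact ContinuousLinearMap.le_of_opNorm_le_of_le _
          ((hAl s _ (hzR c' hc' s) _ hpR).trans
            (by gcongr; exact mem_closedBall_iff_norm.1 ((hz c' hc').2.1 s)))
          ((W s).le_of_opNorm_le (hW s) _)
    rw [sub_zero, abs_of_nonneg hσ] at this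
    refine this.trans ?_
    calc _ = ((L * (2 * (a * Q' * σ)) * Q + L * ρ * Q') * σ) * ‖c - c'‖ := by ring
      _ ≤ Δ / 2 * ‖c - c'‖ := by gcongr
  set Φ : E → E := fun c => -(Δ⁻¹ • D c) with hΦ
  have hmaps : MapsTo Φ (Metric.closedBall 0 r) (Metric.closedBall 0 r) := fun c hc => by
    rw [mem_closedBall_zero_iff] at hc ⊢
    rw [hΦ, norm_neg, norm_smul, norm_inv, Real.norm_of_nonneg hΔ.le, inv_mul_le_iff₀ hΔ]
    exact (hDb c hc).trans h2
  have hcontr : ContractingWith (1 / 2) (hmaps.restrict Φ _ _) := by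
    refine ⟨by rw [← NNReal.coe_lt_coe]; norm_num, LipschitzWith.of_dist_le_mul fun c c' => ?_⟩
    have hc := mem_closedBall_zero_iff.1 c.2
    have hc' := mem_closedBall_zero_iff.1 c'.2
    rw [Subtype.dist_eq, Subtype.dist_eq, MapsTo.val_restrict_apply, MapsTo.val_restrict_apply,
      dist_eq_norm, dist_eq_norm, hΦ, neg_sub_neg, ← smul_sub, norm_smul, norm_inv,
      Real.norm_of_nonneg hΔ.le, inv_mul_le_iff₀ hΔ, norm_sub_rev]
    refine (hDl c c' hc hc').trans_eq ?_
    push_cast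
    ring
  obtain ⟨c, hcmem, hfix, -⟩ := hcontr.exists_fixedPoint' (x := 0)
    Metric.isClosed_closedBall.isComplete hmaps
    (Metric.mem_closedBall_self hr) (edist_ne_top _ _)
  have hc := mem_closedBall_zero_iff.1 hcmem
  refine ⟨c, hc, z c, (hz c hc).1, ?_, ?_, (hz c hc).2.1, fun s hs => ?_⟩
  · rw [(hz c hc).2.2 0 (left_mem_Icc.2 hσ)]; simp
  · have hfix' : -(Δ⁻¹ • D c) = c := hfix
    have : Δ • c = - D c := by
      conv_lhs => rw [← hfix']
      rw [smul_neg, smul_smul, mul_inv_cancel₀ hΔ.ne', one_smul]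
    rw [hend c hc, this]
    abel
  · have hF : Continuous fun s => A s (z c s) (u s + W s c) :=
      (hAz c hc).clm_apply (hcu c)
    have h := ((hF.integral_hasStrictDerivAt 0 s).hasDerivAt).const_add z₀
    refine h.congr_of_eventuallyEq ?_
    filter_upwards [Ioo_mem_nhds hs.1 hs.2] with τ hτ
    exact (hz c hc).2.2 τ (Ioo_subset_Icc_self hτ)

end Steering

/-! ### Reachability and concatenation of trajectories -/

section Reachability

variable {n : ℕ} {M : Type*} [TopologicalSpace M] [ChartedSpace (EuclideanSpace ℝ (Fin n)) M]

theorem HasVelocityAt.comp {x y : C(ℝ, M)} {t d : ℝ} {f : ℝ → ℝ} {w : EuclideanSpace ℝ (Fin n)}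
    (hx : HasVelocityAt x (f t) w) (hf : HasDerivAt f d t) (hy : y =ᶠ[𝓝 t] x ∘ f) :
    HasVelocityAt (n := n) y t (d • w) := by
  have h : HasMFDerivAt 𝓘(ℝ, ℝ) (𝓡 n) (x ∘ f) t
      ((1 : ℝ →L[ℝ] ℝ).smulRight w ∘L (1 : ℝ →L[ℝ] ℝ).smulRight d) :=
    HasMFDerivAt.comp t hx hf.hasFDerivAt.hasMFDerivAt
  have e : ((1 : ℝ →L[ℝ] ℝ).smulRight w ∘L (1 : ℝ →L[ℝ] ℝ).smulRight d) =
      (1 : ℝ →L[ℝ] ℝ).smulRight (d • w) := by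
    ext; simp
  exact (h.congr_mfderiv e).congr_of_eventuallyEq hy

/-- The point `b` is reached from `a` in time `T` by a Lipschitz trajectory, with a control with
values in `U`, of a dynamics `D θ x v θ' x'` involving an angle `θ`, along a whole number of turns
of this angle. -/
def LipReach {V : Type*} [MeasurableSpace V]
    (D : ℝ → M → V → ℝ → EuclideanSpace ℝ (Fin n) → Prop) (U : Set V) (T : ℝ) (a b : M) : Prop :=
  0 ≤ T ∧ ∃ (θ : ℝ → ℝ) (x : C(ℝ, M)) (v : ℝ → V),
    (∃ C : NNReal, LipschitzOnWith C θ (Icc 0 T)) ∧ LipCurveOn n x T ∧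
    Measurable v ∧ (∀ t ∈ Icc 0 T, v t ∈ U) ∧
    (∀ᵐ t ∂(volume.restrict (Icc 0 T)), ∃ (d : ℝ) (w : EuclideanSpace ℝ (Fin n)),
      HasDerivAt θ d t ∧ HasVelocityAt x t w ∧ D (θ t) (x t) (v t) d w) ∧
    x 0 = a ∧ x T = b ∧ θ 0 = 0 ∧ ∃ k : ℤ, θ T = k * (2 * Real.pi)

variable {V : Type*} [MeasurableSpace V] {D : ℝ → M → V → ℝ → EuclideanSpace ℝ (Fin n) → Prop}
  {U : Set V}

theorem LipReach.refl (hU : U.Nonempty) (a : M) : LipReach D U 0 a a := by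
  obtain ⟨u, hu⟩ := hU
  refine ⟨le_rfl, fun _ => 0, ContinuousMap.const ℝ a, fun _ => u, ⟨0, by simp⟩,
    fun f _ => ⟨0, by simp⟩, measurable_const, fun _ _ => hu, ?_, rfl, rfl, rfl, 0, by simp⟩
  have : (volume.restrict (Icc (0 : ℝ) 0)) = 0 := by simp
  rw [this]
  simp

theorem LipschitzOnWith.glue {X : Type*} [PseudoMetricSpace X] {f f₁ f₂ : ℝ → X} {C T₁ T₂ : ℝ}
    (h₁ : ∀ s ∈ Icc 0 T₁, ∀ t ∈ Icc 0 T₁, dist (f₁ s) (f₁ t) ≤ C * |s - t|)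
    (h₂ : ∀ s ∈ Icc 0 T₂, ∀ t ∈ Icc 0 T₂, dist (f₂ s) (f₂ t) ≤ C * |s - t|)
    (e₁ : ∀ t ≤ T₁, f t = f₁ t) (e₂ : ∀ t, T₁ ≤ t → f t = f₂ (t - T₁)) :
    ∀ s ∈ Icc 0 (T₁ + T₂), ∀ t ∈ Icc 0 (T₁ + T₂), dist (f s) (f t) ≤ C * |s - t| := by
  have key : ∀ s ∈ Icc 0 (T₁ + T₂), ∀ t ∈ Icc 0 (T₁ + T₂), s ≤ t →
      dist (f s) (f t) ≤ C * |s - t| := by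
    intro s hs t ht hst
    rcases le_total t T₁ with h | h
    · rw [e₁ s (hst.trans h), e₁ t h]
      exact h₁ s ⟨hs.1, hst.trans h⟩ t ⟨ht.1, h⟩
    rcases le_total T₁ s with h' | h'
    · rw [e₂ s h', e₂ t h]
      refine (h₂ _ ⟨by linarith, by linarith [hs.2]⟩ _ ⟨by linarith, by linarith [ht.2]⟩).trans_eq ?_
      rw [sub_sub_sub_cancel_right]
    · refine (dist_triangle _ (f T₁) _).trans ?_
      have a1 := h₁ s ⟨hs.1, h'⟩ T₁ ⟨hs.1.trans h', le_rfl⟩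
      have a2 := h₂ 0 ⟨le_rfl, by linarith [ht.2]⟩ (t - T₁) ⟨by linarith, by linarith [ht.2]⟩
      rw [← e₁ s h', ← e₁ T₁ le_rfl] at a1
      rw [← sub_self T₁, ← e₂ T₁ le_rfl, ← e₂ t h] at a2
      rw [abs_of_nonpos (by linarith)] at a1 a2 ⊢
      linarith
  intro s hs t ht
  rcases le_total s t with h | h
  · exact key s hs t ht h
  · rw [dist_comm, abs_sub_comm]
    exact key t ht s hs h

theorem LipReach.trans (hD : ∀ (k : ℤ) θ x v d w, D θ x v d w → D (θ + k * (2 * Real.pi)) x v d w)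
    {T₁ T₂ : ℝ} {a b c : M} (h₁ : LipReach D U T₁ a b) (h₂ : LipReach D U T₂ b c) :
    LipReach D U (T₁ + T₂) a c := by
  obtain ⟨hT₁, θ₁, x₁, v₁, ⟨C₁, hC₁⟩, hx₁, hm₁, hv₁, hae₁, ha, hb, hθ0, k₁, hk₁⟩ := h₁
  obtain ⟨hT₂, θ₂, x₂, v₂, ⟨C₂, hC₂⟩, hx₂, hm₂, hv₂, hae₂, hb', hc, hθ0', k₂, hk₂⟩ := h₂
  -- The second angle starts at `0` and the first ends after `k₁` full turns: shifting by these
  -- turns makes the angle continuous at `T₁` and, by `hD`, leaves the dynamics valid.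
  set θ : ℝ → ℝ := fun t => if t ≤ T₁ then θ₁ t else θ₂ (t - T₁) + k₁ * (2 * Real.pi) with hθ
  set x : C(ℝ, M) := ⟨fun t => if t ≤ T₁ then x₁ t else x₂ (t - T₁),
    Continuous.if_le x₁.continuous (x₂.continuous.comp (by fun_prop)) continuous_id
      continuous_const fun t ht => by
        obtain rfl : t = T₁ := ht
        simp [hb, hb']⟩ with hx
  have θe₁ : ∀ t ≤ T₁, θ t = θ₁ t := fun t ht => by simp [hθ, ht]
  have θe₂ : ∀ t, T₁ ≤ t → θ t = θ₂ (t - T₁) + k₁ * (2 * Real.pi) := fun t ht => by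
    rcases ht.eq_or_lt with rfl | h
    · simp [hθ, hk₁, hθ0']
    · simp [hθ, h.not_ge]
  have xe₁ : ∀ t ≤ T₁, x t = x₁ t := fun t ht => by simp [hx, ht]
  have xe₂ : ∀ t, T₁ ≤ t → x t = x₂ (t - T₁) := fun t ht => by
    rcases ht.eq_or_lt with rfl | h
    · simp [hx, hb, hb']
    · simp [hx, h.not_ge]
  refine ⟨add_nonneg hT₁ hT₂, θ, x, fun t => if t ≤ T₁ then v₁ t else v₂ (t - T₁), ?_,
    fun f hf => ?_, ?_, fun t ht => ?_, ?_, ?_, ?_, ?_, k₂ + k₁, ?_⟩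
  · refine ⟨max C₁ C₂, LipschitzOnWith.of_dist_le_mul ?_⟩
    refine LipschitzOnWith.glue (f₁ := θ₁) (f₂ := fun t => θ₂ t + k₁ * (2 * Real.pi))
      (fun s hs t ht => (hC₁.dist_le_mul s hs t ht).trans ?_)
      (fun s hs t ht => ?_) θe₁ θe₂
    · rw [Real.dist_eq s t]
      gcongr
      exact le_max_left _ _
    · rw [dist_add_right]
      refine (hC₂.dist_le_mul s hs t ht).trans ?_
      rw [Real.dist_eq s t]
      gcongr
      exact le_max_right _ _
  · obtain ⟨c₁, h₁⟩ := hx₁ f hf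
    obtain ⟨c₂, h₂⟩ := hx₂ f hf
    refine ⟨max c₁ c₂, ?_⟩
    refine LipschitzOnWith.glue (f := fun t => f (x t)) (f₁ := fun t => f (x₁ t))
      (f₂ := fun t => f (x₂ t)) (fun s hs t ht => (h₁ s hs t ht).trans ?_)
      (fun s hs t ht => (h₂ s hs t ht).trans ?_)
      (fun t ht => by rw [xe₁ t ht]) (fun t ht => by rw [xe₂ t ht])
    · gcongr
      exact le_max_left _ _
    · gcongr
      exact le_max_right _ _
  · exact Measurable.ite measurableSet_Iic hm₁ (hm₂.comp (measurable_id.sub_const _))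
  · by_cases h : t ≤ T₁
    · simp only [h, if_true]; exact hv₁ t ⟨ht.1, h⟩
    · simp only [h, if_false]; exact hv₂ _ ⟨by linarith, by linarith [ht.2]⟩
  · rw [ae_restrict_iff' measurableSet_Icc] at hae₁ hae₂ ⊢
    have hae₂' := (measurePreserving_sub_right (volume : Measure ℝ) T₁).quasiMeasurePreserving.ae
      hae₂
    have hne : ∀ᵐ t : ℝ, t ≠ T₁ := Measure.ae_ne volume T₁
    filter_upwards [hae₁, hae₂', hne] with t h₁ h₂ hne ht
    rcases hne.lt_or_gt with h | h
    · obtain ⟨d, w, hd, hw, hD'⟩ := h₁ ⟨ht.1, h.le⟩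
      have ev : ∀ᶠ s in 𝓝 t, s ≤ T₁ := (eventually_lt_nhds h).mono fun _ => le_of_lt
      refine ⟨d, w, hd.congr_of_eventuallyEq (ev.mono θe₁), ?_, ?_⟩
      · have := HasVelocityAt.comp (y := x) hw (hasDerivAt_id t) (ev.mono xe₁)
        rwa [one_smul] at this
      · rw [θe₁ t h.le, xe₁ t h.le, if_pos h.le]
        exact hD'
    · obtain ⟨d, w, hd, hw, hD'⟩ := h₂ ⟨by linarith, by linarith [ht.2]⟩
      have ev : ∀ᶠ s in 𝓝 t, T₁ ≤ s := (eventually_gt_nhds h).mono fun _ => le_of_lt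
      have hs : HasDerivAt (fun s => s - T₁) 1 t := (hasDerivAt_id t).sub_const T₁
      refine ⟨d, w, ?_, ?_, ?_⟩
      · have := (HasDerivAt.comp_sub_const t T₁ hd).add_const (k₁ * (2 * Real.pi))
        exact this.congr_of_eventuallyEq (ev.mono θe₂)
      · have := HasVelocityAt.comp (y := x) (f := fun s => s - T₁) hw hs (ev.mono xe₂)
        rwa [one_smul] at this
      · rw [θe₂ t h.le, xe₂ t h.le, if_neg h.not_ge]
        exact hD k₁ _ _ _ _ _ hD'
  · rw [xe₁ 0 hT₁, ha]
  · rw [xe₂ _ (by linarith), add_sub_cancel_left, hc]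
  · rw [θe₁ 0 hT₁, hθ0]
  · rw [θe₂ _ (by linarith), add_sub_cancel_left, hk₂]
    push_cast
    ring

end Reachability

namespace KeplerSystem

variable {n m : ℕ} {M : Type*} [TopologicalSpace M] [ChartedSpace (EuclideanSpace ℝ (Fin n)) M]
  [IsManifold (𝓡 n) ∞ M]

/-- Reachability for the Kepler control system, with Lipschitz trajectories that make a whole number
of turns. -/
def KReach (K : KeplerSystem n m M) (ε T : ℝ) (a b : M) : Prop :=
  LipReach (n := n) (fun θ x v d w => d = K.pulse θ x + K.gApply θ x v ∧ w = K.GVec θ x v)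
    {v : EuclideanSpace ℝ (Fin m) | ‖v‖ ≤ ε} T a b

/-- Reachability for the average system, with Lipschitz trajectories. -/
def AvgReach (K : KeplerSystem n m M) (T : ℝ) (a b : M) : Prop :=
  LipReach (n := n) (fun _ x (_ : Unit) _ w => w ∈ K.velocitySet x) univ T a b

theorem KReach.trans {K : KeplerSystem n m M} {ε T₁ T₂ : ℝ} {a b c : M} (h₁ : K.KReach ε T₁ a b)
    (h₂ : K.KReach ε T₂ b c) : K.KReach ε (T₁ + T₂) a c := by
  refine LipReach.trans (fun k θ x v d w h => ?_) h₁ h₂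
  have e1 : K.pulse (θ + k * (2 * Real.pi)) x = K.pulse θ x :=
    Function.Periodic.int_mul (f := fun θ => K.pulse θ x) (K.pulse_periodic · x) k θ
  have e2 : ∀ i, K.g i (θ + k * (2 * Real.pi)) x = K.g i θ x := fun i =>
    Function.Periodic.int_mul (f := fun θ => K.g i θ x) (K.g_periodic i · x) k θ
  have e3 : K.GLin (θ + k * (2 * Real.pi)) x = K.GLin θ x := (K.periodic_GLin x).int_mul k θ
  rw [← GLin_apply] at h ⊢
  rw [e3, e1]
  simpa only [gApply, e2] using h

theorem AvgReach.trans {K : KeplerSystem n m M} {T₁ T₂ : ℝ} {a b c : M} (h₁ : K.AvgReach T₁ a b)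
    (h₂ : K.AvgReach T₂ b c) : K.AvgReach (T₁ + T₂) a c :=
  LipReach.trans (fun _ _ _ _ _ _ h => h) h₁ h₂

theorem KReach.refl (K : KeplerSystem n m M) {ε : ℝ} (hε : 0 ≤ ε) (a : M) : K.KReach ε 0 a a :=
  LipReach.refl ⟨0, by simpa⟩ a

variable [T2Space M]

/-- The initial and final angles are free in `minTime`, so trajectories that make whole turns from
angle `0` are admissible. -/
theorem KReach.minTime_le {K : KeplerSystem n m M} {ε T : ℝ} {a b : M} (h : K.KReach ε T a b) :
    K.minTime ε a b ≤ ENNReal.ofReal T := by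
  obtain ⟨hT, θ, x, v, ⟨C, hC⟩, hx, hm, hv, hae, ha, hb, -⟩ := h
  refine sInf_le ⟨T, hT, rfl, θ, x, ⟨?_, hx.acCurveOn, v, hm, hv, ?_⟩, ha, hb⟩
  · rw [← uIcc_of_le hT] at hC
    exact hC.absolutelyContinuousOnInterval
  · filter_upwards [hae] with t ⟨d, w, h1, h2, h3, h4⟩
    rw [h3] at h1
    rw [h4] at h2
    exact ⟨h1, h2⟩

theorem AvgReach.avgMinTime_ne_top {K : KeplerSystem n m M} {T : ℝ} {a b : M}
    (h : K.AvgReach T a b) : K.avgMinTime a b ≠ ⊤ := by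
  obtain ⟨hT, θ, x, v, -, hx, -, -, hae, ha, hb, -⟩ := h
  refine ne_top_of_le_ne_top ENNReal.ofReal_ne_top (b := ENNReal.ofReal T)
    (sInf_le ⟨T, hT, rfl, x, ⟨hx.acCurveOn, ?_⟩, ha, hb⟩)
  filter_upwards [hae] with t ⟨d, w, _, h2, h3⟩
  exact ⟨w, h3, h2⟩

end KeplerSystem

/-! ### Change of time, and trajectories parametrized by the angle -/

/-- `S` inverts the primitive of `h`, which increases at rate at least `c` and is therefore a
bijection of the line. -/
theorem exists_time_change {h : ℝ → ℝ} (hh : Continuous h) {c : ℝ} (hc : 0 < c)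
    (hch : ∀ s, c ≤ h s) : ∃ S : ℝ → ℝ, StrictMono S ∧
      (∀ s, S (∫ r in (0 : ℝ)..s, h r) = s) ∧ ∀ t, HasDerivAt S (h (S t))⁻¹ t := by
  set τ : ℝ → ℝ := fun s => ∫ r in (0 : ℝ)..s, h r with hτ
  have hd : ∀ s, HasDerivAt τ (h s) s := fun s => (hh.integral_hasStrictDerivAt 0 s).hasDerivAt
  have hτ0 : τ 0 = 0 := intervalIntegral.integral_same
  have hmono : Monotone fun s => τ s - c * s := by
    have hd' : ∀ s, HasDerivAt (fun s => τ s - c * s) (h s - c * 1) s := fun s =>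
      (hd s).sub ((hasDerivAt_id s).const_mul c)
    refine monotone_of_deriv_nonneg (fun s => (hd' s).differentiableAt) fun s => ?_
    rw [(hd' s).deriv]
    linarith [hch s]
  have hstrict : StrictMono τ := by
    intro a b hab
    have h1 : τ a - c * a ≤ τ b - c * b := hmono hab.le
    have h2 : c * a < c * b := by gcongr
    linarith
  have hcont : Continuous τ := continuous_iff_continuousAt.2 fun s => (hd s).continuousAt
  have hsurj : Function.Surjective τ := by
    refine hcont.surjective ?_ ?_
    · refine tendsto_atTop_mono' _ ?_ (tendsto_id.const_mul_atTop hc)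
      filter_upwards [eventually_ge_atTop 0] with s hs
      have : τ 0 - c * 0 ≤ τ s - c * s := hmono hs
      simp only [id]
      linarith
    · refine tendsto_atBot_mono' _ ?_ (tendsto_id.const_mul_atBot hc)
      filter_upwards [eventually_le_atBot 0] with s hs
      have : τ s - c * s ≤ τ 0 - c * 0 := hmono hs
      simp only [id]
      linarith
  set e := hstrict.orderIsoOfSurjective τ hsurj with he
  have hcoe : ∀ s, e s = τ s := fun s => rfl
  refine ⟨e.symm, e.symm.strictMono, fun s => ?_, fun t => ?_⟩
  · exact e.symm_apply_apply s
  · exact HasDerivAt.of_local_left_inverse e.symm.continuous.continuousAt (hd _)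
      (hc.trans_le (hch _)).ne' (Eventually.of_forall fun y => by rw [← hcoe, e.apply_symm_apply])

section ChartLemmas

variable {n : ℕ} {M : Type*} [TopologicalSpace M] [ChartedSpace (EuclideanSpace ℝ (Fin n)) M]
  [IsManifold (𝓡 n) ∞ M]

open KeplerSystem

/-- The inverse chart composed with `g` is the identity near `x`, so by the chain rule the
differential of `g` has a left inverse. -/
theorem injective_diff_of_eventuallyEq {g : M → EuclideanSpace ℝ (Fin n)} {p x : M}
    (hx : x ∈ (extChartAt (𝓡 n) p).source) (hg : g =ᶠ[𝓝 x] extChartAt (𝓡 n) p) :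
    Function.Injective (diff (n := n) g x) := by
  have hgd : MDifferentiableAt (𝓡 n) 𝓘(ℝ, EuclideanSpace ℝ (Fin n)) g x :=
    (mdifferentiableAt_extChartAt (by rwa [extChartAt_source] at hx)).congr_of_eventuallyEq hg
  have hgx : g x = extChartAt (𝓡 n) p x := hg.self_of_nhds
  have hψ : MDifferentiableAt 𝓘(ℝ, EuclideanSpace ℝ (Fin n)) (𝓡 n) (extChartAt (𝓡 n) p).symm
      (g x) := by
    rw [hgx]
    exact ((contMDiffOn_extChartAt_symm (n := ∞) p).contMDiffAt
      (extChartAt_target_mem_nhds' ((extChartAt (𝓡 n) p).map_source hx))).mdifferentiableAt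
      (by simp)
  have hcomp := hψ.hasMFDerivAt.comp x hgd.hasMFDerivAt
  have hid : (extChartAt (𝓡 n) p).symm ∘ g =ᶠ[𝓝 x] id := by
    filter_upwards [hg, extChartAt_source_mem_nhds' hx] with y hy hy'
    rw [Function.comp_apply, hy, (extChartAt (𝓡 n) p).left_inv hy', id]
  have hcomp' := hcomp.congr_of_eventuallyEq hid.symm
  have e := hasMFDerivAt_unique hcomp' (hasMFDerivAt_id x)
  intro v w hvw
  have hv : ∀ v : EuclideanSpace ℝ (Fin n), (mfderiv 𝓘(ℝ, EuclideanSpace ℝ (Fin n)) (𝓡 n)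
      (extChartAt (𝓡 n) p).symm (g x)) (diff g x v) = v := fun v =>
    congrArg (fun L : EuclideanSpace ℝ (Fin n) →L[ℝ] EuclideanSpace ℝ (Fin n) => L v) e
  have h1 := hv v
  rw [hvw] at h1
  exact h1.symm.trans (hv w)

/-- The velocity of a curve, read in a chart. -/
theorem hasVelocityAt_symm_comp {g : M → EuclideanSpace ℝ (Fin n)}
    (hg : ContMDiff (𝓡 n) 𝓘(ℝ, EuclideanSpace ℝ (Fin n)) ∞ g) {p : M}
    {z : ℝ → EuclideanSpace ℝ (Fin n)} {y : C(ℝ, M)} {s : ℝ}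
    (hy : y =ᶠ[𝓝 s] fun s => (extChartAt (𝓡 n) p).symm (z s))
    (hz : z s ∈ (extChartAt (𝓡 n) p).target) (hgy : g =ᶠ[𝓝 (y s)] extChartAt (𝓡 n) p)
    {w : EuclideanSpace ℝ (Fin n)} (hd : HasDerivAt z (diff g (y s) w) s) :
    HasVelocityAt y s w := by
  have hys : y s = (extChartAt (𝓡 n) p).symm (z s) := hy.self_of_nhds
  have hmd : MDifferentiableAt 𝓘(ℝ, ℝ) (𝓡 n) y s := by
    refine MDifferentiableAt.congr_of_eventuallyEq ?_ hy
    exact MDifferentiableAt.comp s (((contMDiffOn_extChartAt_symm (n := ∞) p).contMDiffAt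
      (extChartAt_target_mem_nhds' hz)).mdifferentiableAt (by simp))
      hd.differentiableAt.mdifferentiableAt
  obtain ⟨w', hw'⟩ := hasVelocityAt_mfderiv hmd
  have h1 := hw'.hasDerivAt_comp (hg.mdifferentiable (by simp) _)
  have hsrc : y s ∈ (extChartAt (𝓡 n) p).source := by
    rw [hys]; exact (extChartAt (𝓡 n) p).map_target hz
  have hev : (fun s => g (y s)) =ᶠ[𝓝 s] z := by
    filter_upwards [hy, y.continuous.continuousAt hgy,
      hd.continuousAt (extChartAt_target_mem_nhds' hz)] with r h1 h2 h3
    have h2' : g (y r) = extChartAt (𝓡 n) p (y r) := h2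
    rw [h2', h1]
    exact (extChartAt (𝓡 n) p).right_inv h3
  have h2 := (hd.congr_of_eventuallyEq hev).unique h1
  rwa [injective_diff_of_eventuallyEq hsrc hgy h2]

/-- A smooth function read in the chart is Lipschitz on a compact convex set. -/
theorem lipCurveOn_symm_comp {p : M} {B : Set (EuclideanSpace ℝ (Fin n))} (hB : IsCompact B)
    (hBc : Convex ℝ B) (hBt : B ⊆ (extChartAt (𝓡 n) p).target)
    {z : ℝ → EuclideanSpace ℝ (Fin n)} {y : C(ℝ, M)} {T : ℝ} {C : NNReal}
    (hy : ∀ t ∈ Icc 0 T, y t = (extChartAt (𝓡 n) p).symm (z t))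
    (hz : LipschitzOnWith C z (Icc 0 T)) (hzB : ∀ t ∈ Icc 0 T, z t ∈ B) : LipCurveOn n y T := by
  intro f hf
  have h1 : ContMDiffOn 𝓘(ℝ, EuclideanSpace ℝ (Fin n)) 𝓘(ℝ, ℝ) ∞
      (f ∘ (extChartAt (𝓡 n) p).symm) (extChartAt (𝓡 n) p).target :=
    hf.comp_contMDiffOn (contMDiffOn_extChartAt_symm p)
  obtain ⟨L, hL⟩ := ((contMDiffOn_iff_contDiffOn.1 h1).mono hBt).exists_lipschitzOnWith
    (by simp) hBc hB
  have h2 := hL.comp hz hzB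
  refine ⟨(L * C : NNReal), fun s hs t ht => ?_⟩
  have := h2.dist_le_mul s hs t ht
  simp only [Function.comp, Real.dist_eq] at this
  rwa [← hy s hs, ← hy t ht] at this

end ChartLemmas

namespace KeplerSystem

variable {n m : ℕ} {M : Type*} [TopologicalSpace M] [ChartedSpace (EuclideanSpace ℝ (Fin n)) M]
  [IsManifold (𝓡 n) ∞ M]

/-- A trajectory parametrized by the angle, with `s = ε θ`, gives one of the Kepler system. -/
theorem exists_kReach_of_angle (K : KeplerSystem n m M) {p : M}
    {g : M → EuclideanSpace ℝ (Fin n)} (hg : ContMDiff (𝓡 n) 𝓘(ℝ, EuclideanSpace ℝ (Fin n)) ∞ g)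
    {B : Set (EuclideanSpace ℝ (Fin n))} (hB : IsCompact B)
    (hBc : Convex ℝ B) (hBt : B ⊆ (extChartAt (𝓡 n) p).target)
    (hgB : ∀ z ∈ B, g =ᶠ[𝓝 ((extChartAt (𝓡 n) p).symm z)] extChartAt (𝓡 n) p)
    {ε σ : ℝ} (hε : 0 < ε) (hσ : 0 ≤ σ) {k : ℤ} (hk : σ / ε = k * (2 * Real.pi))
    {z : ℝ → EuclideanSpace ℝ (Fin n)} {C : NNReal} (hz : LipschitzWith C z) (hzB : ∀ s, z s ∈ B)
    {u : ℝ → EuclideanSpace ℝ (Fin m)} (hu : Continuous u)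
    (hd : ∀ s ∈ Ioo 0 σ, HasDerivAt z
      (K.derLin g (s / ε, (extChartAt (𝓡 n) p).symm (z s)) (u s)) s)
    {c : ℝ} (hc : 0 < c) {H : ℝ → ℝ} (hH : Continuous H)
    (h1 : ∀ s, K.pulse (s / ε) ((extChartAt (𝓡 n) p).symm (z s)) * ‖u s‖ ≤
      1 - ε * K.gLin (s / ε, (extChartAt (𝓡 n) p).symm (z s)) (u s))
    (h2 : ∀ s, c ≤ (1 - ε * K.gLin (s / ε, (extChartAt (𝓡 n) p).symm (z s)) (u s)) /
      (ε * K.pulse (s / ε) ((extChartAt (𝓡 n) p).symm (z s))))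
    (h3 : ∀ s, (1 - ε * K.gLin (s / ε, (extChartAt (𝓡 n) p).symm (z s)) (u s)) /
      (ε * K.pulse (s / ε) ((extChartAt (𝓡 n) p).symm (z s))) ≤ H s) :
    ∃ T ≤ ∫ s in (0 : ℝ)..σ, H s,
      K.KReach ε T ((extChartAt (𝓡 n) p).symm (z 0)) ((extChartAt (𝓡 n) p).symm (z σ)) := by
  set ψ := (extChartAt (𝓡 n) p).symm with hψ
  have hyc : Continuous fun s => ψ (z s) :=
    (continuousOn_extChartAt_symm p).comp_continuous hz.continuous fun s => hBt (hzB s)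
  set y : C(ℝ, M) := ⟨fun s => ψ (z s), hyc⟩ with hy
  have hpair : Continuous fun s => (s / ε, ψ (z s)) := (continuous_id.div_const ε).prodMk hyc
  have hpc : Continuous fun s => K.pulse (s / ε) (ψ (z s)) := K.continuous_pulse.comp hpair
  have hgc : Continuous fun s => K.gLin (s / ε, ψ (z s)) (u s) :=
    (K.continuous_gLin.comp hpair).clm_apply hu
  -- `h` is the derivative of time with respect to `s = ε θ`. With control `v = u / h`, the relation
  -- `ds/dt = ε (ω + g v) = 1 / h` gives `h = (1 - ε g u) / (ε ω)`, and `‖v‖ ≤ ε` becomes exactly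
  -- hypothesis `h1`.
  set h : ℝ → ℝ := fun s => (1 - ε * K.gLin (s / ε, ψ (z s)) (u s)) /
    (ε * K.pulse (s / ε) (ψ (z s))) with hh
  have hpos : ∀ s, 0 < ε * K.pulse (s / ε) (ψ (z s)) := fun s => mul_pos hε (K.pulse_pos _ _)
  have hhc : Continuous h := by
    exact (continuous_const.sub (continuous_const.mul hgc)).div (continuous_const.mul hpc)
      fun s => (hpos s).ne'
  obtain ⟨S, hSm, hSτ, hSd⟩ := exists_time_change hhc hc h2
  have hhpos : ∀ s, 0 < h s := fun s => hc.trans_le (h2 s)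
  have hS0 : S 0 = 0 := by simpa using hSτ 0
  set T := ∫ r in (0 : ℝ)..σ, h r with hT
  have hST : S T = σ := hSτ σ
  have hT0 : 0 ≤ T := by
    rw [← hSm.le_iff_le, hS0, hST]; exact hσ
  have hSl : LipschitzWith (c⁻¹).toNNReal S := by
    refine lipschitzWith_of_nnnorm_deriv_le (fun t => (hSd t).differentiableAt) fun t => ?_
    rw [(hSd t).deriv, ← NNReal.coe_le_coe, coe_nnnorm, Real.coe_toNNReal _ (inv_pos.2 hc).le,
      Real.norm_of_nonneg (inv_pos.2 (hhpos _)).le]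
    exact inv_anti₀ hc (h2 _)
  have hSc : Continuous S := hSl.continuous
  have hIoo : ∀ᵐ t ∂(volume.restrict (Icc 0 T)), t ∈ Ioo 0 T := by
    rw [← Measure.restrict_congr_set Ioo_ae_eq_Icc]
    exact ae_restrict_mem measurableSet_Ioo
  refine ⟨T, intervalIntegral.integral_mono hσ (hhc.intervalIntegrable _ _)
    (hH.intervalIntegrable _ _) h3, hT0, fun t => S t / ε, y.comp ⟨S, hSc⟩,
    fun t => (h (S t))⁻¹ • u (S t), ⟨‖ε⁻¹‖₊ * (c⁻¹).toNNReal, ?_⟩, ?_, ?_, fun t _ => ?_, ?_, ?_, ?_,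
    ?_, k, ?_⟩
  · have := (lipschitzWith_smul (α := ℝ) (β := ℝ) ε⁻¹).comp hSl
    have e : (fun t => S t / ε) = (fun x => ε⁻¹ • x) ∘ S := by
      funext t; simp [div_eq_inv_mul]
    rw [e]
    exact LipschitzWith.lipschitzOnWith this
  · exact lipCurveOn_symm_comp hB hBc hBt (z := z ∘ S) (fun t _ => rfl)
      (hz.comp hSl).lipschitzOnWith fun t _ => hzB _
  · exact ((hhc.comp hSc).inv₀ fun t => (hhpos _).ne').smul (hu.comp hSc) |>.measurable
  · rw [mem_ofPred_eq, norm_smul, norm_inv, Real.norm_of_nonneg (hhpos _).le,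
      inv_mul_le_iff₀ (hhpos _), hh]
    dsimp only
    rw [div_mul_eq_mul_div, le_div_iff₀ (hpos _)]
    have := mul_le_mul_of_nonneg_left (h1 (S t)) hε.le
    linarith
  · filter_upwards [hIoo] with t ht
    have hs : S t ∈ Ioo 0 σ := ⟨by rw [← hS0]; exact hSm ht.1, by rw [← hST]; exact hSm ht.2⟩
    refine ⟨(h (S t))⁻¹ / ε, (h (S t))⁻¹ • K.GLin (S t / ε) (ψ (z (S t))) (u (S t)),
      (hSd t).div_const ε, ?_, ?_, ?_⟩
    · refine HasVelocityAt.comp (x := y) (f := S) ?_ (hSd t) EventuallyEq.rfl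
      refine hasVelocityAt_symm_comp hg (p := p) (z := z) EventuallyEq.rfl (hBt (hzB _))
        (hgB _ (hzB _)) ?_
      have := hd _ hs
      rw [derLin_eq] at this
      exact this
    · rw [← gLin_apply, map_smul, smul_eq_mul]
      change _ = K.pulse (S t / ε) (ψ (z (S t))) + (h (S t))⁻¹ * K.gLin (S t / ε, ψ (z (S t))) _
      have hne : h (S t) ≠ 0 := (hhpos _).ne'
      have e : h (S t) * (ε * K.pulse (S t / ε) (ψ (z (S t)))) =
          1 - ε * K.gLin (S t / ε, ψ (z (S t))) (u (S t)) :=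
        div_mul_cancel₀ _ (hpos _).ne'
      field_simp
      linarith
    · rw [← GLin_apply, map_smul]
      rfl
  · simp [hy, hS0]
  · simp [hy, hST]
  · simp [hS0]
  · simp only [hST, hk]

end KeplerSystem

theorem Function.Periodic.integral_comp_div {F : Type*} [NormedAddCommGroup F] [NormedSpace ℝ F]
    [CompleteSpace F]
    {f : ℝ → F} {T : ℝ} (hf : Function.Periodic f T) (hc : Continuous f) {ε : ℝ} (hε : ε ≠ 0)
    (k : ℕ) : ∫ s in (0 : ℝ)..(T * k * ε), f (s / ε) = (ε * k) • ∫ θ in (0 : ℝ)..T, f θ := by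
  rw [intervalIntegral.integral_comp_div _ hε, zero_div, mul_div_cancel_right₀ _ hε, mul_smul]
  have := hf.intervalIntegral_add_zsmul_eq k 0 fun a b => hc.intervalIntegrable a b
  rw [zero_add, zero_add, zsmul_eq_mul] at this
  rw [mul_comm T, ← Int.cast_natCast (R := ℝ) k, this, Int.cast_smul_eq_zsmul]

/-- Smallness of the parameters in `exists_steering`. -/
theorem exists_steering_parameters {a L Q Q' R r C : ℝ} (ha : 0 ≤ a) (hL : 0 ≤ L) (hQ : 0 ≤ Q)
    (hQ' : 0 ≤ Q') (hR : 0 < R) (hr : 0 < r) (hC : 0 ≤ C) :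
    ∃ δ > 0, ∀ Δ x σ, 0 < Δ → Δ < δ → x < δ → 0 ≤ σ → σ ≤ C * Δ →
      x + a * Q * σ ≤ R ∧ L * Q * σ ≤ 1 / 2 ∧ L * (x + a * Q * σ) * Q * σ ≤ Δ * r ∧
      (L * (2 * (a * Q' * σ)) * Q + L * (x + a * Q * σ) * Q') * σ ≤ Δ / 2 := by
  have key : ∀ (f : ℝ → ℝ) (b : ℝ), Continuous f → f 0 = 0 → 0 < b → ∀ᶠ δ in 𝓝[>] 0, f δ < b :=
    fun f b hf h0 hb => ((hf.tendsto' 0 0 h0).eventually_lt_const hb).filter_mono nhdsWithin_le_nhds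
  -- Since `σ ≤ C * Δ`, the last two conditions are divided by `Δ`; what remains on the left of
  -- every condition tends to `0` with `δ`.
  have e1 := key (fun δ => δ + a * Q * (C * δ)) R (by fun_prop) (by simp) hR
  have e2 := key (fun δ => L * Q * (C * δ)) (1 / 2) (by fun_prop) (by simp) (by norm_num)
  have e3 := key (fun δ => L * (δ + a * Q * (C * δ)) * Q * C) r (by fun_prop) (by simp) hr
  have e4 := key (fun δ => (L * (2 * (a * Q' * (C * δ))) * Q + L * (δ + a * Q * (C * δ)) * Q') * C)
    (1 / 2) (by fun_prop) (by simp) (by norm_num)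
  obtain ⟨δ, h1, h2, h3, h4, hδ⟩ := (e1.and (e2.and (e3.and (e4.and self_mem_nhdsWithin)))).exists
  refine ⟨δ, hδ, fun Δ x σ hΔ hΔδ hx hσ hσC => ?_⟩
  have hδ0 : (0 : ℝ) < δ := hδ
  have hσ' : σ ≤ C * δ := hσC.trans (by gcongr)
  have hρ : x + a * Q * σ ≤ δ + a * Q * (C * δ) := by gcongr
  refine ⟨hρ.trans h1.le, le_trans (by gcongr) h2.le, ?_, ?_⟩
  · calc L * (x + a * Q * σ) * Q * σ ≤ L * (δ + a * Q * (C * δ)) * Q * (C * Δ) := by gcongr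
      _ = Δ * (L * (δ + a * Q * (C * δ)) * Q * C) := by ring
      _ ≤ Δ * r := by gcongr
  · calc _ ≤ (L * (2 * (a * Q' * (C * δ))) * Q + L * (δ + a * Q * (C * δ)) * Q') * (C * Δ) := by
          gcongr
      _ = Δ * ((L * (2 * (a * Q' * (C * δ))) * Q + L * (δ + a * Q * (C * δ)) * Q') * C) := by ring
      _ ≤ Δ * (1 / 2) := by gcongr
      _ = Δ / 2 := by ring

/-! ### Nearly optimal short displacements of the Kepler system -/

section ChartBall

variable {n : ℕ} {M : Type*} [TopologicalSpace M] [ChartedSpace (EuclideanSpace ℝ (Fin n)) M]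
  [IsManifold (𝓡 n) ∞ M]

open KeplerSystem

/-- A smooth map that coincides with a chart on a ball read in this chart. -/
theorem exists_contMDiff_eq_chart_closedBall [T2Space M] {p : M} {N : Set M} (hN : N ∈ 𝓝 p) :
    ∃ g : M → EuclideanSpace ℝ (Fin n), ContMDiff (𝓡 n) 𝓘(ℝ, EuclideanSpace ℝ (Fin n)) ∞ g ∧
      g =ᶠ[𝓝 p] extChartAt (𝓡 n) p ∧
      ∃ R > 0, Metric.closedBall (extChartAt (𝓡 n) p p) R ⊆ (extChartAt (𝓡 n) p).target ∧
        ∀ z ∈ Metric.closedBall (extChartAt (𝓡 n) p p) R, (extChartAt (𝓡 n) p).symm z ∈ N ∧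
          g =ᶠ[𝓝 ((extChartAt (𝓡 n) p).symm z)] extChartAt (𝓡 n) p := by
  obtain ⟨g, hg, hgp⟩ := exists_contMDiff_eq_extChartAt (n := n) p (mem_extChartAt_source p)
  refine ⟨g, hg, hgp, ?_⟩
  have hψ : ContinuousAt (extChartAt (𝓡 n) p).symm (extChartAt (𝓡 n) p p) :=
    continuousAt_extChartAt_symm p
  have hev : ∀ᶠ x in 𝓝 ((extChartAt (𝓡 n) p).symm (extChartAt (𝓡 n) p p)),
      x ∈ N ∧ g =ᶠ[𝓝 x] extChartAt (𝓡 n) p := by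
    rw [extChartAt_to_inv]
    exact (eventually_mem_set.2 hN).and hgp.eventually_nhds
  obtain ⟨R, hR, hsub⟩ := Metric.nhds_basis_closedBall.mem_iff.1
    (inter_mem (extChartAt_target_mem_nhds (I := 𝓡 n) p) (hψ.eventually hev))
  exact ⟨R, hR, fun z hz => (hsub hz).1, fun z hz => (hsub hz).2⟩

namespace KeplerSystem

/-- A smooth map is bounded and Lipschitz on the compact convex set formed by a period and `B`;
periodicity makes the bounds uniform in the angle. -/
theorem exists_derLin_symm_bounds {m : ℕ} (K : KeplerSystem n m M)
    {g : M → EuclideanSpace ℝ (Fin n)} (hg : ContMDiff (𝓡 n) 𝓘(ℝ, EuclideanSpace ℝ (Fin n)) ∞ g)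
    {p : M} {B : Set (EuclideanSpace ℝ (Fin n))} (hB : IsCompact B) (hBc : Convex ℝ B)
    (hBt : B ⊆ (extChartAt (𝓡 n) p).target) :
    ContinuousOn (fun q : ℝ × EuclideanSpace ℝ (Fin n) =>
        K.derLin g (q.1, (extChartAt (𝓡 n) p).symm q.2)) (univ ×ˢ B) ∧
      ∃ a L : ℝ, 0 ≤ a ∧ 0 ≤ L ∧ ∀ θ, ∀ z ∈ B,
        ‖K.derLin g (θ, (extChartAt (𝓡 n) p).symm z)‖ ≤ a ∧
        ∀ z' ∈ B, ‖K.derLin g (θ, (extChartAt (𝓡 n) p).symm z) -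
          K.derLin g (θ, (extChartAt (𝓡 n) p).symm z')‖ ≤ L * ‖z - z'‖ := by
  have hsm : ContMDiffOn (𝓘(ℝ, ℝ).prod 𝓘(ℝ, EuclideanSpace ℝ (Fin n)))
      𝓘(ℝ, EuclideanSpace ℝ (Fin m) →L[ℝ] EuclideanSpace ℝ (Fin n)) ∞
      (fun q : ℝ × EuclideanSpace ℝ (Fin n) =>
        K.derLin g (q.1, (extChartAt (𝓡 n) p).symm q.2)) (univ ×ˢ B) := by
    refine (K.contMDiff_derLin hg).comp_contMDiffOn ?_
    exact contMDiff_fst.contMDiffOn.prodMk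
      (((contMDiffOn_extChartAt_symm p).mono hBt).comp contMDiff_snd.contMDiffOn fun q hq => hq.2)
  rw [← modelWithCornersSelf_prod, chartedSpaceSelf_prod, contMDiffOn_iff_contDiffOn] at hsm
  refine ⟨hsm.continuousOn, ?_⟩
  have hKc := (isCompact_Icc (a := (0 : ℝ)) (b := 2 * Real.pi)).prod hB
  have hsub : Icc (0 : ℝ) (2 * Real.pi) ×ˢ B ⊆ univ ×ˢ B := prod_mono_left (subset_univ _)
  obtain ⟨a, ha⟩ := hKc.exists_bound_of_continuousOn (hsm.continuousOn.mono hsub)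
  obtain ⟨L, hL⟩ := (hsm.mono hsub).exists_lipschitzOnWith (by simp)
    ((convex_Icc _ _).prod hBc) hKc
  refine ⟨max a 0, L, le_max_right _ _, L.2, fun θ z hz => ?_⟩
  obtain ⟨j, hj, -⟩ := existsUnique_zsmul_near_of_pos' Real.two_pi_pos θ
  have hp : ∀ x, K.derLin g (θ, x) = K.derLin g (θ - j • (2 * Real.pi), x) := fun x =>
    ((K.periodic_derLin g x).sub_zsmul_eq (x := θ) j).symm
  refine ⟨?_, fun z' hz' => ?_⟩
  · rw [hp]
    exact (ha (_, z) ⟨Ico_subset_Icc_self hj, hz⟩).trans (le_max_left _ _)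
  · rw [hp, hp ((extChartAt (𝓡 n) p).symm z')]
    have := hL.dist_le_mul (θ - j • (2 * Real.pi), z) ⟨Ico_subset_Icc_self hj, hz⟩
      (θ - j • (2 * Real.pi), z') ⟨Ico_subset_Icc_self hj, hz'⟩
    rwa [Prod.dist_eq, dist_self, max_eq_right dist_nonneg, dist_eq_norm, dist_eq_norm] at this

end KeplerSystem

end ChartBall

theorem avgMap_add {E V : Type*} [NormedAddCommGroup E] [InnerProductSpace ℝ E]
    [FiniteDimensional ℝ E] [NormedAddCommGroup V] [InnerProductSpace ℝ V] [FiniteDimensional ℝ V]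
    {T : ℝ} {ρ : ℝ → ℝ} {A : ℝ → V →L[ℝ] E} (hρ : Continuous ρ) (hA : Continuous A)
    {U U' : ℝ → V} (hU : Continuous U) (hU' : Continuous U') :
    avgMap T ρ A (fun θ => U θ + U' θ) = avgMap T ρ A U + avgMap T ρ A U' := by
  have i1 : IntervalIntegrable (fun θ => ρ θ • A θ (U θ)) volume 0 T :=
    (hρ.smul (hA.clm_apply hU)).intervalIntegrable _ _
  have i2 : IntervalIntegrable (fun θ => ρ θ • A θ (U' θ)) volume 0 T :=
    (hρ.smul (hA.clm_apply hU')).intervalIntegrable _ _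
  simp only [avgMap]
  rw [← intervalIntegral.integral_add i1 i2]
  simp only [map_add, smul_add]

namespace KeplerSystem

variable {n m : ℕ} {M : Type*} [TopologicalSpace M] [ChartedSpace (EuclideanSpace ℝ (Fin n)) M]
  [IsManifold (𝓡 n) ∞ M]

theorem integral_pulse_inv_comp_div (K : KeplerSystem n m M) (p : M) {ε : ℝ} (hε : ε ≠ 0) (k : ℕ) :
    ∫ s in (0 : ℝ)..(2 * Real.pi * k * ε), (K.pulse (s / ε) p)⁻¹ =
      2 * Real.pi * k * ε / K.pulseBar p := by
  have hper : Function.Periodic (fun θ => (K.pulse θ p)⁻¹) (2 * Real.pi) := fun θ => by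
    simp only [K.pulse_periodic]
  rw [hper.integral_comp_div ((K.continuous_pulse_left p).inv₀ fun θ => (K.pulse_pos θ p).ne') hε,
    pulseBar, smul_eq_mul, div_inv_eq_mul]
  have := Real.pi_ne_zero
  field_simp

variable [T2Space M]

/-- A control proportional to `U / ω` in the angle variable makes the displacement over whole turns
a multiple of the average with weight `density`. -/
theorem integral_control_comp_div (K : KeplerSystem n m M) (p : M)
    {U : ℝ → EuclideanSpace ℝ (Fin m)} (hU : Continuous U)
    (hUp : Function.Periodic U (2 * Real.pi)) (μ : ℝ) {ε : ℝ} (hε : ε ≠ 0) (k : ℕ) :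
    ∫ s in (0 : ℝ)..(2 * Real.pi * k * ε),
        K.GLin (s / ε) p ((μ * (K.pulse (s / ε) p)⁻¹) • U (s / ε)) =
      (μ * (2 * Real.pi * k * ε) / K.pulseBar p) •
        avgMap (2 * Real.pi) (K.density p) (fun θ => K.GLin θ p) U := by
  have hpi := Real.pi_ne_zero
  have hb := (K.pulseBar_pos p).ne'
  have hper : Function.Periodic (fun θ => K.GLin θ p ((μ * (K.pulse θ p)⁻¹) • U θ))
      (2 * Real.pi) := fun θ => by
    have := K.periodic_GLin p θ
    simp only [K.pulse_periodic, hUp θ] at this ⊢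
    rw [this]
  have hcont : Continuous fun θ => K.GLin θ p ((μ * (K.pulse θ p)⁻¹) • U θ) :=
    (K.continuous_GLin p).clm_apply ((continuous_const.mul
      ((K.continuous_pulse_left p).inv₀ fun θ => (K.pulse_pos θ p).ne')).smul hU)
  have e : (fun θ => K.GLin θ p ((μ * (K.pulse θ p)⁻¹) • U θ)) = fun θ =>
      (μ * (2 * Real.pi) / K.pulseBar p) • (K.density p θ • K.GLin θ p (U θ)) := by
    funext θ
    have := (K.pulse_pos θ p).ne'
    rw [map_smul, smul_smul, density]
    congr 1
    field_simp
  rw [hper.integral_comp_div hcont hε, e, intervalIntegral.integral_smul, smul_smul, avgMap]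
  congr 1
  ring

set_option maxHeartbeats 1000000 in
/-- Short displacements are realized, for small `ε`, nearly as fast as in the average system frozen
at `p`. -/
theorem FullRank.exists_local_kReach {K : KeplerSystem n m M} (hK : K.FullRank) (p : M) {Λ : ℝ}
    (hΛ : 1 < Λ) :
    ∃ N ∈ 𝓝 p, ∃ Δ₀ > 0, ∀ a ∈ N, ∀ b ∈ N, ∀ Δ, 0 < Δ → Δ < Δ₀ →
      (∀ l, l (extChartAt (𝓡 n) p b - extChartAt (𝓡 n) p a) ≤ Δ * K.supp p l) →
      ∀ᶠ ε in 𝓝[>] (0 : ℝ), ∃ T ≤ Λ ^ 7 * Δ / ε, K.KReach ε T a b := by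
  have hΛ0 : 0 < Λ := one_pos.trans hΛ
  obtain ⟨k, hk, hpulse⟩ := K.pulse_lower
  set φ := extChartAt (𝓡 n) p with hφ
  set ω₀ := K.pulseBar p with hω₀
  have hω₀pos : 0 < ω₀ := K.pulseBar_pos p
  obtain ⟨Cp, hCp, hCpb⟩ := Function.Periodic.exists_norm_le (q := fun θ => K.pulse θ p)
    (K.pulse_periodic · p) Real.two_pi_pos (K.continuous_pulse_left p)
  obtain ⟨Cg, hCg, hCgb⟩ := (K.periodic_gLin p).exists_norm_le Real.two_pi_pos
    (K.continuous_gLin.comp (by fun_prop : Continuous fun θ : ℝ => (θ, p)))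
  have hN1 : ∀ᶠ x in 𝓝 p, ∀ θ, dist (K.pulse θ x) (K.pulse θ p) < (Λ - 1) * k :=
    eventually_forall_dist_lt_of_periodic (q := fun q : ℝ × M => K.pulse q.1 q.2) Real.two_pi_pos
      (fun x θ => K.pulse_periodic θ x) K.continuous_pulse p (mul_pos (sub_pos.2 hΛ) hk)
  have hN2 : ∀ᶠ x in 𝓝 p, ∀ θ, dist (K.gLin (θ, x)) (K.gLin (θ, p)) < 1 :=
    eventually_forall_dist_lt_of_periodic Real.two_pi_pos K.periodic_gLin K.continuous_gLin p
      one_pos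
  obtain ⟨g, hg, hgp, R, hR, hRt, hRN⟩ := exists_contMDiff_eq_chart_closedBall (n := n) (hN1.and hN2)
  set B := Metric.closedBall (φ p) R with hBdef
  have hB : IsCompact B := isCompact_closedBall _ _
  have hBc : Convex ℝ B := convex_closedBall _ _
  have hup : ∀ z ∈ B, ∀ θ, K.pulse θ (φ.symm z) ≤ Λ * K.pulse θ p := fun z hz θ => by
    have := abs_lt.1 ((hRN z hz).1.1 θ)
    nlinarith [hpulse θ p]
  have hlow : ∀ z ∈ B, ∀ θ, K.pulse θ p ≤ Λ * K.pulse θ (φ.symm z) := fun z hz θ => by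
    have := abs_lt.1 ((hRN z hz).1.1 θ)
    nlinarith [hpulse θ (φ.symm z)]
  have hgl : ∀ z ∈ B, ∀ θ, ‖K.gLin (θ, φ.symm z)‖ ≤ Cg + 1 := fun z hz θ => by
    have h1 := (hRN z hz).1.2 θ
    rw [dist_eq_norm] at h1
    have h2 := norm_le_norm_add_norm_sub' (K.gLin (θ, φ.symm z)) (K.gLin (θ, p))
    have h3 : ‖K.gLin (θ, p)‖ ≤ Cg := hCgb θ
    linarith
  obtain ⟨hAc, A₀, L, hA₀, hL, hAb⟩ := K.exists_derLin_symm_bounds hg hB hBc hRt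
  obtain ⟨W₀, hW₀c, hW₀p, hW₀⟩ := exists_rightInverse_avgMap Real.two_pi_pos
    (K.continuous_density_right p) (K.density_pos p) (K.continuous_GLin p)
    (K.periodic_GLin p) (fun _ => hK.eq_zero p)
  obtain ⟨CW, hCW, hCWb⟩ := hW₀p.exists_norm_le Real.two_pi_pos hW₀c
  -- Corrections `c` of this size keep `‖U₀ + W₀ c‖ ≤ Λ`.
  have hr : 0 < (Λ - 1) / CW := div_pos (sub_pos.2 hΛ) hCW
  obtain ⟨δ, hδ, hpar⟩ := exists_steering_parameters (a := A₀) (L := L) (Q := 1 / k)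
    (Q' := CW / k) (R := R) (r := (Λ - 1) / CW) (C := ω₀ * Λ ^ 5) hA₀ hL (by positivity)
    (by positivity) hR hr (by positivity)
  have hNmem : {a | a ∈ φ.source ∧ φ a ∈ Metric.ball (φ p) δ} ∈ 𝓝 p :=
    inter_mem (extChartAt_source_mem_nhds p)
      (continuousAt_extChartAt p (Metric.ball_mem_nhds _ hδ))
  refine ⟨_, hNmem, δ, hδ, fun a ha b hb Δ hΔ hΔδ hab => ?_⟩
  set d := φ b - φ a with hd
  -- The contraction by `Λ⁻¹` is the price of a continuous control in the unit ball with the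
  -- prescribed average.
  obtain ⟨U₀, hU₀c, hU₀p, hU₀1, hU₀⟩ := exists_continuous_avgMap_eq_smul Real.two_pi_pos
    (K.continuous_density_right p) (K.density_pos p) (K.integral_density p) (K.continuous_GLin p)
    (K.periodic_GLin p) (fun _ => hK.eq_zero p) (w := Δ⁻¹ • d) (s := Λ⁻¹)
    (fun l => by
      rw [map_smul, smul_eq_mul, inv_mul_le_iff₀ hΔ]
      exact hab l) (inv_pos.2 hΛ0).le (inv_lt_one_of_one_lt₀ hΛ)
  have key : ∀ (c : ℝ), 0 < c → ∀ C : ℝ, ∀ᶠ ε in 𝓝[>] (0 : ℝ), C * ε ≤ c := fun c hc C => by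
    have : Tendsto (fun ε : ℝ => C * ε) (𝓝 0) (𝓝 0) :=
      (continuous_const.mul continuous_id).tendsto' 0 0 (by simp)
    exact ((this.eventually_lt_const hc).filter_mono nhdsWithin_le_nhds).mono fun _ => le_of_lt
  have hinv1 : Λ⁻¹ < 1 := inv_lt_one_of_one_lt₀ hΛ
  filter_upwards [self_mem_nhdsWithin,
    key (Δ * ω₀ * Λ ^ 4 * (Λ - 1)) (by have := sub_pos.2 hΛ; positivity) (2 * Real.pi),
    key (1 - Λ⁻¹) (sub_pos.2 hinv1) ((Cg + 1) * (1 / k))] with ε hε hε1 hε2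
  have hε0 : (0 : ℝ) < ε := hε
  -- The number of turns, rounded up so that `σ ≥ Δ ω₀ Λ ^ 4`. The excess is at most one turn, of
  -- length `2π ε`, and for small `ε` it costs less than one more factor `Λ`.
  set j := ⌈Δ * ω₀ * Λ ^ 4 / (2 * Real.pi * ε)⌉₊ with hj
  set σ : ℝ := 2 * Real.pi * j * ε with hσ
  have h2πε : 0 < 2 * Real.pi * ε := by positivity
  have hσ1 : Δ * ω₀ * Λ ^ 4 ≤ σ := by
    have := (div_le_iff₀ h2πε).1 (Nat.le_ceil (Δ * ω₀ * Λ ^ 4 / (2 * Real.pi * ε)))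
    rw [hσ]; linarith
  have hσ2 : σ ≤ ω₀ * Λ ^ 5 * Δ := by
    have h := Nat.ceil_lt_add_one (div_nonneg (by positivity : 0 ≤ Δ * ω₀ * Λ ^ 4) h2πε.le)
    have h' := mul_le_mul_of_nonneg_right h.le h2πε.le
    rw [add_mul, div_mul_cancel₀ _ h2πε.ne', one_mul] at h'
    calc σ = j * (2 * Real.pi * ε) := by rw [hσ]; ring
      _ ≤ Δ * ω₀ * Λ ^ 4 + 2 * Real.pi * ε := h'
      _ ≤ ω₀ * Λ ^ 5 * Δ := by linarith [hε1]
  have hσpos : 0 < σ := lt_of_lt_of_le (by positivity) hσ1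
  -- With this amplitude, averages are multiplied by `μ σ / ω₀ = Δ Λ`, so the control `U₀ + W₀ c`
  -- produces `d + (Δ Λ) • c` in the frozen system. The slack `μ Λ ^ 3 ≤ 1` pays for the correction
  -- `c`, for the variation of the pulsation near `p` and for the perturbation `ε g u`, one factor
  -- each.
  set μ := Δ * ω₀ * Λ / σ with hμ
  have hμ0 : 0 < μ := by positivity
  have hμΛ : μ * Λ ^ 3 ≤ 1 := by
    rw [hμ, div_mul_eq_mul_div, div_le_one hσpos]
    linarith
  have hμ2 : μ * Λ ^ 2 ≤ Λ⁻¹ := by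
    rw [← one_div, le_div_iff₀ hΛ0]; linarith
  have hμ1 : μ * Λ ≤ 1 := by
    have : μ * Λ ≤ μ * Λ ^ 3 := by
      gcongr
      exact le_self_pow₀ hΛ.le (by norm_num)
    linarith
  have hμ1' : μ ≤ 1 := by nlinarith
  set u : ℝ → EuclideanSpace ℝ (Fin m) := fun s =>
    (μ * (K.pulse (s / ε) p)⁻¹) • U₀ (s / ε) with hu
  set W : ℝ → EuclideanSpace ℝ (Fin n) →L[ℝ] EuclideanSpace ℝ (Fin m) := fun s =>
    (μ * (K.pulse (s / ε) p)⁻¹) • W₀ (s / ε) with hW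
  have hcoef : Continuous fun s => μ * (K.pulse (s / ε) p)⁻¹ :=
    continuous_const.mul (((K.continuous_pulse_left p).comp (continuous_id.div_const ε)).inv₀
      fun s => (K.pulse_pos _ p).ne')
  have huc : Continuous u := hcoef.smul (hU₀c.comp (continuous_id.div_const ε))
  have hWc : Continuous W := hcoef.smul (hW₀c.comp (continuous_id.div_const ε))
  have huW : ∀ s c, u s + W s c = (μ * (K.pulse (s / ε) p)⁻¹) • (U₀ (s / ε) + W₀ (s / ε) c) :=
    fun s c => by simp [hu, hW, smul_add]
  have hpk : ∀ θ, (K.pulse θ p)⁻¹ ≤ k⁻¹ := fun θ => inv_anti₀ hk (hpulse θ p)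
  have hpi : ∀ θ, 0 < (K.pulse θ p)⁻¹ := fun θ => inv_pos.2 (K.pulse_pos θ p)
  have hbound : ∀ s c, ‖c‖ ≤ (Λ - 1) / CW → ‖u s + W s c‖ ≤ μ * (K.pulse (s / ε) p)⁻¹ * Λ :=
    fun s c hc => by
      rw [huW, norm_smul, Real.norm_of_nonneg (mul_pos hμ0 (hpi _)).le]
      refine mul_le_mul_of_nonneg_left ?_ (mul_pos hμ0 (hpi _)).le
      have h1 : ‖W₀ (s / ε) c‖ ≤ CW * ((Λ - 1) / CW) :=
        (W₀ (s / ε)).le_of_opNorm_le_of_le (hCWb _) hc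
      rw [mul_div_cancel₀ _ hCW.ne'] at h1
      linarith [norm_add_le (U₀ (s / ε)) (W₀ (s / ε) c), hU₀1 (s / ε)]
  have hboundk : ∀ s c, ‖c‖ ≤ (Λ - 1) / CW → ‖u s + W s c‖ ≤ 1 / k := fun s c hc => by
    refine (hbound s c hc).trans ?_
    calc μ * (K.pulse (s / ε) p)⁻¹ * Λ = μ * Λ * (K.pulse (s / ε) p)⁻¹ := by ring
      _ ≤ 1 * k⁻¹ := mul_le_mul hμ1 (hpk _) (hpi _).le zero_le_one
      _ = 1 / k := by ring
  have hφp : φ.symm (φ p) = p := extChartAt_to_inv p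
  have hAp : ∀ θ, K.derLin g (θ, φ.symm (φ p)) = K.GLin θ p := fun θ => by
    rw [hφp, derLin_eq, diff_eq_id_of_eventuallyEq hgp, ContinuousLinearMap.id_comp]
  obtain ⟨hp1, hp2, hp3, hp4⟩ := hpar Δ ‖φ a - φ p‖ σ hΔ hΔδ (mem_ball_iff_norm.1 ha.2) hσpos.le hσ2
  have hΔΛ : Δ ≤ Δ * Λ := le_mul_of_one_le_right hΔ.le hΛ.le
  obtain ⟨c, hc, z, hzl, hz0, hzσ, hzB, hzd⟩ := exists_steering
    (A := fun s z => K.derLin g (s / ε, φ.symm z)) (u := u) (W := W) (p := φ p) (z₀ := φ a) (d := d)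
    (R := R) (a := A₀) (L := L) (Q := 1 / k) (Q' := CW / k) (r := (Λ - 1) / CW) (σ := σ)
    (Δ := Δ * Λ) (ρ := ‖φ a - φ p‖ + A₀ * (1 / k) * σ) hσpos.le hA₀ hL (by positivity) hr.le
    (by positivity)
    (hAc.comp (f := fun q : ℝ × EuclideanSpace ℝ (Fin n) => (q.1 / ε, q.2))
      (by fun_prop) fun q hq => ⟨mem_univ _, hq.2⟩)
    (fun s z hz => (hAb _ z hz).1) (fun s z hz z' hz' => (hAb _ z hz).2 z' hz') huc hWc hboundk
    (fun s => by
      rw [hW, norm_smul, Real.norm_of_nonneg (mul_pos hμ0 (hpi _)).le]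
      calc μ * (K.pulse (s / ε) p)⁻¹ * ‖W₀ (s / ε)‖ ≤ 1 * k⁻¹ * CW :=
            mul_le_mul (mul_le_mul hμ1' (hpk _) (hpi _).le zero_le_one) (hCWb _) (norm_nonneg _)
              (by positivity)
        _ = CW / k := by ring)
    (fun c => by
      have h1 := K.integral_control_comp_div p (U := fun θ => U₀ θ + W₀ θ c)
        (hU₀c.add (hW₀c.clm_apply continuous_const))
        (fun θ => by simp only [hU₀p θ, hW₀p θ]) μ hε0.ne' j
      have h2 : avgMap (2 * Real.pi) (K.density p) (fun θ => K.GLin θ p)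
          (fun θ => U₀ θ + W₀ θ c) = Λ⁻¹ • Δ⁻¹ • d + c := by
        rw [← hU₀]
        conv_rhs => rw [← hW₀ c]
        exact avgMap_add (K.continuous_density_right p) (K.continuous_GLin p) hU₀c
          (hW₀c.clm_apply continuous_const)
      have h3 : μ * σ / ω₀ = Δ * Λ := by
        rw [hμ]; field_simp
      rw [h2, ← hσ, ← hω₀, h3, smul_add, smul_smul, smul_smul,
        show Δ * Λ * Λ⁻¹ * Δ⁻¹ = 1 by field_simp, one_smul, add_comm] at h1
      rw [← h1]
      simp only [hAp, huW])
    rfl hp1 hp2 (hp3.trans (by gcongr)) (hp4.trans (by gcongr))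
  have hzB' : ∀ s, z s ∈ B := fun s => Metric.closedBall_subset_closedBall hp1 (hzB s)
  have hgu : ∀ s, |ε * K.gLin (s / ε, φ.symm (z s)) (u s + W s c)| ≤ 1 - Λ⁻¹ := fun s => by
    rw [abs_mul, abs_of_pos hε0]
    have : |K.gLin (s / ε, φ.symm (z s)) (u s + W s c)| ≤ (Cg + 1) * (1 / k) :=
      ContinuousLinearMap.le_of_opNorm_le_of_le _ (hgl _ (hzB' s) _) (hboundk s c hc)
    calc _ ≤ ε * ((Cg + 1) * (1 / k)) := by gcongr
      _ ≤ 1 - Λ⁻¹ := by linarith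
  have hΛinv : 2 - Λ⁻¹ ≤ Λ := by
    have h1 : Λ * Λ⁻¹ = 1 := mul_inv_cancel₀ hΛ0.ne'
    nlinarith [sq_nonneg (Λ - 1), inv_pos.2 hΛ0]
  have hjσ : σ / ε = ((j : ℤ) : ℝ) * (2 * Real.pi) := by
    rw [hσ, mul_div_cancel_right₀ _ hε0.ne', Int.cast_natCast, mul_comm]
  -- In the bound `H` of the time density, one factor `Λ` bounds `1 - ε g u` and the other compares
  -- the pulsations. Integrated over `σ ≤ ω₀ Λ ^ 5 Δ`, it gives the factor `Λ ^ 7`.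
  obtain ⟨T, hT, hreach⟩ := K.exists_kReach_of_angle hg hB hBc hRt (fun z hz => (hRN z hz).2)
    hε0 hσpos.le (k := j) hjσ hzl hzB'
    (u := fun s => u s + W s c) (huc.add (hWc.clm_apply continuous_const)) hzd
    (c := Λ⁻¹ / (ε * (Λ * Cp))) (by positivity)
    (H := fun s => Λ ^ 2 / ε * (K.pulse (s / ε) p)⁻¹)
    (continuous_const.mul (((K.continuous_pulse_left p).comp (continuous_id.div_const ε)).inv₀
      fun s => (K.pulse_pos _ p).ne'))
    (fun s => by
      have h1 := (abs_le.1 (hgu s)).2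
      have h2 : K.pulse (s / ε) (φ.symm (z s)) * ‖u s + W s c‖ ≤
          Λ * K.pulse (s / ε) p * (μ * (K.pulse (s / ε) p)⁻¹ * Λ) :=
        mul_le_mul (hup _ (hzB' s) _) (hbound s c hc) (norm_nonneg _)
          (mul_pos hΛ0 (K.pulse_pos _ _)).le
      have h3 : Λ * K.pulse (s / ε) p * (μ * (K.pulse (s / ε) p)⁻¹ * Λ) = μ * Λ ^ 2 := by
        have := (K.pulse_pos (s / ε) p).ne'
        field_simp
      linarith)
    (fun s => by
      have h1 := (abs_le.1 (hgu s)).2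
      have h2 := hup _ (hzB' s) (s / ε)
      have h3 : K.pulse (s / ε) p ≤ Cp := (le_abs_self _).trans (hCpb _)
      have h4 := K.pulse_pos (s / ε) (φ.symm (z s))
      refine div_le_div₀ ?_ ?_ (by positivity) ?_
      · linarith [inv_pos.2 hΛ0]
      · linarith
      · gcongr
        exact h2.trans (by gcongr))
    (fun s => by
      have h1 := (abs_le.1 (hgu s)).1
      have h2 := hlow _ (hzB' s) (s / ε)
      have h4 := K.pulse_pos (s / ε) (φ.symm (z s))
      have h5 := K.pulse_pos (s / ε) p
      rw [← div_eq_mul_inv, div_div, div_le_div_iff₀ (by positivity) (by positivity)]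
      calc _ ≤ Λ * (ε * (Λ * K.pulse (s / ε) (φ.symm (z s)))) := by
            gcongr
            linarith
        _ = _ := by ring)
  refine ⟨T, hT.trans ?_, ?_⟩
  · rw [intervalIntegral.integral_const_mul, hσ, K.integral_pulse_inv_comp_div p hε0.ne' j, ← hσ,
      ← hω₀, div_mul_div_comm, div_le_div_iff₀ (by positivity) hε0]
    calc Λ ^ 2 * σ * ε ≤ Λ ^ 2 * (ω₀ * Λ ^ 5 * Δ) * ε := by gcongr
      _ = Λ ^ 7 * Δ * (ε * ω₀) := by ring
  · rw [hz0, hzσ, hd, add_sub_cancel, φ.left_inv ha.1, φ.left_inv hb.1] at hreach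
    exact hreach

end KeplerSystem

/-! ### Following average solutions, and finiteness of the average minimal time -/

namespace KeplerSystem

variable {n m : ℕ} {M : Type*} [TopologicalSpace M] [ChartedSpace (EuclideanSpace ℝ (Fin n)) M]
  [IsManifold (𝓡 n) ∞ M]

theorem supp_nonneg (K : KeplerSystem n m M) (x : M) (l : EuclideanSpace ℝ (Fin n) →L[ℝ] ℝ) :
    0 ≤ K.supp x l :=
  intervalIntegral.integral_nonneg Real.two_pi_pos.le fun θ _ =>
    mul_nonneg (K.density_pos x θ).le (norm_nonneg _)

theorem supp_smul (K : KeplerSystem n m M) (x : M) {c : ℝ} (hc : 0 ≤ c)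
    (l : EuclideanSpace ℝ (Fin n) →L[ℝ] ℝ) : K.supp x (c • l) = c * K.supp x l := by
  rw [supp, supp, avgSupp, avgSupp, ← intervalIntegral.integral_const_mul]
  congr 1
  funext θ
  rw [ContinuousLinearMap.smul_comp, norm_smul, Real.norm_of_nonneg hc]
  ring

variable [T2Space M]

/-- The support functions of the velocity sets at nearby points, read in a chart, are close. -/
theorem FullRank.eventually_supp_le {K : KeplerSystem n m M} (hK : K.FullRank) {p : M}
    {g : M → EuclideanSpace ℝ (Fin n)} (hg : ContMDiff (𝓡 n) 𝓘(ℝ, EuclideanSpace ℝ (Fin n)) ∞ g)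
    (hgp : g =ᶠ[𝓝 p] extChartAt (𝓡 n) p) {Λ : ℝ} (hΛ : 1 < Λ) :
    ∀ᶠ x in 𝓝 p, ∀ l, K.supp x (l ∘L diff g x) ≤ Λ * K.supp p l ∧
      K.supp p l ≤ Λ * K.supp x (l ∘L diff g x) := by
  have hΛ0 : 0 < Λ := one_pos.trans hΛ
  have hinv : Λ⁻¹ < 1 := inv_lt_one_of_one_lt₀ hΛ
  obtain ⟨C, hC, hCl⟩ := hK.norm_le_supp p
  have hκ : 0 < (1 - Λ⁻¹) / C := div_pos (sub_pos.2 hinv) hC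
  have hid : ∀ l : EuclideanSpace ℝ (Fin n) →L[ℝ] ℝ, l ∘L diff (n := n) g p = l := fun l => by
    rw [diff_eq_id_of_eventuallyEq hgp, ContinuousLinearMap.comp_id]
  -- On the compact sphere of unit forms closeness is uniform, and the lower bound `1 / C` of the
  -- support function turns this additive closeness into a multiplicative one. Homogeneity extends
  -- it to all forms.
  have hev : ∀ᶠ x in 𝓝 p, ∀ l ∈ Metric.sphere (0 : EuclideanSpace ℝ (Fin n) →L[ℝ] ℝ) 1,
      |K.supp x (l ∘L diff g x) - K.supp p l| < (1 - Λ⁻¹) / C := by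
    refine (isCompact_sphere _ _).eventually_forall_of_forall_eventually fun l _ => ?_
    have h1 := K.continuous_supp_diff hg
    have h2 : Continuous fun l => K.supp p (l ∘L diff (n := n) g p) :=
      h1.comp (by fun_prop : Continuous fun l : EuclideanSpace ℝ (Fin n) →L[ℝ] ℝ => (l, p))
    simp only [hid] at h2
    have h3 : Continuous fun z : M × (EuclideanSpace ℝ (Fin n) →L[ℝ] ℝ) =>
        |K.supp z.1 (z.2 ∘L diff g z.1) - K.supp p z.2| :=
      ((h1.comp continuous_swap).sub (h2.comp continuous_snd)).abs
    refine h3.continuousAt.eventually (gt_mem_nhds ?_)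
    simpa only [hid, sub_self, abs_zero] using hκ
  filter_upwards [hev] with x hx l
  rcases eq_or_ne l 0 with rfl | hl
  · simp [supp, avgSupp]
  have hl0 : 0 < ‖l‖ := norm_pos_iff.2 hl
  set l₁ := ‖l‖⁻¹ • l with hl₁
  have hn : ‖l₁‖ = 1 := by
    rw [hl₁, norm_smul, norm_inv, norm_norm, inv_mul_cancel₀ hl0.ne']
  have hll : l = ‖l‖ • l₁ := by rw [hl₁, smul_smul, mul_inv_cancel₀ hl0.ne', one_smul]
  have h1 := abs_lt.1 (hx l₁ (mem_sphere_zero_iff_norm.2 hn))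
  have h2 : 1 / C ≤ K.supp p l₁ := by
    rw [div_le_iff₀' hC, ← hn]; exact hCl l₁
  have h3 : (1 - Λ⁻¹) / C ≤ (1 - Λ⁻¹) * K.supp p l₁ := by
    rw [div_eq_mul_one_div]
    exact mul_le_mul_of_nonneg_left h2 (sub_pos.2 hinv).le
  have h4 := K.supp_nonneg p l₁
  have h5 : 1 - Λ⁻¹ ≤ Λ - 1 := by
    have : Λ * Λ⁻¹ = 1 := mul_inv_cancel₀ hΛ0.ne'
    nlinarith [sq_nonneg (Λ - 1), inv_pos.2 hΛ0]
  rw [hll, ContinuousLinearMap.smul_comp, K.supp_smul _ hl0.le, K.supp_smul _ hl0.le]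
  constructor
  · rw [mul_left_comm]
    refine mul_le_mul_of_nonneg_left ?_ hl0.le
    nlinarith
  · rw [mul_left_comm]
    refine mul_le_mul_of_nonneg_left ?_ hl0.le
    have : Λ⁻¹ * K.supp p l₁ ≤ K.supp x (l₁ ∘L diff g x) := by linarith
    rwa [inv_mul_le_iff₀ hΛ0] at this

/-- Solutions of the average system are followed by solutions of the Kepler systems, nearly as fast
when `ε` is small. -/
theorem FullRank.eventually_kReach {K : KeplerSystem n m M} (hK : K.FullRank) {T : ℝ} (hT : 0 ≤ T)
    {y : C(ℝ, M)} (hy : K.IsAvgSolution T y) {Λ : ℝ} (hΛ : 1 < Λ) :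
    ∀ᶠ ε in 𝓝[>] (0 : ℝ), ∃ T' ≤ Λ ^ 8 * T / ε, K.KReach ε T' (y 0) (y T) := by
  have hΛ0 : 0 < Λ := one_pos.trans hΛ
  suffices h : ∀ᶠ ε in 𝓝[>] (0 : ℝ), ∃ T' ≤ Λ ^ 8 * (T - 0) / ε, K.KReach ε T' (y 0) (y T) by
    simpa using h
  -- The time bound is additive in `s - r` and trajectories concatenate, so it is enough to follow
  -- short pieces of `y`.
  refine rel_of_locally_Icc (P := fun r s => ∀ᶠ ε in 𝓝[>] (0 : ℝ),
    ∃ T' ≤ Λ ^ 8 * (s - r) / ε, K.KReach ε T' (y r) (y s)) hT ?_ ?_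
  · intro r s t _ _ _ _ h1 h2
    filter_upwards [h1, h2] with ε ⟨T₁, hT₁, hr₁⟩ ⟨T₂, hT₂, hr₂⟩
    refine ⟨T₁ + T₂, (add_le_add hT₁ hT₂).trans_eq ?_, hr₁.trans hr₂⟩
    rw [← add_div]
    ring
  intro t _
  set p := y t with hp
  set φ := extChartAt (𝓡 n) p with hφ
  obtain ⟨N, hN, Δ₀, hΔ₀, hloc⟩ := hK.exists_local_kReach p hΛ
  obtain ⟨g, hg, hgp⟩ := exists_contMDiff_eq_extChartAt (n := n) p (mem_extChartAt_source p)
  have hev : ∀ᶠ x in 𝓝 p, x ∈ N ∧ x ∈ φ.source ∧ g =ᶠ[𝓝 x] φ ∧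
      ∀ l, K.supp x (l ∘L diff g x) ≤ Λ * K.supp p l := by
    filter_upwards [hN, extChartAt_source_mem_nhds (I := 𝓡 n) p, hgp.eventually_nhds,
      hK.eventually_supp_le hg hgp hΛ] with x h1 h2 h3 h4
    exact ⟨h1, h2, h3, fun l => (h4 l).1⟩
  have hδ : 0 < Δ₀ / (2 * Λ) := by positivity
  refine ⟨_, (y.continuous.continuousAt.eventually hev).and (Metric.ball_mem_nhds t hδ),
    fun r s hrs hr hle hs => ?_⟩
  rcases hle.eq_or_lt with rfl | hlt
  · filter_upwards [self_mem_nhdsWithin] with ε hε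
    exact ⟨0, by simp, KReach.refl K (le_of_lt hε) _⟩
  have hmem : ∀ u ∈ Icc r s, y u ∈ N ∧ y u ∈ φ.source ∧ g =ᶠ[𝓝 (y u)] φ ∧
      ∀ l, K.supp (y u) (l ∘L diff g (y u)) ≤ Λ * K.supp p l := fun u hu => (hrs hu).1
  have hlen : Λ * (s - r) < Δ₀ := by
    have h1 := abs_lt.1 (Metric.mem_ball.1 (hrs (left_mem_Icc.2 hle)).2)
    have h2 := abs_lt.1 (Metric.mem_ball.1 (hrs (right_mem_Icc.2 hle)).2)
    have h3 : Λ * (2 * (Δ₀ / (2 * Λ))) = Δ₀ := by field_simp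
    rw [← h3]
    exact mul_lt_mul_of_pos_left (by linarith [h1.1, h2.2]) hΛ0
  have hAC := hy.1 p r s hr hle hs fun u hu => (hmem u hu).2.1
  have hae : ∀ᵐ u ∂(volume.restrict (Icc r s)), ∃ w ∈ K.velocitySet (y u), HasVelocityAt y u w :=
    ae_restrict_of_ae_restrict_of_subset (Icc_subset_Icc hr hs) hy.2
  -- Integrating the support inequality of the velocities, with the support function at `u` compared
  -- to that at `p`, shows that the chart displacement is admissible for `Δ = Λ (s - r)`. This is
  -- the extra factor that changes `Λ ^ 7` into `Λ ^ 8`.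
  have hl : ∀ l : EuclideanSpace ℝ (Fin n) →L[ℝ] ℝ,
      l (φ (y s) - φ (y r)) ≤ Λ * (s - r) * K.supp p l := fun l => by
    have h := AbsolutelyContinuousOnInterval.sub_le_of_ae_deriv_le (F := fun u => l (φ (y u)))
      (c := Λ * K.supp p l) hle
      ((l.lipschitz.lipschitzOnWith (s := univ)).comp_absolutelyContinuousOnInterval hAC
        fun _ _ => mem_univ _) (by
      filter_upwards [hae, ae_restrict_mem measurableSet_Icc] with u ⟨w, hw, hv⟩ hu
      obtain ⟨-, -, hgu, hsu⟩ := hmem u hu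
      have hd := hv.hasDerivAt_comp (hg.mdifferentiable (by simp) _)
      refine ⟨l (diff g (y u) w), ?_, (K.apply_le_supp hw (l ∘L diff g (y u))).trans (hsu l)⟩
      refine (l.hasFDerivAt.comp_hasDerivAt u hd).congr_of_eventuallyEq ?_
      filter_upwards [y.continuous.continuousAt hgu] with v hv
      have hv' : g (y v) = φ (y v) := hv
      rw [Function.comp_apply, hv'])
    rw [map_sub]
    linarith
  have := hloc (y r) (hmem r (left_mem_Icc.2 hle)).1 (y s) (hmem s (right_mem_Icc.2 hle)).1
    (Λ * (s - r)) (mul_pos hΛ0 (sub_pos.2 hlt)) hlen hl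
  filter_upwards [this] with ε ⟨T', hT', hreach⟩
  exact ⟨T', hT'.trans_eq (by ring), hreach⟩

/-- The velocity sets near `p`, read in the chart, contain a common ball around `0`, so any segment
in the chart is a solution if it is travelled slowly enough. -/
theorem FullRank.exists_local_avgReach {K : KeplerSystem n m M} (hK : K.FullRank) (p : M) :
    ∃ N ∈ 𝓝 p, ∀ a ∈ N, ∀ b ∈ N, ∃ T, K.AvgReach T a b := by
  obtain ⟨g₀, hg₀, hg₀p⟩ := exists_contMDiff_eq_extChartAt (n := n) p (mem_extChartAt_source p)
  obtain ⟨g, hg, hgp, R, hR, hRt, hRN⟩ := exists_contMDiff_eq_chart_closedBall (n := n)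
    ((hK.eventually_supp_le hg₀ hg₀p one_lt_two).and hg₀p.eventually_nhds)
  set φ := extChartAt (𝓡 n) p with hφ
  set B := Metric.closedBall (φ p) R with hBdef
  obtain ⟨C, hC, hCl⟩ := hK.norm_le_supp p
  refine ⟨{a | a ∈ φ.source ∧ φ a ∈ B}, inter_mem (extChartAt_source_mem_nhds p)
    (continuousAt_extChartAt p (Metric.closedBall_mem_nhds _ hR)), fun a ha b hb => ?_⟩
  set d := φ b - φ a with hd
  -- `C` bounds norms by the support function at `p`, the factor `2` compares it with nearby points,
  -- and `1` keeps `T` positive when `d = 0`.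
  set T := 2 * C * ‖d‖ + 1 with hT
  have hT0 : 0 < T := by positivity
  set z : ℝ → EuclideanSpace ℝ (Fin n) := fun t => φ a + (max 0 (min (t / T) 1)) • d with hz
  have hzc : Continuous z := by fun_prop
  have hzB : ∀ t, z t ∈ B := fun t => by
    refine (convex_closedBall _ _).add_smul_sub_mem ha.2 hb.2 ⟨le_max_left _ _, ?_⟩
    exact max_le zero_le_one (min_le_right _ _)
  have hze : ∀ t ∈ Icc 0 T, z t = φ a + (t / T) • d := fun t ht => by
    rw [hz]
    dsimp only
    rw [min_eq_left ((div_le_one hT0).2 ht.2), max_eq_right (div_nonneg ht.1 hT0.le)]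
  set y : C(ℝ, M) := ⟨fun t => φ.symm (z t),
    (continuousOn_extChartAt_symm p).comp_continuous hzc fun t => hRt (hzB t)⟩ with hy
  have hIoo : ∀ᵐ t ∂(volume.restrict (Icc 0 T)), t ∈ Ioo 0 T := by
    rw [← Measure.restrict_congr_set Ioo_ae_eq_Icc]
    exact ae_restrict_mem measurableSet_Ioo
  refine ⟨T, hT0.le, fun _ => 0, y, fun _ => (), ⟨0, by simp⟩, ?_, measurable_const,
    fun _ _ => mem_univ _, ?_, ?_, ?_, rfl, 0, by simp⟩
  · refine lipCurveOn_symm_comp (isCompact_closedBall _ _) (convex_closedBall _ _) hRt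
      (C := ‖T⁻¹ • d‖₊) (fun t _ => rfl) (LipschitzOnWith.of_dist_le_mul fun s hs t ht => ?_)
      fun t _ => hzB t
    rw [hze s hs, hze t ht, dist_add_left, dist_eq_norm, ← sub_smul, ← sub_div, div_eq_mul_inv,
      mul_smul, norm_smul, mul_comm]
    rfl
  · filter_upwards [hIoo] with t ht
    obtain ⟨⟨hs, hgx'⟩, -⟩ := hRN (z t) (hzB t)
    have hgx : g₀ =ᶠ[𝓝 (φ.symm (z t))] extChartAt (𝓡 n) p := hgx'
    have hsrc : φ.symm (z t) ∈ φ.source := φ.map_target (hRt (hzB t))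
    have hinj := injective_diff_of_eventuallyEq hsrc hgx
    -- The velocity of the segment, given in the chart at `p`, is pulled back to the tangent space
    -- at the moving point, and forms are transported the other way.
    set e := LinearEquiv.ofInjectiveEndo
      (diff (n := n) g₀ (φ.symm (z t)) : EuclideanSpace ℝ (Fin n) →ₗ[ℝ] _) hinj with he
    have hew : ∀ v, diff (n := n) g₀ (φ.symm (z t)) (e.symm v) = v := fun v =>
      e.apply_symm_apply v
    refine ⟨0, e.symm (T⁻¹ • d), hasDerivAt_const _ _, ?_, ?_⟩
    · refine hasVelocityAt_symm_comp hg₀ (p := p) (z := z) EventuallyEq.rfl (hRt (hzB t)) hgx ?_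
      have h1 : HasDerivAt (fun t => φ a + (t / T) • d) (T⁻¹ • d) t := by
        have := (((hasDerivAt_id t).div_const T).smul_const d).const_add (φ a)
        simpa using this
      refine HasDerivAt.congr_deriv (h1.congr_of_eventuallyEq ?_) (hew _).symm
      filter_upwards [Ioo_mem_nhds ht.1 ht.2] with s hs
      exact hze s (Ioo_subset_Icc_self hs)
    · refine hK.mem_velocitySet fun l => ?_
      set l' : EuclideanSpace ℝ (Fin n) →L[ℝ] ℝ :=
        l ∘L LinearMap.toContinuousLinearMap (e.symm : _ →ₗ[ℝ] EuclideanSpace ℝ (Fin n)) with hl'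
      have hll : l' ∘L diff (n := n) g₀ (φ.symm (z t)) = l := by
        ext v
        exact congrArg l (e.symm_apply_apply v)
      have h1 := (hs l').2
      rw [hll] at h1
      have h2 := hCl l'
      have h3 : l (e.symm (T⁻¹ • d)) = T⁻¹ * l' d := by
        rw [map_smul, map_smul]; rfl
      have h4 : l' d ≤ ‖l'‖ * ‖d‖ := (le_abs_self _).trans (l'.le_opNorm d)
      have h0 := K.supp_nonneg (φ.symm (z t)) l
      change l (e.symm (T⁻¹ • d)) ≤ K.supp (φ.symm (z t)) l
      rw [h3, inv_mul_le_iff₀ hT0]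
      have h5 : ‖l'‖ ≤ C * (2 * K.supp (φ.symm (z t)) l) :=
        h2.trans (mul_le_mul_of_nonneg_left h1 hC.le)
      calc l' d ≤ C * (2 * K.supp (φ.symm (z t)) l) * ‖d‖ := h4.trans (by gcongr)
        _ ≤ T * K.supp (φ.symm (z t)) l := by rw [hT]; linarith
  · change φ.symm (z 0) = a
    rw [hze 0 (left_mem_Icc.2 hT0.le), zero_div, zero_smul, add_zero, φ.left_inv ha.1]
  · change φ.symm (z T) = b
    rw [hze T (right_mem_Icc.2 hT0.le), div_self hT0.ne', one_smul, hd, add_sub_cancel,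
      φ.left_inv hb.1]

/-- Mutual reachability is transitive and holds near each point, so connectedness makes it global.
-/
theorem FullRank.avgMinTime_ne_top [ConnectedSpace M] {K : KeplerSystem n m M} (hK : K.FullRank)
    (x₀ x₁ : M) : K.avgMinTime x₀ x₁ ≠ ⊤ := by
  obtain ⟨T, hT⟩ : ∃ T, K.AvgReach T x₀ x₁ := by
    refine PreconnectedSpace.induction₂' (fun a b => ∃ T, K.AvgReach T a b) (fun p => ?_)
      ⟨fun a b c ⟨T₁, h₁⟩ ⟨T₂, h₂⟩ => ⟨T₁ + T₂, h₁.trans h₂⟩⟩ x₀ x₁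
    obtain ⟨N, hN, h⟩ := hK.exists_local_avgReach p
    filter_upwards [hN] with q hq
    exact ⟨h p (mem_of_mem_nhds hN) q hq, h q hq p (mem_of_mem_nhds hN)⟩
  exact hT.avgMinTime_ne_top

/-- Each average trajectory of duration `T` is followed in slow time at most `Λ ^ 8 * T`, for every
`Λ > 1`; then `Λ` tends to `1`. -/
theorem FullRank.limsup_minTime_le {K : KeplerSystem n m M} (hK : K.FullRank) (x₀ x₁ : M) :
    limsup (fun ε : ℝ => ENNReal.ofReal ε * K.minTime ε x₀ x₁) (𝓝[>] 0) ≤ K.avgMinTime x₀ x₁ := by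
  refine le_sInf ?_
  rintro _ ⟨T, hT, rfl, y, hy, rfl, rfl⟩
  have h : ∀ Λ : ℝ, 1 < Λ →
      limsup (fun ε : ℝ => ENNReal.ofReal ε * K.minTime ε (y 0) (y T)) (𝓝[>] 0) ≤
        ENNReal.ofReal (Λ ^ 8 * T) := fun Λ hΛ => by
    refine limsup_le_of_le (by isBoundedDefault) ?_
    filter_upwards [hK.eventually_kReach hT hy hΛ, self_mem_nhdsWithin] with ε ⟨T', hT', hr⟩ hε
    have hε0 : (0 : ℝ) < ε := hε
    calc _ ≤ ENNReal.ofReal ε * ENNReal.ofReal T' := by gcongr; exact hr.minTime_le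
      _ = ENNReal.ofReal (ε * T') := (ENNReal.ofReal_mul hε0.le).symm
      _ ≤ _ := ENNReal.ofReal_le_ofReal (by rwa [le_div_iff₀' hε0] at hT')
  have hlim : Tendsto (fun Λ : ℝ => ENNReal.ofReal (Λ ^ 8 * T)) (𝓝[>] 1) (𝓝 (ENNReal.ofReal T)) := by
    refine (ENNReal.continuous_ofReal.comp (by fun_prop : Continuous fun Λ : ℝ => Λ ^ 8 * T)).tendsto'
      1 _ (by simp) |>.mono_left nhdsWithin_le_nhds
  exact ge_of_tendsto hlim (by filter_upwards [self_mem_nhdsWithin] with Λ hΛ using h Λ hΛ)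

end KeplerSystem

/-! ### Convergence of minimizing solutions -/

namespace KeplerSystem

variable {n m : ℕ} {M : Type*} [TopologicalSpace M] [T2Space M] [SecondCountableTopology M]
  [ChartedSpace (EuclideanSpace ℝ (Fin n)) M] [IsManifold (𝓡 n) ∞ M]

/-- Families of minimizing solutions of the Kepler systems that remain in a compact set. -/
theorem FullRank.minimizing_family {K : KeplerSystem n m M} (hK : K.FullRank) {x₀ x₁ : M}
    (htop : K.avgMinTime x₀ x₁ ≠ ⊤) {T : ℝ → ℝ} {θ : ℝ → ℝ → ℝ} {x : ℝ → C(ℝ, M)} {S : Set M}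
    (hS : IsCompact S) (h : ∀ᶠ ε : ℝ in 𝓝[>] 0, K.IsMinimizing ε x₀ x₁ (T ε) (θ ε) (x ε) ∧
      ∀ t ∈ Icc 0 (T ε), x ε t ∈ S) :
    (∃ F : Set C(Icc (0 : ℝ) (K.avgMinTime x₀ x₁).toReal, M), IsCompact F ∧
      ∀ᶠ ε : ℝ in 𝓝[>] 0,
        (slowCurve ε (T ε) (x ε)).restrict (Icc 0 (K.avgMinTime x₀ x₁).toReal) ∈ F) ∧
    (∀ y : C(Icc (0 : ℝ) (K.avgMinTime x₀ x₁).toReal, M),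
      MapClusterPt y (𝓝[>] 0) (fun ε : ℝ =>
        (slowCurve ε (T ε) (x ε)).restrict (Icc 0 (K.avgMinTime x₀ x₁).toReal)) →
      K.IsAvgMinimizing x₀ x₁ (K.avgMinTime x₀ x₁).toReal
        (y.IccExtend ENNReal.toReal_nonneg)) ∧
    Tendsto (fun ε : ℝ => ENNReal.ofReal ε * K.minTime ε x₀ x₁) (𝓝[>] 0)
      (𝓝 (K.avgMinTime x₀ x₁)) := by
  set T₀ := (K.avgMinTime x₀ x₁).toReal with hT₀
  have hT₀e : ENNReal.ofReal T₀ = K.avgMinTime x₀ x₁ := ENNReal.ofReal_toReal htop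
  have hT₀0 : 0 ≤ T₀ := ENNReal.toReal_nonneg
  have hsol : ∀ᶠ ε in 𝓝[>] (0 : ℝ), 0 ≤ T ε ∧ K.IsSolution ε (T ε) (θ ε) (x ε) ∧ x ε 0 = x₀ ∧
      x ε (T ε) = x₁ ∧ ∀ t ∈ Icc 0 (T ε), x ε t ∈ S := by
    filter_upwards [h] with ε ⟨⟨h1, _, h2, h3, h4⟩, h5⟩
    exact ⟨h1, h2, h3, h4, h5⟩
  have htime : ∀ᶠ ε in 𝓝[>] (0 : ℝ),
      ENNReal.ofReal ε * K.minTime ε x₀ x₁ = ENNReal.ofReal (ε * T ε) := by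
    filter_upwards [h, self_mem_nhdsWithin] with ε h1 hε
    rw [ENNReal.ofReal_mul (le_of_lt hε), h1.1.2.1]
  obtain ⟨C, hC⟩ := exists_slowCurve_lipschitz hS K
  set F := {z : C(Icc (0 : ℝ) T₀, M) | (∀ t, z t ∈ S) ∧ ∀ f : M → ℝ,
    ContMDiff (𝓡 n) 𝓘(ℝ, ℝ) ∞ f → ∀ s t, |f (z s) - f (z t)| ≤ C f * |(s : ℝ) - t|}
  have hF : IsCompact F := isCompact_lipschitz_curves (n := n) hS C
  have hmem : ∀ᶠ ε : ℝ in 𝓝[>] 0, (slowCurve ε (T ε) (x ε)).restrict (Icc 0 T₀) ∈ F := by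
    filter_upwards [hsol, self_mem_nhdsWithin] with ε h1 hε
    obtain ⟨h2, h3⟩ := hC ε (T ε) (θ ε) (x ε) hε h1.1 h1.2.1 h1.2.2.2.2
    exact ⟨fun t => h2 t, fun f hf s t => h3 f hf s t⟩
  have hlim : Tendsto (fun ε : ℝ => ENNReal.ofReal ε * K.minTime ε x₀ x₁) (𝓝[>] 0)
      (𝓝 (K.avgMinTime x₀ x₁)) := by
    -- Along an ultrafilter the rescaled times converge in the compact space `[0, ∞]` and the slow
    -- curves converge in `F`, without extraction of subsequences. It remains to identify the limit
    -- `L` of the times.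
    rw [tendsto_iff_ultrafilter]
    intro 𝓤 h𝓤
    set 𝓥 := 𝓤.map (fun ε : ℝ => ENNReal.ofReal ε * K.minTime ε x₀ x₁) with h𝓥
    have hL : Tendsto (fun ε : ℝ => ENNReal.ofReal ε * K.minTime ε x₀ x₁) 𝓤 (𝓝 𝓥.lim) :=
      𝓥.le_nhds_lim
    set L := 𝓥.lim with hLdef
    have hL1 : L ≤ K.avgMinTime x₀ x₁ := by
      refine le_of_forall_gt fun c hc => ?_
      obtain ⟨c', hc', hcc⟩ := exists_between hc
      have hev := eventually_lt_of_limsup_lt ((hK.limsup_minTime_le x₀ x₁).trans_lt hc')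
      exact (le_of_tendsto hL (h𝓤 (hev.mono fun _ => le_of_lt))).trans_lt hcc
    have hLtop : L ≠ ⊤ := ne_top_of_le_ne_top htop hL1
    have hLr : Tendsto (fun ε => ε * T ε) 𝓤 (𝓝 L.toReal) := by
      refine ((ENNReal.tendsto_toReal hLtop).comp hL).congr' ?_
      filter_upwards [h𝓤 htime, h𝓤 hsol, h𝓤 self_mem_nhdsWithin] with ε h1 h2 h3
      rw [Function.comp_apply, h1, ENNReal.toReal_ofReal (mul_nonneg (le_of_lt h3) h2.1)]
    obtain ⟨y, -, hy⟩ := hF.ultrafilter_le_nhds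
      (𝓤.map fun ε => (slowCurve ε (T ε) (x ε)).restrict (Icc 0 T₀))
      (le_principal_iff.2 (h𝓤 hmem))
    obtain ⟨h1, h2, h3⟩ := hK.isAvgSolution_of_tendsto hS h𝓤 (h𝓤 hsol)
      ENNReal.toReal_nonneg (ENNReal.toReal_mono htop hL1) hLr hy
    -- The limit curve joins `x₀` to `x₁` in time `L` in the average system, so it competes for
    -- `T₀`.
    have hL2 : K.avgMinTime x₀ x₁ ≤ L :=
      sInf_le ⟨L.toReal, ENNReal.toReal_nonneg, (ENNReal.ofReal_toReal hLtop).symm, _, h1, h2, h3⟩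
    rw [← le_antisymm hL1 hL2]
    exact hL
  refine ⟨⟨F, hF, hmem⟩, fun y hy => ?_, hlim⟩
  obtain ⟨𝓤, h𝓤, hy⟩ := mapClusterPt_iff_ultrafilter.1 hy
  have hLr : Tendsto (fun ε => ε * T ε) 𝓤 (𝓝 T₀) := by
    refine ((ENNReal.tendsto_toReal htop).comp (hlim.mono_left h𝓤)).congr' ?_
    filter_upwards [h𝓤 htime, h𝓤 hsol, h𝓤 self_mem_nhdsWithin] with ε h1 h2 h3
    rw [Function.comp_apply, h1, ENNReal.toReal_ofReal (mul_nonneg (le_of_lt h3) h2.1)]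
  obtain ⟨h1, h2, h3⟩ := hK.isAvgSolution_of_tendsto hS h𝓤 (h𝓤 hsol) hT₀0 le_rfl hLr hy
  exact ⟨hT₀0, hT₀e, h1, h2, h3⟩

end KeplerSystem

theorem theorem4p6 {n m : ℕ} {M : Type*} [TopologicalSpace M] [T2Space M]
    [SecondCountableTopology M] [ConnectedSpace M]
    [ChartedSpace (EuclideanSpace ℝ (Fin n)) M] [IsManifold (𝓡 n) ∞ M]
    (K : KeplerSystem n m M) (hK : K.FullRank) (x₀ x₁ : M) :
    -- `T₀` is finite, `limsup ε T_ε ≤ T₀`, and `ε T_ε` is bounded as `ε → 0`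
    (K.avgMinTime x₀ x₁ ≠ ⊤ ∧
      limsup (fun ε : ℝ => ENNReal.ofReal ε * K.minTime ε x₀ x₁) (𝓝[>] 0)
        ≤ K.avgMinTime x₀ x₁ ∧
      ∃ C : ℝ, ∀ᶠ ε : ℝ in 𝓝[>] 0,
        ENNReal.ofReal ε * K.minTime ε x₀ x₁ ≤ ENNReal.ofReal C) ∧
    -- families of minimizing solutions that remain in a common compact set
    (∀ (T : ℝ → ℝ) (θ : ℝ → ℝ → ℝ) (x : ℝ → C(ℝ, M)) (S : Set M), IsCompact S →
      (∀ᶠ ε : ℝ in 𝓝[>] 0, K.IsMinimizing ε x₀ x₁ (T ε) (θ ε) (x ε) ∧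
        ∀ t ∈ Icc 0 (T ε), x ε t ∈ S) →
      (∃ F : Set C(Icc (0 : ℝ) (K.avgMinTime x₀ x₁).toReal, M), IsCompact F ∧
        ∀ᶠ ε : ℝ in 𝓝[>] 0,
          (slowCurve ε (T ε) (x ε)).restrict (Icc 0 (K.avgMinTime x₀ x₁).toReal) ∈ F) ∧
      (∀ y : C(Icc (0 : ℝ) (K.avgMinTime x₀ x₁).toReal, M),
        MapClusterPt y (𝓝[>] 0) (fun ε : ℝ =>
          (slowCurve ε (T ε) (x ε)).restrict (Icc 0 (K.avgMinTime x₀ x₁).toReal)) →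
        K.IsAvgMinimizing x₀ x₁ (K.avgMinTime x₀ x₁).toReal
          (y.IccExtend ENNReal.toReal_nonneg)) ∧
      Tendsto (fun ε : ℝ => ENNReal.ofReal ε * K.minTime ε x₀ x₁) (𝓝[>] 0)
        (𝓝 (K.avgMinTime x₀ x₁))) := by
  have htop := hK.avgMinTime_ne_top x₀ x₁
  have hlimsup := hK.limsup_minTime_le x₀ x₁
  refine ⟨⟨htop, hlimsup, (K.avgMinTime x₀ x₁).toReal + 1, ?_⟩, fun T θ x S hS h =>
    hK.minimizing_family htop hS h⟩
  -- Adding `1` to `T₀` gives a number strictly above the limsup, hence an eventual bound.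
  refine (eventually_lt_of_limsup_lt (hlimsup.trans_lt ?_)).mono fun _ => le_of_lt
  rw [ENNReal.lt_ofReal_iff_toReal_lt htop]
  exact lt_add_one _
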